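/- Conventions. A length function on a topological group $G$ is a continuous function $l:G\to[0,\infty)$ with $l(g^{-1})=l(g)$ and $l(gh)\le l(g)+l(h)$ for all $g,h\in G$. A (Hausdorff) locally compact group $G$ has strong Property (T) (with respect to Hilbert spaces) if for every length function $l$ on $G$ there is a sequence $(m_n)_n$ of compactly supported symmetric (finite, real) Borel measures on $G$ such that for every complex Hilbert space $H$ there is $t>0$ with the following property: for every strongly continuous representation $\pi$ of $G$ by bounded operators on $H$ such that, for some $L\ge 0$, $\|\pi(g)\|\le L e^{t\,l(g)}$ for all $g\in G$, the operators $\pi(m_n)=\int_G\pi(g)\,dm_n(g)$ converge in operator norm to a (not necessarily orthogonal) projection onto the subspace of $\pi(G)$-invariant vectors. Let $\Gamma$ be a finitely generated group and $H_1,\dots,H_k$ subgroups of $\Gamma$. The coned-off Cayley graph of $\Gamma$ over $H_1,\dots,H_k$, with respect to a finite generating set of $\Gamma$, is the Cayley graph to which one adds, for each $i$ and each left coset $gH_i$, a vertex $\widehat{gH_i}$ joined by an edge to every element of $gH_i$. A connected graph is hyperbolic if for some $\delta>0$ every side of every geodesic triangle lies in the $\delta$-neighbourhood of the union of the other two sides.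 A graph is uniformly fine if for every $L$ the number of simple loops of length at most $L$ containing a given edge is finite and bounded by a constant depending only on $L$. The group $\Gamma$ is hyperbolic relative to $(H_1,\dots,H_k)$ if its coned-off Cayley graph over $H_1,\dots,H_k$ with respect to some finite generating set is hyperbolic and uniformly fine. Corollary 1.4. Let $G$ be a locally compact group with strong Property (T), and let $\Gamma$ (a discrete group) be hyperbolic relative to subgroups $(H_1,\dots,H_k)$. Let $\varphi:G\to\Gamma$ be a continuous group morphism (continuity is automatic if $G$ is discrete). Then $\varphi(G)$ is finite or is contained in a conjugate $\gamma H_i\gamma^{-1}$ of one of the $H_i$. -/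

import Mathlib

open MeasureTheory Filter Topology

universe u v w

noncomputable section

/-! ### Strong Property (T) with respect to Hilbert spaces -/

/-- A length function on a topological group: a continuous function `l : G → ℝ₊` which is
symmetric and subadditive. -/
structure IsLengthFunction {G : Type*} [Group G] [TopologicalSpace G] (l : G → ℝ) : Prop where
  continuous : Continuous l
  nonneg : ∀ g, 0 ≤ l g
  inv : ∀ g, l g⁻¹ = l g
  mul_le : ∀ g h, l (g * h) ≤ l g + l h

/-- A (finite, real) Borel measure on `G` is compactly supported if its total variation is
concentrated on a compact set. -/
def MeasureTheory.SignedMeasure.IsCompactlySupported {G : Type*} [TopologicalSpace G]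
    [MeasurableSpace G] (m : SignedMeasure G) : Prop :=
  ∃ K : Set G, IsCompact K ∧ m.totalVariation Kᶜ = 0

/-- A (finite, real) Borel measure on `G` is symmetric if it is invariant under `g ↦ g⁻¹`. -/
def MeasureTheory.SignedMeasure.IsSymmetric {G : Type*} [Group G]
    [MeasurableSpace G] (m : SignedMeasure G) : Prop :=
  ∀ A : Set G, MeasurableSet A → m A⁻¹ = m A

/-- The integral of a vector valued function against a signed measure `m = m⁺ - m⁻`. -/
def signedIntegral {G E : Type*} [MeasurableSpace G] [NormedAddCommGroup E] [NormedSpace ℝ E]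
    (m : SignedMeasure G) (f : G → E) : E :=
  (∫ g, f g ∂m.toJordanDecomposition.posPart) - ∫ g, f g ∂m.toJordanDecomposition.negPart

/-- A representation of `G` by bounded operators on `H` is strongly continuous if all its orbit
maps `g ↦ π g x` are continuous. -/
def IsStronglyContinuous {G H : Type*} [Group G] [TopologicalSpace G] [NormedAddCommGroup H]
    [NormedSpace ℂ H] (π : G →* (H →L[ℂ] H)) : Prop :=
  ∀ x : H, Continuous fun g => π g x

/-- `T` is the operator `π(m) = ∫ π(g) dm(g)`, the integral being taken in the strong sense.
(For `m` compactly supported and `π` strongly continuous the integrals converge and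
exactly one such `T` exists.) -/
def IsIntegratedOperator {G H : Type*} [Group G] [MeasurableSpace G] [NormedAddCommGroup H]
    [NormedSpace ℂ H] (π : G →* (H →L[ℂ] H)) (m : SignedMeasure G) (T : H →L[ℂ] H) : Prop :=
  ∀ x : H, T x = signedIntegral m fun g => π g x

/-- `P` is a (not necessarily orthogonal) bounded projection onto the subspace of
`π(G)`-invariant vectors. -/
def IsProjectionOntoInvariants {G H : Type*} [Group G] [NormedAddCommGroup H]
    [NormedSpace ℂ H] (π : G →* (H →L[ℂ] H)) (P : H →L[ℂ] H) : Prop :=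
  (∀ x, P (P x) = P x) ∧ Set.range P = {x | ∀ g, π g x = x}

/-- Strong Property (T) with respect to (complex) Hilbert spaces: for every length function `l`
there is a sequence `m n` of compactly supported symmetric Borel measures such that, for every
Hilbert space `H`, there is `t > 0` such that for every strongly continuous representation `π` on
`H` with `‖π g‖ ≤ L * exp (t * l g)` for some `L`, the operators `π(m n)` converge in operator norm
to a projection onto the invariant vectors. -/
def StrongPropertyT (G : Type u) [Group G] [TopologicalSpace G] [MeasurableSpace G] : Prop :=
  ∀ l : G → ℝ, IsLengthFunction l →
    ∃ m : ℕ → SignedMeasure G,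
      (∀ n, (m n).IsCompactlySupported ∧ (m n).IsSymmetric) ∧
      ∀ (H : Type v) [NormedAddCommGroup H] [InnerProductSpace ℂ H] [CompleteSpace H],
        ∃ t : ℝ, 0 < t ∧
          ∀ π : G →* (H →L[ℂ] H), IsStronglyContinuous π →
            (∃ L : ℝ, 0 ≤ L ∧ ∀ g, ‖π g‖ ≤ L * Real.exp (t * l g)) →
            ∃ (T : ℕ → H →L[ℂ] H) (P : H →L[ℂ] H),
              (∀ n, IsIntegratedOperator π (m n) (T n)) ∧
              IsProjectionOntoInvariants π P ∧
              Tendsto T atTop (𝓝 P)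

/-! ### Hyperbolic and uniformly fine graphs -/

/-- A walk is geodesic if its length is the distance between its endpoints. -/
def SimpleGraph.Walk.IsGeodesicWalk {V : Type*} {X : SimpleGraph V} {x y : V}
    (p : X.Walk x y) : Prop :=
  p.length = X.dist x y

/-- A graph is hyperbolic if it is connected and, for some `δ > 0`, every side of every geodesic
triangle lies in the `δ`-neighbourhood of the union of the other two sides. (The triple of corners
is arbitrary, so it is enough to speak of the side `p`.) -/
def SimpleGraph.IsGromovHyperbolic {V : Type*} (X : SimpleGraph V) : Prop :=
  X.Connected ∧ ∃ δ : ℝ, 0 < δ ∧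
    ∀ (x y z : V) (p : X.Walk x y) (q : X.Walk y z) (r : X.Walk x z),
      p.IsGeodesicWalk → q.IsGeodesicWalk → r.IsGeodesicWalk →
      ∀ a ∈ p.support, ∃ b, (b ∈ q.support ∨ b ∈ r.support) ∧ (X.dist a b : ℝ) ≤ δ

/-- The simple simplicial loops of length at most `L` containing the edge `e`; a simple loop is
recorded by its set of edges. -/
def SimpleGraph.simpleLoopsThrough {V : Type*} (X : SimpleGraph V) (e : Sym2 V) (L : ℕ) :
    Set (Set (Sym2 V)) :=
  {C | ∃ (v : V) (p : X.Walk v v),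
    p.IsCycle ∧ p.length ≤ L ∧ e ∈ p.edges ∧ C = {f | f ∈ p.edges}}

/-- A graph is uniformly fine if the number of simple loops of length at most `L` containing a
given edge is finite and bounded by a function of `L` only. -/
def SimpleGraph.IsUniformlyFine {V : Type*} (X : SimpleGraph V) : Prop :=
  ∃ φ : ℕ → ℕ, ∀ e ∈ X.edgeSet, ∀ L : ℕ,
    (X.simpleLoopsThrough e L).Finite ∧ (X.simpleLoopsThrough e L).ncard ≤ φ L

/-! ### Relatively hyperbolic groups -/

/-- The coned-off Cayley graph of `Γ` with respect to `S`, over the subgroups `H i`: the Cayley graph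
(with edges `{g, g * s}`, `s ∈ S`), to which a new vertex is added for each `i` and each left coset of
`H i`, joined by an edge to each element of that coset. -/
def conedOffCayleyGraph {Γ ι : Type*} [Group Γ] (H : ι → Subgroup Γ) (S : Set Γ) :
    SimpleGraph (Γ ⊕ Σ i, Γ ⧸ H i) :=
  SimpleGraph.fromRel fun a b =>
    match a, b with
    | Sum.inl g, Sum.inl h => g⁻¹ * h ∈ S
    | Sum.inl g, Sum.inr c => (QuotientGroup.mk g : Γ ⧸ H c.1) = c.2
    | Sum.inr _, _ => False

/-- `Γ` is hyperbolic relative to the subgroups `H i`: `Γ` is finitely generated and one of its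
coned-off Cayley graphs with respect to a finite generating set is hyperbolic and uniformly fine. -/
def IsRelativelyHyperbolic {Γ ι : Type*} [Group Γ] (H : ι → Subgroup Γ) : Prop :=
  ∃ S : Set Γ, S.Finite ∧ Subgroup.closure S = ⊤ ∧
    (conedOffCayleyGraph H S).IsGromovHyperbolic ∧ (conedOffCayleyGraph H S).IsUniformlyFine

end

/-! Suppose the image Λ of `φ` is infinite. The plan is to let strong Property (T) produce an
invariant vector in a Hilbert space built from the coned-off graph, and to read off from it a single
cone point at which Λ accumulates. That point is then fixed by `φ(G)`, and its stabiliser is a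
conjugate of some `H i`.

Geometry. The graph is locally infinite at cone points, so a word metric `D` is carried along. Its
finite generating set is enlarged by fineness so that two neighbours of a cone point joined by a few
geodesics avoiding it are at `D`-distance at most 1 (`ConedGeometry.D_chain`,
`exists_conedGeometry`). A flag is a group element, or a cone point with a marked neighbour. From a
flag one sees a finite set of vertices, and points `z` are grouped into finitely many classes
according to their horofunctions on that set (`SameView`).

Analysis. A finitely supported function on Γ is measured by the squares of its masses on all view
classes, with weights decaying exponentially in the `reach` of the class from a base point. The key
recursion `exists_closer_flag` moves a flag towards the base point, so masses of classes grow only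
linearly with the distance of the flag (`norm_massOn_le`). Hence changing the base point costs a
cubic factor in the squared norm (`exists_massNormSq_le`), and translation has polynomial growth.
Strong Property (T) gives an invariant vector of total mass 1
(`StrongPropertyT.exists_invariant_masses`).

Conclusion. At each `g` some view class carries a definite part of this vector. Invariance and
summability force these classes to escape from Λ and from 1 (`exists_escaping`). By hyperbolicity
such escape is incompatible with an infinite Λ unless geodesics to Λ make unbounded jumps at a cone
point (`exists_isLimitCone`). The same escape makes this cone point unique (`isLimitCone_unique`).
-/

open Sum
open scoped ENNReal NNReal

noncomputable section

/-! ### Geodesic intervals, slim triangles, and detours around a vertex. -/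

namespace SimpleGraph

variable {V : Type*} {X : SimpleGraph V}

/-- `w` lies on a geodesic from `x` to `y`. -/
def Btw (X : SimpleGraph V) (x w y : V) : Prop := X.dist x w + X.dist w y = X.dist x y

theorem Btw.symm {x w y : V} (h : X.Btw x w y) : X.Btw y w x := by
  unfold Btw at *
  rw [X.dist_comm (u := y) (v := w), X.dist_comm (u := w) (v := x), X.dist_comm (u := y) (v := x)]
  omega

theorem btw_left (x y : V) : X.Btw x x y := by simp [Btw]

theorem btw_right (x y : V) : X.Btw x y y := by simp [Btw]

theorem Btw.trans_left (hc : X.Connected) {x u w y : V} (h : X.Btw x w y) (h' : X.Btw x u w) :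
    X.Btw x u y ∧ X.Btw u w y := by
  unfold Btw at *
  have h1 := hc.dist_triangle (u := u) (v := w) (w := y)
  have h2 := hc.dist_triangle (u := x) (v := u) (w := y)
  omega

theorem Btw.trans_right (hc : X.Connected) {x u w y : V} (h : X.Btw x w y) (h' : X.Btw w u y) :
    X.Btw x u y ∧ X.Btw x w u := by
  have := h.symm.trans_left hc h'.symm
  exact ⟨this.1.symm, this.2.symm⟩

theorem btw_self_iff (hc : X.Connected) {x w : V} : X.Btw x w x ↔ w = x := by
  unfold Btw
  rw [X.dist_comm (u := w), dist_self]
  constructor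
  · intro h
    exact ((hc.dist_eq_zero_iff).1 (by omega : X.dist x w = 0)).symm
  · rintro rfl; simp

theorem exists_btw_dist (hc : X.Connected) {x y : V} {n : ℕ} (hn : n ≤ X.dist x y) :
    ∃ w, X.Btw x w y ∧ X.dist x w = n := by
  obtain ⟨p, hp⟩ := hc.exists_walk_length_eq_dist x y
  have h1 := X.dist_le (p.take n)
  have h2 := X.dist_le (p.drop n)
  have h3 := hc.dist_triangle (u := x) (v := p.getVert n) (w := y)
  rw [Walk.take_length] at h1
  rw [Walk.drop_length] at h2
  have h4 : min n p.length = n := by omega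
  refine ⟨p.getVert n, ?_, ?_⟩
  · unfold Btw; omega
  · omega

theorem exists_geodesic_avoiding (hc : X.Connected) {x v y : V} (h : ¬ X.Btw x v y) :
    ∃ p : X.Walk x y, v ∉ p.support ∧ p.length = X.dist x y := by
  classical
  obtain ⟨p, hp⟩ := hc.exists_walk_length_eq_dist x y
  refine ⟨p, fun hv => h ?_, hp⟩
  have h1 := X.dist_le (p.takeUntil v hv)
  have h2 := X.dist_le (p.dropUntil v hv)
  have h3 := hc.dist_triangle (u := x) (v := v) (w := y)
  have h4 := congrArg Walk.length (p.take_spec hv)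
  rw [Walk.length_append] at h4
  unfold Btw; omega

theorem exists_adj_dist_succ (hc : X.Connected) {x y : V} (h : x ≠ y) :
    ∃ w, X.Adj w y ∧ X.dist x w + 1 = X.dist x y := by
  have h0 := hc.pos_dist_of_ne h
  obtain ⟨w, hw, hd⟩ := exists_btw_dist hc (x := x) (y := y) (n := X.dist x y - 1) (by omega)
  unfold Btw at hw
  exact ⟨w, dist_eq_one_iff_adj.1 (by omega), by omega⟩

/-- Geodesic triangles are `δ`-slim, expressed by intervals. -/
def Slim (X : SimpleGraph V) (δ : ℕ) : Prop :=
  ∀ x y z a : V, X.Btw x a z → ∃ b, (X.Btw x b y ∨ X.Btw y b z) ∧ X.dist a b ≤ δ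

theorem IsGeodesicWalk.btw_of_mem (hc : X.Connected) {x y v : V} {p : X.Walk x y}
    (hp : p.IsGeodesicWalk) (hv : v ∈ p.support) : X.Btw x v y := by
  classical
  have h1 := X.dist_le (p.takeUntil v hv)
  have h2 := X.dist_le (p.dropUntil v hv)
  have h3 := hc.dist_triangle (u := x) (v := v) (w := y)
  have h4 := congrArg Walk.length (p.take_spec hv)
  rw [Walk.length_append] at h4
  unfold Walk.IsGeodesicWalk at hp
  unfold Btw; omega

theorem IsGromovHyperbolic.exists_slim (h : X.IsGromovHyperbolic) : ∃ δ, X.Slim δ := by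
  obtain ⟨hc, δ, -, h⟩ := h
  refine ⟨⌈δ⌉₊, fun x y z a ha => ?_⟩
  obtain ⟨p₁, hp₁⟩ := hc.exists_walk_length_eq_dist x a
  obtain ⟨p₂, hp₂⟩ := hc.exists_walk_length_eq_dist a z
  obtain ⟨q, hq⟩ := hc.exists_walk_length_eq_dist x y
  obtain ⟨r, hr⟩ := hc.exists_walk_length_eq_dist y z
  have hp : (p₁.append p₂).IsGeodesicWalk := by
    unfold Walk.IsGeodesicWalk; rw [Walk.length_append, hp₁, hp₂]; exact ha
  have hrr : r.reverse.IsGeodesicWalk := by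
    unfold Walk.IsGeodesicWalk; rw [Walk.length_reverse, hr, X.dist_comm]
  obtain ⟨b, hb, hd⟩ := h x z y (p₁.append p₂) r.reverse q hp hrr hq a (by simp)
  refine ⟨b, ?_, ?_⟩
  · rcases hb with hb | hb
    · exact Or.inr (IsGeodesicWalk.btw_of_mem hc hrr hb).symm
    · exact Or.inl (IsGeodesicWalk.btw_of_mem hc hq hb)
  · exact_mod_cast hd.trans (Nat.le_ceil δ)

/-- `x` and `y` are joined by a chain of `n` geodesic intervals avoiding `v`. -/
def AvoidChain (X : SimpleGraph V) (v : V) : ℕ → V → V → Prop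
  -- Requiring `x ≠ v` for the empty chain lets every chain be padded with constant intervals, as in
  -- `AvoidChain.mono`.
  | 0, x, y => x = y ∧ x ≠ v
  | n + 1, x, y => ∃ w, ¬ X.Btw x v w ∧ AvoidChain X v n w y

theorem AvoidChain.cons {v x w y : V} {n : ℕ} (h : ¬ X.Btw x v w) (h' : X.AvoidChain v n w y) :
    X.AvoidChain v (n + 1) x y := ⟨w, h, h'⟩

theorem AvoidChain.nil {v x : V} (h : x ≠ v) : X.AvoidChain v 0 x x := ⟨rfl, h⟩

theorem AvoidChain.single {v x y : V} (h : ¬ X.Btw x v y) : X.AvoidChain v 1 x y :=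
  ⟨y, h, rfl, fun e => h (e ▸ btw_right x y)⟩

theorem AvoidChain.append {v x y z : V} {m n : ℕ} (h : X.AvoidChain v m x y)
    (h' : X.AvoidChain v n y z) : X.AvoidChain v (m + n) x z := by
  induction m generalizing x with
  | zero => obtain ⟨rfl, -⟩ := h; simpa using h'
  | succ m ih =>
    obtain ⟨w, hw, h⟩ := h
    rw [Nat.succ_add_eq_add_succ, Nat.add_succ]
    exact ⟨w, hw, ih h⟩

theorem AvoidChain.snoc {v x y z : V} {m : ℕ} (h : X.AvoidChain v m x y)
    (h' : ¬ X.Btw y v z) : X.AvoidChain v (m + 1) x z := h.append (.single h')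

theorem AvoidChain.ne_left {v x y : V} {n : ℕ} (h : X.AvoidChain v n x y) : x ≠ v := by
  cases n with
  | zero => exact h.2
  | succ n => obtain ⟨w, hw, -⟩ := h; exact fun e => hw (e ▸ btw_left x w)

theorem AvoidChain.mono (hc : X.Connected) {v x y : V} {m n : ℕ} (hmn : m ≤ n)
    (h : X.AvoidChain v m x y) : X.AvoidChain v n x y := by
  induction n, hmn using Nat.le_induction with
  | base => exact h
  | succ n _ ih => exact ⟨x, fun hb => ih.ne_left ((btw_self_iff hc).1 hb).symm, ih⟩

/-- Cut the polygon into triangles with apex `x`; each costs `δ`. As soon as the nearby point falls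
on a side of the chain, the rest of the chain from there still avoids `v`, because subintervals of
an interval avoiding `v` avoid it. -/
theorem Slim.exists_near_chain (hc : X.Connected) {δ : ℕ} (hδ : X.Slim δ) {v y : V} {n : ℕ} :
    ∀ {x x₁ a : V}, X.AvoidChain v n x₁ y → X.Btw x a x₁ →
      ∃ c, X.dist a c ≤ n * δ ∧ (X.Btw x c y ∨ X.AvoidChain v n c y) := by
  induction n with
  | zero =>
    rintro x x₁ a ⟨rfl, -⟩ ha
    exact ⟨a, by simp, Or.inl ha⟩
  | succ n ih =>
    rintro x x₁ a ⟨x₂, h₂, h⟩ ha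
    obtain ⟨c, hc' | hc', hd⟩ := hδ x x₂ x₁ a ha
    · obtain ⟨c', hd', hh⟩ := ih h hc'
      refine ⟨c', ?_, hh.imp id (AvoidChain.mono hc (by omega))⟩
      have := hc.dist_triangle (u := a) (v := c) (w := c')
      rw [Nat.succ_mul]; omega
    · refine ⟨c, by rw [Nat.succ_mul]; omega, Or.inr ⟨x₂, fun hb => h₂ ?_, h⟩⟩
      exact (hc'.symm.trans_right hc hb).1

/-- In a slim graph, a chain of geodesics avoiding `v` between nearby points can be replaced by a
short walk avoiding `v`. -/
theorem Slim.exists_walk_avoiding (hc : X.Connected) {δ : ℕ} (hδ : X.Slim δ) (n : ℕ) :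
    ∀ m, ∃ ℓ, ∀ v x y, X.AvoidChain v n x y → X.dist x y ≤ m →
      ∃ p : X.Walk x y, v ∉ p.support ∧ p.length ≤ ℓ := by
  induction n with
  | zero =>
    refine fun m => ⟨0, ?_⟩
    rintro v x y ⟨rfl, h⟩ -
    exact ⟨.nil, by simpa using h.symm, by simp⟩
  | succ n ih =>
    intro m
    obtain ⟨k, hk⟩ : ∃ k, k = n * δ := ⟨_, rfl⟩
    obtain ⟨ℓ, hℓ⟩ := ih (m + (m + 3 * k + 2) + k)
    refine ⟨m + 3 * k + 2 + k + ℓ, ?_⟩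
    rintro v x y ⟨x₁, h₁, h⟩ hxy
    by_cases hs : X.dist x x₁ ≤ m + 3 * k + 2
    · obtain ⟨p, hp, hpl⟩ := exists_geodesic_avoiding hc h₁
      have h3 := hc.dist_triangle (u := x₁) (v := x) (w := y)
      rw [X.dist_comm (u := x₁) (v := x)] at h3
      obtain ⟨q, hq, hql⟩ := hℓ v x₁ y h (by omega)
      refine ⟨p.append q, ?_, ?_⟩
      · rw [Walk.mem_support_append_iff]; tauto
      · rw [Walk.length_append]; omega
    -- The first side is long. Leave it at `b`, jump to the remaining chain by a geodesic of length
    -- at most `k`, too short to reach `v`, and use the induction hypothesis. The lower bound on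
    -- `dist x b` rules out a jump to the interval `[x, y]`, whose length is at most `m`.
    · have key : ∀ b, X.Btw x b x₁ → m + k + 1 ≤ X.dist x b → X.dist x b ≤ m + 3 * k + 2 →
          k < X.dist b v → ∃ p : X.Walk x y, v ∉ p.support ∧ p.length ≤ m + 3 * k + 2 + k + ℓ := by
        intro b hb hb1 hb2 hbv
        obtain ⟨c, hd, hc' | hc'⟩ := hδ.exists_near_chain hc h hb
        · exfalso
          have h3 := hc.dist_triangle (u := x) (v := c) (w := b)
          rw [X.dist_comm (u := c) (v := b)] at h3
          unfold Btw at hc'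
          omega
        · have hxb : ¬ X.Btw x v b := fun hh => h₁ (hb.trans_left hc hh).1
          have hbc : ¬ X.Btw b v c := fun hh => by
            unfold Btw at hh; omega
          obtain ⟨p, hp, hpl⟩ := exists_geodesic_avoiding hc hxb
          obtain ⟨r, hr, hrl⟩ := exists_geodesic_avoiding hc hbc
          have h3 := hc.dist_triangle (u := c) (v := x) (w := y)
          have h4 := hc.dist_triangle (u := c) (v := b) (w := x)
          rw [X.dist_comm (u := c) (v := b), X.dist_comm (u := b) (v := x)] at h4
          obtain ⟨q, hq, hql⟩ := hℓ v c y hc' (by omega)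
          refine ⟨p.append (r.append q), ?_, ?_⟩
          · simp only [Walk.mem_support_append_iff]; tauto
          · simp only [Walk.length_append]; omega
      -- Two candidates at distance `2k + 1` from each other: `v` cannot be within `k` of both.
      obtain ⟨b₂, hb₂, hd₂⟩ := exists_btw_dist hc (n := m + 3 * k + 2) (by omega : _ ≤ X.dist x x₁)
      obtain ⟨b₁, hb₁, hd₁⟩ := exists_btw_dist hc (n := m + k + 1) (by omega : _ ≤ X.dist x b₂)
      by_cases hv : k < X.dist b₁ v
      · exact key b₁ (hb₂.trans_left hc hb₁).1 (by omega) (by omega) hv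
      · refine key b₂ hb₂ (by omega) (by omega) ?_
        have h3 := hc.dist_triangle (u := b₁) (v := v) (w := b₂)
        rw [X.dist_comm (u := v) (v := b₂)] at h3
        unfold Btw at hb₁
        omega

end SimpleGraph

/-! ### Coned geometry: jumps at cone points measured by the metric `D`. -/

/-- A slim graph on group elements and cone points, with a metric `D` on the group elements which
controls the jumps of geodesics at cone points. -/
structure ConedGeometry {Γ Z : Type*} (X : SimpleGraph (Γ ⊕ Z)) (D : Γ → Γ → ℕ) (δ N : ℕ) :
    Prop where
  conn : X.Connected
  not_adj : ∀ c c' : Z, ¬ X.Adj (inr c) (inr c')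
  slim : X.Slim δ
  D_comm : ∀ a b, D a b = D b a
  D_tri : ∀ a b c, D a c ≤ D a b + D b c
  D_eq_zero : ∀ a b, D a b = 0 ↔ a = b
  D_adj : ∀ a b, X.Adj (inl a) (inl b) → D a b ≤ 1
  D_step : ∀ a b k, D a b ≤ k + 1 → ∃ c, D a c ≤ 1 ∧ D c b ≤ k
  dist_le : ∀ a b, X.dist (inl a) (inl b) ≤ 2 * D a b
  -- This is the form in which fineness is used in all the geometric arguments.
  D_chain : ∀ c a b n, n ≤ N → X.Adj (inl a) (inr c) → X.Adj (inl b) (inr c) →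
    X.AvoidChain (inr c) n (inl a) (inl b) → D a b ≤ 1

/-- `a` is the last vertex before the cone point `c` on a geodesic from `x`. -/
def SimpleGraph.Entry {Γ Z : Type*} (X : SimpleGraph (Γ ⊕ Z)) (x : Γ ⊕ Z) (c : Z) (a : Γ) : Prop :=
  X.Adj (inl a) (inr c) ∧ X.dist x (inl a) + 1 = X.dist x (inr c)

namespace ConedGeometry

variable {Γ Z : Type*} {X : SimpleGraph (Γ ⊕ Z)} {D : Γ → Γ → ℕ} {δ N : ℕ}

theorem _root_.SimpleGraph.Entry.not_btw {x : Γ ⊕ Z} {c : Z} {a : Γ} (h : X.Entry x c a) :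
    ¬ X.Btw x (inr c) (inl a) := by
  have := h.2
  unfold SimpleGraph.Btw
  omega

theorem _root_.SimpleGraph.Entry.btw {x : Γ ⊕ Z} {c : Z} {a : Γ} (h : X.Entry x c a) :
    X.Btw x (inl a) (inr c) := by
  have := h.2
  have := SimpleGraph.dist_eq_one_iff_adj.2 h.1
  unfold SimpleGraph.Btw
  omega

theorem _root_.SimpleGraph.Entry.self {c : Z} {a : Γ} (h : X.Adj (inl a) (inr c)) :
    X.Entry (inl a) c a :=
  ⟨h, by rw [SimpleGraph.dist_self, SimpleGraph.dist_eq_one_iff_adj.2 h]⟩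

section
variable (hX : ConedGeometry X D δ N)
include hX

theorem D_self (a : Γ) : D a a = 0 := (hX.D_eq_zero a a).2 rfl

theorem exists_entry {x : Γ ⊕ Z} {c : Z} (h : x ≠ inr c) : ∃ a, X.Entry x c a := by
  obtain ⟨w, hw, hd⟩ := SimpleGraph.exists_adj_dist_succ hX.conn h
  rcases w with a | c'
  · exact ⟨a, hw, hd⟩
  · exact absurd hw (hX.not_adj _ _)

theorem entry_extend {y w : Γ ⊕ Z} {c : Z} {b : Γ} (h : X.Btw y w (inr c)) (hb : X.Entry w c b) :
    X.Entry y c b := by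
  refine ⟨hb.1, ?_⟩
  have h1 := hb.2
  have h2 := hX.conn.dist_triangle (u := y) (v := w) (w := inl b)
  have h3 := hX.conn.dist_triangle (u := y) (v := inl b) (w := inr c)
  have h4 := SimpleGraph.dist_eq_one_iff_adj.2 hb.1
  unfold SimpleGraph.Btw at h
  omega

/-- The intervals `[a, x]` and `[y, b]` avoid `c` because `a` and `b` are entry points, so two links
close the chain up. Most applications go by contradiction: a large jump at `c` forces a geodesic to
pass through `c`. -/
theorem D_le_one {x y : Γ ⊕ Z} {c : Z} {a b : Γ} {n : ℕ} (ha : X.Entry x c a)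
    (h : X.AvoidChain (inr c) n x y) (hb : X.Entry y c b) (hn : n + 2 ≤ N) : D a b ≤ 1 := by
  refine hX.D_chain c a b (n + 1 + 1) (by omega) ha.1 hb.1 ?_
  exact .cons (fun hh => ha.not_btw hh.symm) (h.snoc hb.not_btw)

/-- Join `h` to `h'` by unit `D`-steps. Such a step has graph length at most 2, so it can meet `c`
only if both its ends are neighbours of `c`; then the chain is closed at one end and restarted at
the other, at a cost of 2. -/
theorem D_le_of_link {y : Γ ⊕ Z} {c : Z} {b h' : Γ} {m k : ℕ} :
    ∀ {x : Γ ⊕ Z} {a h : Γ} {n : ℕ}, X.Entry x c a → X.AvoidChain (inr c) n x (inl h) →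
    D h h' ≤ k → X.AvoidChain (inr c) m (inl h') y → X.Entry y c b → n + k + m + 2 ≤ N →
    D a b ≤ 2 * k + 1 := by
  induction k with
  | zero =>
    intro x a h n ha hc hk hm hb hN
    obtain rfl := (hX.D_eq_zero _ _).1 (Nat.le_zero.1 hk)
    have := hX.D_le_one ha (hc.append hm) hb (by omega)
    omega
  | succ k ih =>
    intro x a h n ha hc hk hm hb hN
    obtain ⟨h₁, hh₁, hk₁⟩ := hX.D_step _ _ _ hk
    by_cases hv : X.Btw (inl h) (inr c) (inl h₁)
    · have hd := hX.dist_le h h₁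
      have h1 := hX.conn.pos_dist_of_ne (show (inl h : Γ ⊕ Z) ≠ inr c by simp)
      have h2 := hX.conn.pos_dist_of_ne (show (inr c : Γ ⊕ Z) ≠ inl h₁ by simp)
      unfold SimpleGraph.Btw at hv
      have e1 : X.Adj (inl h) (inr c) := SimpleGraph.dist_eq_one_iff_adj.1 (by omega)
      have e2 : X.Adj (inr c) (inl h₁) := SimpleGraph.dist_eq_one_iff_adj.1 (by omega)
      have d1 := hX.D_le_one ha hc (.self e1) (by omega)
      have d2 := ih (n := 0) (.self e2.symm) (.nil (by simp)) hk₁ hm hb (by omega)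
      have d3 := hX.D_tri a h h₁
      have d4 := hX.D_tri a h₁ b
      omega
    · have := ih ha (hc.snoc hv) hk₁ hm hb (by omega)
      omega

/-- Peel off the last edge of a geodesic, or the last two if they pass through a cone point.
Ordinary edges cost at most 1 in `D` and passages at most `M`. -/
theorem D_le_mul_dist {M : ℕ} (hM : 1 ≤ M) {g : Γ} : ∀ {y : Γ},
    (∀ c a b, X.Btw (inl g) (inr c) (inl y) → X.Entry (inl g) c a → X.Entry (inl y) c b →
      D a b ≤ M) → D g y ≤ M * X.dist (inl g) (inl y) := by
  intro y
  induction hd : X.dist (inl g) (inl y) using Nat.strong_induction_on generalizing y with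
  | _ n ih =>
    intro h
    by_cases hgy : g = y
    · rw [(hX.D_eq_zero g y).2 hgy]; omega
    obtain ⟨w, hw, hwd⟩ := SimpleGraph.exists_adj_dist_succ hX.conn
      (show (inl g : Γ ⊕ Z) ≠ inl y by simpa using hgy)
    have hw1 := SimpleGraph.dist_eq_one_iff_adj.2 hw
    have hb : X.Btw (inl g) w (inl y) := by unfold SimpleGraph.Btw; omega
    have sub : ∀ w', X.Btw (inl g) (inl w') (inl y) → ∀ c a b, X.Btw (inl g) (inr c) (inl w') →
        X.Entry (inl g) c a → X.Entry (inl w') c b → D a b ≤ M := by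
      intro w' hw' c a b hc ha hb
      have := hw'.trans_left hX.conn hc
      exact h c a b this.1 ha (hX.entry_extend this.2.symm hb)
    rcases w with w | c
    · have h1 := ih _ (by omega) rfl (sub w hb)
      have h2 := hX.D_adj _ _ hw
      have h3 := hX.D_tri g w y
      have : M * n = M * X.dist (inl g) (inl w) + M := by
        rw [← hd, ← hwd]; ring
      omega
    · obtain ⟨a, ha⟩ := hX.exists_entry (show (inl g : Γ ⊕ Z) ≠ inr c by simp)
      have ha2 := ha.2
      have hba : X.Btw (inl g) (inl a) (inl y) := (hb.trans_left hX.conn ha.btw).1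
      have h1 := ih _ (by omega) rfl (sub a hba)
      have h2 := h c a y hb ha (.self hw.symm)
      have h3 := hX.D_tri g a y
      have : M * n = M * X.dist (inl g) (inl a) + M + M := by
        rw [← hd, ← hwd, ← ha2]; ring
      omega

/-- Geodesic triangles are thin with respect to `D`. -/
theorem thin (hN : 8 ≤ N) {x z g : Γ} {y : Γ ⊕ Z} (hg : X.Btw (inl x) (inl g) (inl z)) :
    ∃ w : Γ, (X.Btw (inl x) (inl w) y ∨ X.Btw y (inl w) (inl z)) ∧ D g w ≤ δ + 1 := by
  classical
  -- Choose `b` on the other two sides as near to `g` as possible. A cone point on the way from `g`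
  -- to `b` then lies on neither side, so a chain along the triangle goes around it and every jump
  -- on the way is at most 1.
  have hP : ∃ n, ∃ b, (X.Btw (inl x) b y ∨ X.Btw y b (inl z)) ∧ X.dist (inl g) b = n := by
    obtain ⟨b, hb, -⟩ := hX.slim (inl x) y (inl z) (inl g) hg
    exact ⟨_, b, hb, rfl⟩
  obtain ⟨b, hb, hbd⟩ := Nat.find_spec hP
  have hbδ : X.dist (inl g) b ≤ δ := by
    obtain ⟨b', hb', hd⟩ := hX.slim (inl x) y (inl z) (inl g) hg
    rw [hbd]
    exact (Nat.find_min' hP ⟨b', hb', rfl⟩).trans hd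
  have hmin : ∀ v, X.dist (inl g) v < X.dist (inl g) b →
      ¬ X.Btw (inl x) v y ∧ ¬ X.Btw y v (inl z) := by
    intro v hv
    have := Nat.find_min hP (hbd ▸ hv)
    exact ⟨fun h => this ⟨v, Or.inl h, rfl⟩, fun h => this ⟨v, Or.inr h, rfl⟩⟩
  -- Since `g` lies between `x` and `z`, a cone point cannot be on the way from `g` to both.
  have hside : ∀ c : Z, ¬ X.Btw (inl g) (inr c) (inl x) ∨ ¬ X.Btw (inl g) (inr c) (inl z) := by
    intro c
    by_contra! hh
    obtain ⟨h1, h2⟩ := hh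
    have := hX.conn.dist_triangle (u := inl x) (v := inr c) (w := inl z)
    have := hX.conn.pos_dist_of_ne (show (inl g : Γ ⊕ Z) ≠ inr c by simp)
    replace h1 := h1.symm
    unfold SimpleGraph.Btw at *
    rw [X.dist_comm (u := inr c) (v := inl g)] at h1
    omega
  have hout : ∀ c, X.dist (inl g) (inr c) < X.dist (inl g) b →
      X.AvoidChain (inr c) 3 (inl g) b := by
    intro c hc
    obtain ⟨h1, h2⟩ := hmin _ hc
    rcases hside c with hs | hs
    · rcases hb with hb | hb
      · exact .mono hX.conn (m := 2) (by omega)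
          (.cons hs (.single fun h => h1 (hb.trans_left hX.conn h).1))
      · exact .cons hs (.cons h1 (.single fun h => h2 (hb.trans_left hX.conn h).1))
    · rcases hb with hb | hb
      · exact .cons hs (.cons (fun h => h2 h.symm)
          (.single fun h => h1 (hb.symm.trans_left hX.conn h).1.symm))
      · exact .mono hX.conn (m := 2) (by omega)
          (.cons hs (.single fun h => h2 (hb.symm.trans_left hX.conn h).1.symm))
  have hD : ∀ w : Γ, X.Btw (inl g) (inl w) b → D g w ≤ X.dist (inl g) (inl w) := by
    intro w hw
    have := hX.D_le_mul_dist le_rfl (g := g) (y := w) ?_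
    · omega
    intro c a a' hc ha ha'
    have h1 := hw.trans_left hX.conn hc
    have h2 := hX.conn.pos_dist_of_ne (show (inr c : Γ ⊕ Z) ≠ inl w by simp)
    refine hX.D_le_one ha ((hout c ?_).snoc (z := inl w) ?_) ha' (by omega)
    · unfold SimpleGraph.Btw at hw hc; omega
    · intro hh
      replace h1 := h1.2
      unfold SimpleGraph.Btw at hh h1
      rw [X.dist_comm (u := b) (v := inl w), X.dist_comm (u := b) (v := inr c)] at hh
      omega
  rcases b with b | c
  · refine ⟨b, hb, ?_⟩
    have := hD b (SimpleGraph.btw_right _ _)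
    omega
  · obtain ⟨a, ha⟩ := hX.exists_entry (show (inl g : Γ ⊕ Z) ≠ inr c by simp)
    have hga := hD a ha.btw
    have ha2 := ha.2
    suffices H : ∃ w, (X.Btw (inl x) (inl w) y ∨ X.Btw y (inl w) (inl z)) ∧ D a w ≤ 1 by
      obtain ⟨w, hw, hd⟩ := H
      exact ⟨w, hw, by have := hX.D_tri g a w; omega⟩
    -- The nearest vertex is a cone point `c`, so a group element next to it on the same side is
    -- needed. The entry point from a suitable corner of the triangle is within 1 of `a`, which
    -- explains the `+ 1` in the constant.
    obtain ⟨ax, hax⟩ := hX.exists_entry (show (inl x : Γ ⊕ Z) ≠ inr c by simp)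
    obtain ⟨az, haz⟩ := hX.exists_entry (show (inl z : Γ ⊕ Z) ≠ inr c by simp)
    rcases hside c with hs | hs
    · by_cases h1 : X.Btw (inl x) (inr c) y
      · exact ⟨ax, Or.inl (h1.trans_left hX.conn hax.btw).1,
          hX.D_le_one ha (.single hs) hax (by omega)⟩
      · have h2 : X.Btw y (inr c) (inl z) := hb.resolve_left h1
        have hy : y ≠ inr c := fun e => h1 (e ▸ SimpleGraph.btw_right _ _)
        obtain ⟨ay, hay⟩ := hX.exists_entry hy
        exact ⟨ay, Or.inr (h2.trans_left hX.conn hay.btw).1,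
          hX.D_le_one ha (.cons hs (.single h1)) hay (by omega)⟩
    · by_cases h1 : X.Btw y (inr c) (inl z)
      · exact ⟨az, Or.inr (h1.symm.trans_left hX.conn haz.btw).1.symm,
          hX.D_le_one ha (.single hs) haz (by omega)⟩
      · have h2 : X.Btw (inl x) (inr c) y := hb.resolve_right h1
        have hy : y ≠ inr c := fun e => h1 (e ▸ SimpleGraph.btw_left _ _)
        obtain ⟨ay, hay⟩ := hX.exists_entry hy
        exact ⟨ay, Or.inl (h2.symm.trans_left hX.conn hay.btw).1.symm,
          hX.D_le_one ha (.cons hs (.single fun h => h1 h.symm)) hay (by omega)⟩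

end

end ConedGeometry

/-! ### Flags, views, and the transfer of views across a cone point. -/

/-- Parameters of the finite sets of points visible from a flag. -/
structure ViewParams where
  radius : ℕ
  budget : ℕ
  slope : ℕ

namespace SimpleGraph

variable {Γ Z : Type*}

/-- A flag is a group element, or a cone point together with one of its neighbours. -/
def IsFlag (X : SimpleGraph (Γ ⊕ Z)) (s : Γ ⊕ Z) (b : Γ) : Prop :=
  s = inl b ∨ ∃ c, s = inr c ∧ X.Adj (inl b) (inr c)

/-- The points visible from the flag `(s, b)`: the jumps at cone points on the way have to be
small, the more so the further they are from `s`. -/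
def view (X : SimpleGraph (Γ ⊕ Z)) (D : Γ → Γ → ℕ) (P : ViewParams) (s : Γ ⊕ Z) (b : Γ) :
    Set (Γ ⊕ Z) :=
  {y | X.dist s y ≤ P.radius ∧
    (∀ c a b', X.Btw s (inr c) y → X.Entry s c a → X.Entry y c b' →
      D a b' + P.slope * X.dist s (inr c) ≤ P.budget) ∧
    ∀ c b', s = inr c → X.Entry y c b' → D b b' ≤ P.budget}

/-- `z` and `z'` have the same horofunction on the set of points visible from `(s, b)`. -/
def SameView (X : SimpleGraph (Γ ⊕ Z)) (D : Γ → Γ → ℕ) (P : ViewParams) (s : Γ ⊕ Z) (b : Γ)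
    (z z' : Γ) : Prop :=
  ∀ y ∈ X.view D P s b,
    X.dist y (inl z) + X.dist s (inl z') = X.dist y (inl z') + X.dist s (inl z)

/-- All geodesics from `x` to `z` stay at `D`-distance more than `κ` from `b`. -/
def FarFrom (X : SimpleGraph (Γ ⊕ Z)) (D : Γ → Γ → ℕ) (κ : ℕ) (b x z : Γ) : Prop :=
  ∀ w, X.Btw (inl x) (inl w) (inl z) → κ < D b w

variable {X : SimpleGraph (Γ ⊕ Z)} {D : Γ → Γ → ℕ} {P : ViewParams} {s : Γ ⊕ Z} {b : Γ}

theorem SameView.symm {z z' : Γ} (h : X.SameView D P s b z z') : X.SameView D P s b z' z :=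
  fun y hy => (h y hy).symm

theorem SameView.btw {z z' : Γ} (h : X.SameView D P s b z z') {y w : Γ ⊕ Z}
    (hy : y ∈ X.view D P s b) (hw : w ∈ X.view D P s b) (hb : X.Btw y w (inl z)) :
    X.Btw y w (inl z') := by
  have h1 := h y hy
  have h2 := h w hw
  unfold Btw at *
  omega

end SimpleGraph

namespace ConedGeometry

variable {Γ Z : Type*} {X : SimpleGraph (Γ ⊕ Z)} {D : Γ → Γ → ℕ} {δ N : ℕ} {P : ViewParams}
  {s : Γ ⊕ Z} {b : Γ}

section
variable (hX : ConedGeometry X D δ N)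
include hX

theorem base_mem_view : s ∈ X.view D P s b := by
  refine ⟨by simp, ?_, ?_⟩
  · intro c a b' h ha _
    rw [SimpleGraph.btw_self_iff hX.conn] at h
    have := ha.2
    rw [h, SimpleGraph.dist_self] at this
    omega
  · rintro c b' rfl h
    have := h.2
    rw [SimpleGraph.dist_self] at this
    omega

theorem mem_view_of_btw {y w : Γ ⊕ Z} (hy : y ∈ X.view D P s b) (hw : X.Btw s w y) :
    w ∈ X.view D P s b := by
  obtain ⟨h1, h2, h3⟩ := hy
  refine ⟨by unfold SimpleGraph.Btw at hw; omega, ?_, ?_⟩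
  · intro c a b' hc ha hb
    have := hw.trans_left hX.conn hc
    exact h2 c a b' this.1 ha (hX.entry_extend this.2.symm hb)
  · rintro c b' rfl hb
    exact h3 c b' rfl (hX.entry_extend hw.symm hb)

/-- By `D_le_of_link` a cone point between `s` and `w` carries a jump of at most `2M + 1`. The
budget pays for this even at the full radius. -/
theorem mem_view_of_D_le {M : ℕ} (hN : M + 5 ≤ N) (hR : 2 * M + 1 ≤ P.radius)
    (hB : P.slope * P.radius + 2 * M + 1 ≤ P.budget) (hs : X.IsFlag s b) {w : Γ}
    (hw : D b w ≤ M) : inl w ∈ X.view D P s b := by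
  have hd := hX.dist_le b w
  have hsb : X.dist s (inl b) ≤ 1 := by
    rcases hs with rfl | ⟨c, rfl, hc⟩
    · simp
    · rw [SimpleGraph.dist_comm, SimpleGraph.dist_eq_one_iff_adj.2 hc]
  have htri := hX.conn.dist_triangle (u := s) (v := inl b) (w := inl w)
  have hR' : X.dist s (inl w) ≤ P.radius := by omega
  refine ⟨hR', ?_, ?_⟩
  · intro c a b' hc ha hb
    have hsc : s ≠ inr c := by
      rintro rfl
      have := ha.2
      rw [SimpleGraph.dist_self] at this
      omega
    have hsb' : ¬ X.Btw s (inr c) (inl b) := by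
      intro h
      have h1 := hX.conn.pos_dist_of_ne hsc
      have h2 := hX.conn.pos_dist_of_ne (show (inr c : Γ ⊕ Z) ≠ inl b by simp)
      unfold SimpleGraph.Btw at h
      omega
    have h1 := hX.D_le_of_link ha (.single hsb') hw (.nil (by simp)) hb (by omega)
    have h2 : P.slope * X.dist s (inr c) ≤ P.slope * P.radius :=
      Nat.mul_le_mul_left _ (by unfold SimpleGraph.Btw at hc; omega)
    omega
  · rintro c b' rfl hb
    rcases hs with h | ⟨c', h, hc⟩
    · cases h
    · cases h
      have := hX.D_le_of_link (.self hc) (.nil (by simp)) hw (.nil (by simp)) hb (by omega)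
      omega

/-- A distance to `z` splits at the vertex `w` where the geodesic meets the second view. Equality of
horofunctions at `w` gives one inequality, and exchanging `z` and `z'` gives the other. -/
theorem sameView_of_cover {s' : Γ ⊕ Z} {b' z z' : Γ} (h : X.SameView D P s' b' z z')
    (hc : ∀ ζ, ζ = z ∨ ζ = z' → ∀ y ∈ X.view D P s b,
      ∃ w ∈ X.view D P s' b', X.Btw y w (inl ζ)) : X.SameView D P s b z z' := by
  have key : ∀ y ∈ X.view D P s b,
      X.dist y (inl z) + X.dist s' (inl z') = X.dist y (inl z') + X.dist s' (inl z) := by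
    intro y hy
    obtain ⟨w, hw, hb⟩ := hc z (Or.inl rfl) y hy
    obtain ⟨w', hw', hb'⟩ := hc z' (Or.inr rfl) y hy
    have h1 := h w hw
    have h2 := h w' hw'
    have h3 := hX.conn.dist_triangle (u := y) (v := w) (w := inl z')
    have h4 := hX.conn.dist_triangle (u := y) (v := w') (w := inl z)
    unfold SimpleGraph.Btw at *
    omega
  intro y hy
  have h1 := key y hy
  have h2 := key s hX.base_mem_view
  omega

/-- If far points are seen from `(s, b)` through the cone point `c`, then their views from `(s, b)`
are determined by their views from `(c, b₁)`, apart from the view that sees nothing beyond `c`. -/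
theorem sameView_of_crossing (hN : 5 ≤ N) (hB : 3 ≤ P.budget) (hR : 1 ≤ P.radius)
    {c : Z} {b₁ z z'' z' : Γ}
    (hcl : ∀ y ∈ X.view D P s b, ¬ X.Btw y (inr c) (inl z) →
      X.Btw s (inr c) y ∧ ∀ b', X.Entry y c b' → D b' b₁ ≤ 1)
    (hcross : ∀ ζ a, X.Entry (inl ζ) c a → D a b₁ ≤ 2 → ∀ y ∈ X.view D P s b,
      ¬ X.Btw y (inr c) (inl ζ) → X.Btw s (inr c) y)
    (hz : ¬ ∀ y ∈ X.view D P s b, X.Btw y (inr c) (inl z))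
    (h : X.SameView D P s b z z'') (h' : X.SameView D P (inr c) b₁ z'' z') :
    X.SameView D P s b z'' z' := by
  push Not at hz
  obtain ⟨y₀, hy₀, hy₀z⟩ := hz
  obtain ⟨hsy₀, hb₀⟩ := hcl y₀ hy₀ hy₀z
  have hcY : inr c ∈ X.view D P s b := hX.mem_view_of_btw hy₀ hsy₀
  have hy₀z'' : ¬ X.Btw y₀ (inr c) (inl z'') := fun hh => hy₀z (h.symm.btw hy₀ hcY hh)
  obtain ⟨b₀, hb₀e⟩ := hX.exists_entry (x := y₀) (c := c)
    (fun e => hy₀z (e ▸ SimpleGraph.btw_left _ _))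
  obtain ⟨c₂, hc₂⟩ := hX.exists_entry (show (inl z'' : Γ ⊕ Z) ≠ inr c by simp)
  have hc₂b : D c₂ b₁ ≤ 2 := by
    have h1 := hX.D_le_one hc₂ (.single fun hh => hy₀z'' hh.symm) hb₀e (by omega)
    have h2 := hb₀ b₀ hb₀e
    have h3 := hX.D_tri c₂ b₀ b₁
    omega
  -- The neighbour `c₂` of `c` is visible from `(c, b₁)`, so equality of views there makes it an
  -- entry point for `z'` as well as for `z''`.
  have hc₂Y : inl c₂ ∈ X.view D P (inr c) b₁ := by
    have h1 := SimpleGraph.dist_eq_one_iff_adj.2 hc₂.1.symm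
    refine ⟨by omega, ?_, ?_⟩
    · intro e a b' he ha _
      exfalso
      have h2 := hX.conn.pos_dist_of_ne (show (inr e : Γ ⊕ Z) ≠ inl c₂ by simp)
      have h3 := ha.2
      unfold SimpleGraph.Btw at he
      omega
    · rintro e b' he hb'
      cases he
      have h3 := hb'.2
      rw [X.dist_comm (u := inl c₂) (v := inr c), h1] at h3
      have h4 : (inl c₂ : Γ ⊕ Z) = inl b' := (hX.conn.dist_eq_zero_iff).1 (by omega)
      cases h4
      rw [hX.D_comm]; omega
  have hz'e : X.Entry (inl z') c c₂ := by
    refine ⟨hc₂.1, ?_⟩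
    have h1 := h'.btw hX.base_mem_view hc₂Y hc₂.btw.symm
    have h2 := SimpleGraph.dist_eq_one_iff_adj.2 hc₂.1.symm
    unfold SimpleGraph.Btw at h1
    rw [X.dist_comm (u := inl z') (v := inr c), X.dist_comm (u := inl z') (v := inl c₂)]
    omega
  refine hX.sameView_of_cover h' ?_
  intro ζ hζ y hy
  have hζe : X.Entry (inl ζ) c c₂ := by
    rcases hζ with rfl | rfl
    · exact hc₂
    · exact hz'e
  by_cases hv : X.Btw y (inr c) (inl ζ)
  · exact ⟨inr c, hX.base_mem_view, hv⟩
  · have hsy := hcross ζ c₂ hζe hc₂b y hy hv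
    -- As `y` lies behind `c`, passing from `s` to `c` only lowers the slope terms. The new
    -- condition at `c` itself holds because the entry point of `y` is within 1 of `c₂`, hence
    -- within 3 of `b₁`.
    refine ⟨y, ?_, SimpleGraph.btw_left _ _⟩
    obtain ⟨h1, h2, h3⟩ := hy
    refine ⟨by unfold SimpleGraph.Btw at hsy; omega, ?_, ?_⟩
    · intro e a b' he ha hb'
      have h4 := hsy.trans_right hX.conn he
      have h5 := h2 e a b' h4.1 (hX.entry_extend h4.2 ha) hb'
      have h6 : P.slope * X.dist (inr c) (inr e) ≤ P.slope * X.dist s (inr e) :=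
        Nat.mul_le_mul_left _ (by have := h4.2; unfold SimpleGraph.Btw at this; omega)
      omega
    · rintro e b' he hb'
      cases he
      have h4 := hX.D_le_one hb' (.single hv) hζe (by omega)
      have h5 := hX.D_tri b' c₂ b₁
      rw [hX.D_comm]; omega

/-- When everything visible reaches the target through `c`, the horofunction is that of `c`. This is
the single exceptional view in the recursion. -/
theorem sameView_of_through {c : Z} {z z' : Γ}
    (hz : ∀ y ∈ X.view D P s b, X.Btw y (inr c) (inl z))
    (hz' : ∀ y ∈ X.view D P s b, X.Btw y (inr c) (inl z')) : X.SameView D P s b z z' := by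
  intro y hy
  have h1 := hz y hy
  have h2 := hz' y hy
  have h3 := hz s hX.base_mem_view
  have h4 := hz' s hX.base_mem_view
  unfold SimpleGraph.Btw at *
  omega

/-- Used to change the mark of a cone flag from `b` to the entry point `b₁` of `x`. If `[z, x]`
crossed `c`, the entry point of `z` would be far from `b`, yet within `budget + 1` of it by
visibility of `y`. So the chain `y, z, x` avoids `c`. -/
theorem crossing_recentre (hN : 5 ≤ N) {c : Z} {b₁ x z : Γ} {κ : ℕ} (hκ : P.budget + 1 ≤ κ)
    (hb₁ : X.Entry (inl x) c b₁) (hz : X.FarFrom D κ b x z) :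
    ∀ y ∈ X.view D P (inr c) b, ¬ X.Btw y (inr c) (inl z) →
      X.Btw (inr c) (inr c) y ∧ ∀ b', X.Entry y c b' → D b' b₁ ≤ 1 := by
  intro y hy hyz
  refine ⟨SimpleGraph.btw_left _ _, fun b' hb' => ?_⟩
  by_cases hzx : X.Btw (inl z) (inr c) (inl x)
  · exfalso
    obtain ⟨a₂, ha₂⟩ := hX.exists_entry (show (inl z : Γ ⊕ Z) ≠ inr c by simp)
    have h1 := hX.D_le_one hb' (.single hyz) ha₂ (by omega)
    have h2 := hy.2.2 c b' rfl hb'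
    have h3 := hz a₂ (hzx.trans_left hX.conn ha₂.btw).1.symm
    have h4 := hX.D_tri b b' a₂
    omega
  · exact hX.D_le_one hb' (.cons hyz (.single hzx)) hb₁ (by omega)

/-- If `[z, x]` crosses `c`, the entry point of `z` is far from `b`, hence from `a`, beyond what the
budget of a visible `y` allows. Otherwise `z` and `x` enter `c` side by side, and the jump from `a`
to `b₁` forces `y` to lie behind `c`, next to `b₁`. -/
theorem crossing_jump (hN : 5 ≤ N) {c : Z} {a b₁ x z : Γ} {κ K : ℕ}
    (hκ : K + P.budget + 2 ≤ κ) (hK : D b a ≤ K) (ha : X.Entry s c a)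
    (hb₁ : X.Entry (inl x) c b₁) (hJ : 3 < D a b₁) (hz : X.FarFrom D κ b x z) :
    ∀ y ∈ X.view D P s b, ¬ X.Btw y (inr c) (inl z) →
      X.Btw s (inr c) y ∧ ∀ b', X.Entry y c b' → D b' b₁ ≤ 1 := by
  intro y hy hyz
  obtain ⟨a₂, ha₂⟩ := hX.exists_entry (show (inl z : Γ ⊕ Z) ≠ inr c by simp)
  have hfar : X.Btw (inl z) (inr c) (inl x) → κ < D b a₂ := fun hzx =>
    hz a₂ (hzx.trans_left hX.conn ha₂.btw).1.symm
  have htri := hX.D_tri b a a₂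
  have hsy : X.Btw s (inr c) y := by
    by_contra hsy
    by_cases hzx : X.Btw (inl z) (inr c) (inl x)
    · have h1 := hX.D_le_one ha (.cons hsy (.single hyz)) ha₂ (by omega)
      have := hfar hzx
      omega
    · have h1 := hX.D_le_one ha (.cons hsy (.cons hyz (.single hzx))) hb₁ (by omega)
      omega
  refine ⟨hsy, fun b' hb' => ?_⟩
  by_cases hzx : X.Btw (inl z) (inr c) (inl x)
  · exfalso
    have h1 := hX.D_le_one hb' (.single hyz) ha₂ (by omega)
    have h2 := hy.2.1 c a b' hsy ha hb'
    have h3 := hfar hzx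
    have h4 := hX.D_tri a b' a₂
    omega
  · exact hX.D_le_one hb' (.cons hyz (.single hzx)) hb₁ (by omega)

theorem btw_of_jump (hN : 5 ≤ N) {c : Z} {a b₁ ζ a' : Γ} (ha : X.Entry s c a) (hJ : 3 < D a b₁)
    (ha' : X.Entry (inl ζ) c a') (hab : D a' b₁ ≤ 2) {y : Γ ⊕ Z}
    (hy : ¬ X.Btw y (inr c) (inl ζ)) : X.Btw s (inr c) y := by
  by_contra hsy
  have h1 := hX.D_le_one ha (.cons hsy (.single hy)) ha' (by omega)
  have h2 := hX.D_tri a a' b₁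
  omega

end

end ConedGeometry

/-! ### Transfer of views when a flag advances along a geodesic. -/

namespace ConedGeometry

variable {Γ Z : Type*} {X : SimpleGraph (Γ ⊕ Z)} {D : Γ → Γ → ℕ} {δ N : ℕ} {P : ViewParams}
  {s : Γ ⊕ Z} {b : Γ}

section
variable (hX : ConedGeometry X D δ N)
include hX

/-- A point at bounded distance that is not visible from `g` is hidden by a visible cone point with
a big jump. -/
theorem exists_first_violation {g : Γ} {y : Γ ⊕ Z} (hy : y ∉ X.view D P (inl g) g)
    (hd : X.dist (inl g) y ≤ P.radius) :
    ∃ c a b', X.Btw (inl g) (inr c) y ∧ X.Entry (inl g) c a ∧ X.Entry y c b' ∧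
      P.budget < D a b' + P.slope * X.dist (inl g) (inr c) ∧ inr c ∈ X.view D P (inl g) g := by
  classical
  have hex : ∃ n c a b', X.dist (inl g) (inr c) = n ∧ X.Btw (inl g) (inr c) y ∧
      X.Entry (inl g) c a ∧ X.Entry y c b' ∧
      P.budget < D a b' + P.slope * X.dist (inl g) (inr c) := by
    by_contra! hh
    refine hy ⟨hd, fun c a b' h1 h2 h3 => hh _ c a b' rfl h1 h2 h3, ?_⟩
    intro c b' h; cases h
  obtain ⟨c, a, b', hn, h1, h2, h3, h4⟩ := Nat.find_spec hex
  refine ⟨c, a, b', h1, h2, h3, h4, ?_, ?_, ?_⟩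
  · unfold SimpleGraph.Btw at h1; omega
  · intro e a₂ b₂ he ha₂ hb₂
    have hec : (inr e : Γ ⊕ Z) ≠ inr c := by
      intro hec
      have := hb₂.2
      rw [hec, SimpleGraph.dist_self] at this
      omega
    have h5 := hX.conn.pos_dist_of_ne hec
    have h6 := h1.trans_left hX.conn he
    have h7 := Nat.find_min hex (m := X.dist (inl g) (inr e)) (by
      unfold SimpleGraph.Btw at he; omega)
    by_contra hlt
    exact h7 ⟨e, a₂, b₂, rfl, h6.1, ha₂, hX.entry_extend h6.2.symm hb₂, by omega⟩
  · intro c b' h; cases h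

/-- If a geodesic from `b` to `ζ` passes near `g`, at a large distance from `b`, then every geodesic
from a point visible from `(s, b)` to `ζ` meets the set of points visible from `g`. -/
theorem exists_mem_view_btw {g w₀ ζ : Γ} {y : Γ ⊕ Z} (hN : 3 * δ + 20 ≤ N)
    (hR : 4 * δ + 5 ≤ P.radius) (hslope : 2 * δ + 5 ≤ P.slope)
    (hB : P.slope * P.radius + 4 * δ + 20 ≤ P.budget)
    (hs : X.IsFlag s b) (hsg : X.dist s (inl g) = X.dist s (inl b) + X.dist (inl b) (inl g))
    (hg : 8 * δ + 18 ≤ X.dist (inl b) (inl g))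
    (hw₀ : X.Btw (inl b) (inl w₀) (inl ζ)) (hw₀g : D w₀ g ≤ δ + 1)
    (hy : y ∈ X.view D P s b) : ∃ w ∈ X.view D P (inl g) g, X.Btw y w (inl ζ) := by
  by_cases hyg : y ∈ X.view D P (inl g) g
  · exact ⟨y, hyg, SimpleGraph.btw_left _ _⟩
  have hsb : X.dist s (inl b) ≤ 1 := by
    rcases hs with rfl | ⟨c, rfl, hc⟩
    · simp
    · rw [SimpleGraph.dist_comm, SimpleGraph.dist_eq_one_iff_adj.2 hc]
  have hdw := hX.dist_le w₀ g
  have t1 := hX.conn.dist_triangle (u := inl b) (v := inl w₀) (w := inl g)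
  by_cases hd : X.dist (inl g) y ≤ P.radius
  · obtain ⟨c, a, b', hc, ha, hb', hv, hcY⟩ := hX.exists_first_violation hyg hd
    refine ⟨inr c, hcY, ?_⟩
    by_contra hyz
    have hgc : P.slope * X.dist (inl g) (inr c) ≤ P.slope * P.radius :=
      Nat.mul_le_mul_left _ hcY.1
    have hgw : D g w₀ ≤ δ + 1 := by rw [hX.D_comm]; exact hw₀g
    -- `c` hides `y` from `g` by a big jump. If `[w₀, ζ]` avoids `c`, the chain through `ζ` makes
    -- that jump small.
    by_cases hwz : X.Btw (inl w₀) (inr c) (inl ζ)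
    · obtain ⟨a₅, ha₅⟩ := hX.exists_entry (show (inl w₀ : Γ ⊕ Z) ≠ inr c by simp)
      have hbw : ¬ X.Btw (inl b) (inr c) (inl w₀) := by
        intro hh
        have h1 := hX.conn.pos_dist_of_ne (show (inl w₀ : Γ ⊕ Z) ≠ inr c by simp)
        have h2 := (hw₀.trans_left hX.conn hh).2
        unfold SimpleGraph.Btw at h2 hwz
        rw [X.dist_comm (u := inr c) (v := inl w₀)] at h2
        omega
      have hbc := hw₀.trans_right hX.conn hwz
      have d1 := hX.D_le_of_link ha (.nil (by simp)) hgw (.nil (by simp)) ha₅ (by omega)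
      -- The slope matters here. Seen from `s` and from `g`, the jumps at `c` differ by at most `2δ
      -- + 4`, while `c` is at least one unit farther from `s`. A slope of `2δ + 5` therefore makes
      -- a jump tolerated from `s` tolerated from `g`.
      by_cases hsy : X.Btw s (inr c) y
      · have hsc : s ≠ inr c := by
          rintro rfl
          have h1 := hbc.2
          have h2 := hX.dist_le b w₀
          unfold SimpleGraph.Btw at h1
          rw [X.dist_comm (u := inl b) (v := inr c)] at h1
          have h3 := hX.conn.pos_dist_of_ne (show (inl w₀ : Γ ⊕ Z) ≠ inr c by simp)
          omega
        have hsb' : ¬ X.Btw s (inr c) (inl b) := by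
          intro h
          have h1 := hX.conn.pos_dist_of_ne hsc
          have h2 := hX.conn.pos_dist_of_ne (show (inr c : Γ ⊕ Z) ≠ inl b by simp)
          unfold SimpleGraph.Btw at h
          omega
        obtain ⟨a₁, ha₁⟩ := hX.exists_entry hsc
        have hyc : y ≠ inr c := fun e => hyz (e ▸ SimpleGraph.btw_left _ _)
        have h1 := hy.2.1 c a₁ b' hsy ha₁ hb'
        have h2 := hX.D_le_one ha₁ (.cons hsb' (.single hbw)) ha₅ (by omega)
        have h3 := hX.D_tri a a₅ b'
        have h4 := hX.D_tri a₅ a₁ b'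
        rw [hX.D_comm a₅ a₁] at h4
        have h5 : X.dist (inl g) (inr c) + 4 * δ + 13 ≤ X.dist s (inr c) := by
          have e1 := hX.conn.dist_triangle (u := inl b) (v := s) (w := inr c)
          have e2 := hX.conn.dist_triangle (u := inl g) (v := inl w₀) (w := inr c)
          rw [X.dist_comm (u := inl b) (v := s)] at e1
          rw [X.dist_comm (u := inl g) (v := inl w₀)] at e2
          have e3 := hbc.2
          unfold SimpleGraph.Btw at e3
          omega
        have h6 := Nat.mul_le_mul_left P.slope h5
        have h7 : P.slope * (X.dist (inl g) (inr c) + 4 * δ + 13) =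
          P.slope * X.dist (inl g) (inr c) + P.slope * (4 * δ + 13) := by ring
        have h8 : P.slope * 1 ≤ P.slope * (4 * δ + 13) := Nat.mul_le_mul_left _ (by omega)
        omega
      · have h1 := hX.D_le_one hb' (.cons (fun h => hsy h.symm) (.cons (w := inl b) (fun h => ?_)
          (.single hbw))) ha₅ (by omega)
        · have h2 := hX.D_tri a a₅ b'
          rw [hX.D_comm] at h1
          omega
        · rcases hs with rfl | ⟨c', rfl, hc'⟩
          · rw [SimpleGraph.btw_self_iff hX.conn] at h; cases h
          · rcases eq_or_ne c' c with rfl | hne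
            · exact hsy (SimpleGraph.btw_left _ _)
            · have h1 := hX.conn.pos_dist_of_ne (show (inr c' : Γ ⊕ Z) ≠ inr c by simpa using hne)
              have h2 := hX.conn.pos_dist_of_ne (show (inr c : Γ ⊕ Z) ≠ inl b by simp)
              unfold SimpleGraph.Btw at h
              omega
    · have h1 := hX.D_le_of_link ha (.nil (by simp)) hgw
        (.cons hwz (.single fun h => hyz h.symm)) hb' (by omega)
      omega
  -- `y` is beyond the radius of `g`. Thinness places a point near `w₀` on `[b, y]` or on `[y, ζ]`;
  -- the first would put `y` out of the radius of `s`, as `g` is at distance at least `8δ + 18` from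
  -- `b`.
  · obtain ⟨w, hw, hwd⟩ := hX.thin (by omega) (y := y) hw₀
    have h1 := hX.D_tri w₀ g w
    rcases hw with hw | hw
    · exfalso
      have d1 := hX.dist_le w₀ w
      have h2 := hy.1
      have e1 := hX.conn.dist_triangle (u := inl b) (v := s) (w := y)
      have e2 := hX.conn.dist_triangle (u := inl b) (v := inl w) (w := inl g)
      have e3 := hX.conn.dist_triangle (u := inl w) (v := inl w₀) (w := inl g)
      have e4 := hX.conn.dist_triangle (u := inl g) (v := inl w) (w := y)
      rw [X.dist_comm (u := inl b) (v := s)] at e1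
      rw [X.dist_comm (u := inl w) (v := inl w₀)] at e3
      rw [X.dist_comm (u := inl g) (v := inl w)] at e4
      unfold SimpleGraph.Btw at hw
      omega
    · refine ⟨inl w, hX.mem_view_of_D_le (M := 2 * δ + 2) (by omega) (by omega) (by omega)
        (Or.inl rfl) ?_, hw⟩
      have := hX.D_tri g w₀ w
      rw [hX.D_comm g w₀] at this
      omega

theorem exists_near_of_farFrom {g x z : Γ} {κ M : ℕ} (hN : 8 ≤ N) (hκ : M + δ + 1 ≤ κ)
    (hg : X.Btw (inl b) (inl g) (inl x)) (hbg : D b g ≤ M) (hz : X.FarFrom D κ b x z) :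
    ∃ w₀, X.Btw (inl b) (inl w₀) (inl z) ∧ D w₀ g ≤ δ + 1 := by
  obtain ⟨w, hw, hwd⟩ := hX.thin hN (y := inl z) hg
  rcases hw with hw | hw
  · exact ⟨w, hw, by rw [hX.D_comm]; exact hwd⟩
  · exfalso
    have := hz w hw.symm
    have := hX.D_tri b g w
    omega

/-- Since `[x, z]` stays far from `b`, thinness makes `[b, z]` pass near `g`, at some `w₀`. Both `b`
and `w₀` are visible from both flags, so this persists for `z''` and then `z'`, and
`exists_mem_view_btw` provides the cover. -/
theorem sameView_of_advance {g x z z'' z' : Γ} {κ M : ℕ} (hN : 3 * δ + 20 ≤ N)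
    (hMN : M + δ + 6 ≤ N)
    (hMR : 2 * (M + δ + 1) + 1 ≤ P.radius)
    (hR : 4 * δ + 5 ≤ P.radius) (hslope : 2 * δ + 5 ≤ P.slope)
    (hB : P.slope * P.radius + 4 * δ + 2 * M + 20 ≤ P.budget)
    (hs : X.IsFlag s b) (hsb : X.Btw s (inl b) (inl x)) (hκ : M + δ + 1 ≤ κ)
    (hgx : X.Btw (inl b) (inl g) (inl x))
    (hg : 8 * δ + 18 ≤ X.dist (inl b) (inl g)) (hbg : D b g ≤ M)
    (hz : X.FarFrom D κ b x z) (h : X.SameView D P s b z z'')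
    (h' : X.SameView D P (inl g) g z'' z') : X.SameView D P s b z'' z' := by
  obtain ⟨w₀, hw₀, hw₀g⟩ := hX.exists_near_of_farFrom (by omega) hκ hgx hbg hz
  have m1 : inl b ∈ X.view D P s b := hX.mem_view_of_D_le (M := M + δ + 1) (by omega) hMR (by omega)
    hs (by rw [hX.D_self]; omega)
  have m2 : inl w₀ ∈ X.view D P s b := hX.mem_view_of_D_le (M := M + δ + 1) (by omega) hMR
    (by omega) hs (by have := hX.D_tri b g w₀; rw [hX.D_comm g w₀] at this; omega)
  have m3 : inl b ∈ X.view D P (inl g) g := hX.mem_view_of_D_le (M := M + δ + 1) (by omega) hMR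
    (by omega) (Or.inl rfl) (by rw [hX.D_comm]; omega)
  have m4 : inl w₀ ∈ X.view D P (inl g) g := hX.mem_view_of_D_le (M := M + δ + 1) (by omega) hMR
    (by omega) (Or.inl rfl) (by rw [hX.D_comm]; omega)
  have b1 := h.btw m1 m2 hw₀
  have b2 := h'.btw m3 m4 b1
  have hsg : X.dist s (inl g) = X.dist s (inl b) + X.dist (inl b) (inl g) :=
    Eq.symm (hsb.trans_right hX.conn hgx).2
  refine hX.sameView_of_cover h' ?_
  rintro ζ (rfl | rfl) y hy
  · exact hX.exists_mem_view_btw hN hR hslope (by omega) hs hsg hg b1 hw₀g hy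
  · exact hX.exists_mem_view_btw hN hR hslope (by omega) hs hsg hg b2 hw₀g hy

end

end ConedGeometry

/-! ### The recursion that moves a flag towards the base point. -/

/-- The view parameters used for a `δ`-slim graph. -/
def viewParams (δ : ℕ) : ViewParams where
  radius := 60 * δ + 150
  -- The first summand is slope times radius, so that every jump up to `100δ + 300` is tolerated
  -- anywhere within the radius.
  budget := (2 * δ + 5) * (60 * δ + 150) + 100 * δ + 300
  slope := 2 * δ + 5

/-- The distance beyond which points are regarded as far. -/
def farConst (δ : ℕ) : ℕ := (viewParams δ).budget + 60 * δ + 150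

namespace ConedGeometry

variable {Γ Z : Type*} {X : SimpleGraph (Γ ⊕ Z)} {D : Γ → Γ → ℕ} {δ N : ℕ}

open Classical in
/-- Measures how far the flag `(s, b)` is from `x`. -/
def flagDist (X : SimpleGraph (Γ ⊕ Z)) (x : Γ) (s : Γ ⊕ Z) (b : Γ) : ℕ :=
  -- The factor 2 leaves room for the last term, so that correcting the mark of a cone flag also
  -- counts as progress.
  2 * X.dist s (inl x) + if X.Btw s (inl b) (inl x) then 0 else 1

/-- The recursion step: views of far points from a flag are determined by their views from a flag
closer to `x`, up to one exceptional view. -/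
theorem exists_closer_flag (hX : ConedGeometry X D δ N) (hN : 30 * δ + 100 ≤ N) {s : Γ ⊕ Z} {b : Γ}
    (hs : X.IsFlag s b) (x : Γ) :
    (∀ z, ¬ X.FarFrom D (farConst δ) b x z) ∨
    ∃ s' b', X.IsFlag s' b' ∧ flagDist X x s' b' < flagDist X x s b ∧ ∃ E : Γ → Prop,
      (∀ z z', E z → E z' → X.SameView D (viewParams δ) s b z z') ∧
      ∀ z, X.FarFrom D (farConst δ) b x z → E z ∨
        ∀ z'', X.SameView D (viewParams δ) s b z z'' →
        ∀ z', X.SameView D (viewParams δ) s' b' z'' z' →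
          X.SameView D (viewParams δ) s b z'' z' := by
  classical
  obtain ⟨q, hq⟩ : ∃ q, q = (2 * δ + 5) * (60 * δ + 150) := ⟨_, rfl⟩
  have hbud : (viewParams δ).budget = q + 100 * δ + 300 := by rw [hq]; rfl
  have hrad : (viewParams δ).radius = 60 * δ + 150 := rfl
  have hslo : (viewParams δ).slope = 2 * δ + 5 := rfl
  have hfar : farConst δ = (viewParams δ).budget + 60 * δ + 150 := rfl
  have hmul : (viewParams δ).slope * (viewParams δ).radius = q := by rw [hq]; rfl
  generalize viewParams δ = P at *
  generalize farConst δ = κ at *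
  by_cases hsb : X.Btw s (inl b) (inl x)
  -- Jump to the nearest cone point on the way to `x` whose jump exceeds 3. Minimality bounds all
  -- earlier jumps by 3, hence the `D`-distance from `b` to its entry point.
  · by_cases hJ : ∃ n c a b₁, X.dist (inl b) (inr c) = n ∧ n ≤ 8 * δ + 18 ∧
        X.Btw (inl b) (inr c) (inl x) ∧ X.Entry (inl b) c a ∧ X.Entry (inl x) c b₁ ∧ 3 < D a b₁
    · obtain ⟨c, a, b₁, hn, hnL, hc, ha, hb₁, h3⟩ := Nat.find_spec hJ
      right
      have hsc := hsb.trans_right hX.conn hc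
      have hsa := hX.entry_extend hsc.2 ha
      have hba : X.Btw (inl b) (inl a) (inr c) := ha.btw
      have hK : D b a ≤ 3 * (8 * δ + 18) := by
        refine (hX.D_le_mul_dist (M := 3) (by omega) ?_).trans
          (Nat.mul_le_mul_left _ (by have := ha.2; omega))
        intro c' a' b' hc' ha' hb'
        by_contra hlt
        have hcc := hba.trans_left hX.conn hc'
        have hxx := hc.trans_left hX.conn hcc.1
        have hlt' : X.dist (inl b) (inr c') < Nat.find hJ := by
          have h1 := hX.conn.pos_dist_of_ne (show (inr c' : Γ ⊕ Z) ≠ inl a by simp)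
          have h2 := ha.2
          unfold SimpleGraph.Btw at hc'
          omega
        refine Nat.find_min hJ hlt' ⟨c', a', b', rfl, by omega, hxx.1, ha', ?_, by omega⟩
        have hax : X.Btw (inl b) (inl a) (inl x) := (hc.trans_left hX.conn hba).1
        exact hX.entry_extend (hax.trans_left hX.conn hc').2.symm hb'
      refine ⟨inr c, b₁, Or.inr ⟨c, rfl, hb₁.1⟩, ?_, fun z => ∀ y ∈ X.view D P s b,
        X.Btw y (inr c) (inl z), fun z z' => hX.sameView_of_through, ?_⟩
      · unfold flagDist
        rw [if_pos hb₁.btw.symm, if_pos hsb]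
        have h1 := hX.conn.pos_dist_of_ne (show (inl b : Γ ⊕ Z) ≠ inr c by simp)
        have h2 := hsc.1
        have h3 := hsc.2
        unfold SimpleGraph.Btw at h2 h3
        omega
      · intro z hz
        by_cases hE : ∀ y ∈ X.view D P s b, X.Btw y (inr c) (inl z)
        · exact Or.inl hE
        · exact Or.inr fun z'' h z' h' => hX.sameView_of_crossing (by omega) (by omega) (by omega)
            (hX.crossing_jump (by omega) (by omega) hK hsa hb₁ h3 hz)
            (fun ζ a' ha' hab y _ hyc => hX.btw_of_jump (by omega) hsa h3 ha' hab hyc) hE h h'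
    · push Not at hJ
      have hD : ∀ g, X.Btw (inl b) (inl g) (inl x) → X.dist (inl b) (inl g) ≤ 8 * δ + 19 →
          D b g ≤ 3 * (8 * δ + 19) := by
        intro g hg hgd
        refine (hX.D_le_mul_dist (M := 3) (by omega) ?_).trans (Nat.mul_le_mul_left _ hgd)
        intro c' a' b' hc' ha' hb'
        have h1 := hX.conn.pos_dist_of_ne (show (inr c' : Γ ⊕ Z) ≠ inl g by simp)
        have h2 := hg.trans_left hX.conn hc'
        exact hJ _ c' a' b' rfl (by unfold SimpleGraph.Btw at hc'; omega) h2.1 ha'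
          (hX.entry_extend h2.2.symm hb')
      by_cases hxd : X.dist (inl b) (inl x) ≤ 8 * δ + 18
      · left
        intro z hz
        have h1 := hD x (SimpleGraph.btw_right _ _) (by omega)
        have h2 := hz x (SimpleGraph.btw_left _ _)
        omega
      · right
        -- There is no big jump, so advance to a group element. The vertex at level `8δ + 18` may be
        -- a cone point, and then the next vertex is taken.
        obtain ⟨g, hg, hgd, hgd'⟩ : ∃ g : Γ, X.Btw (inl b) (inl g) (inl x) ∧
            8 * δ + 18 ≤ X.dist (inl b) (inl g) ∧ X.dist (inl b) (inl g) ≤ 8 * δ + 19 := by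
          obtain ⟨w, hw, hwd⟩ := SimpleGraph.exists_btw_dist hX.conn (x := inl b) (y := inl x)
            (n := 8 * δ + 18) (by omega)
          rcases w with g | c
          · exact ⟨g, hw, by omega, by omega⟩
          · obtain ⟨g, hg⟩ := hX.exists_entry (show (inl x : Γ ⊕ Z) ≠ inr c by simp)
            have hcg := (hw.trans_right hX.conn hg.btw.symm)
            have h1 := hcg.2
            have h2 := SimpleGraph.dist_eq_one_iff_adj.2 hg.1.symm
            refine ⟨g, hcg.1, ?_, ?_⟩ <;>
            · unfold SimpleGraph.Btw at h1
              omega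
        refine ⟨inl g, g, Or.inl rfl, ?_, fun _ => False, fun z z' h => h.elim, ?_⟩
        · unfold flagDist
          rw [if_pos (SimpleGraph.btw_left _ _), if_pos hsb]
          unfold SimpleGraph.Btw at hg hsb
          omega
        · intro z hz
          exact Or.inr fun z'' h z' h' => hX.sameView_of_advance (M := 3 * (8 * δ + 19)) (by omega)
            (by omega) (by omega) (by omega) (by omega) (by omega) hs hsb (by omega) hg hgd
            (hD g hg hgd') hz h h'
  · right
    rcases hs with rfl | ⟨c, rfl, hbc⟩
    · exact absurd (SimpleGraph.btw_left _ _) hsb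
    -- The flag is a cone point whose mark does not point to `x`: keep the cone point and change the
    -- mark.
    obtain ⟨b₁, hb₁⟩ := hX.exists_entry (show (inl x : Γ ⊕ Z) ≠ inr c by simp)
    refine ⟨inr c, b₁, Or.inr ⟨c, rfl, hb₁.1⟩, ?_, fun z => ∀ y ∈ X.view D P (inr c) b,
        X.Btw y (inr c) (inl z), fun z z' => hX.sameView_of_through, ?_⟩
    · unfold flagDist
      rw [if_pos hb₁.btw.symm, if_neg hsb]
      omega
    · intro z hz
      by_cases hE : ∀ y ∈ X.view D P (inr c) b, X.Btw y (inr c) (inl z)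
      · exact Or.inl hE
      · exact Or.inr fun z'' h z' h' => hX.sameView_of_crossing (by omega) (by omega) (by omega)
          (hX.crossing_recentre (by omega) (by omega) hb₁ hz)
          (fun ζ a' _ _ y _ _ => SimpleGraph.btw_left _ _) hE h h'

end ConedGeometry

/-! ### Limit cone points: existence and uniqueness. -/

namespace SimpleGraph

variable {Γ Z : Type*}

/-- Geodesics from `g` to elements of `Λ` make arbitrarily big jumps at `c`. -/
def IsLimitCone (X : SimpleGraph (Γ ⊕ Z)) (D : Γ → Γ → ℕ) (Λ : Set Γ) (g : Γ) (c : Z) : Prop :=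
  ∀ M : ℕ, ∃ x ∈ Λ, X.Btw (inl g) (inr c) (inl x) ∧
    ∃ a b, X.Entry (inl g) c a ∧ X.Entry (inl x) c b ∧ M < D a b

end SimpleGraph

namespace ConedGeometry

variable {Γ Z : Type*} {X : SimpleGraph (Γ ⊕ Z)} {D : Γ → Γ → ℕ} {δ N : ℕ} {P : ViewParams}

section
variable (hX : ConedGeometry X D δ N)
include hX

/-- Points of an interval at the same level are close. -/
theorem D_le_of_same_level (hN : 5 ≤ N) {x z w h : Γ} (hw : X.Btw (inl x) (inl w) (inl z))
    (hh : X.Btw (inl x) (inl h) (inl z)) (hd : X.dist (inl x) (inl w) = X.dist (inl x) (inl h)) :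
    D w h ≤ 2 * δ := by
  have hwh : X.dist (inl w) (inl h) ≤ 2 * δ := by
    obtain ⟨b, hb, hbd⟩ := hX.slim (inl x) (inl h) (inl z) (inl w) hw
    have t1 := hX.conn.dist_triangle (u := inl w) (v := b) (w := inl h)
    have t2 := hX.conn.dist_triangle (u := inl x) (v := b) (w := inl w)
    have t3 := hX.conn.dist_triangle (u := inl w) (v := b) (w := inl z)
    rw [X.dist_comm (u := b) (v := inl w)] at t2
    unfold SimpleGraph.Btw at *
    rcases hb with hb | hb
    · omega
    · rw [X.dist_comm (u := inl h) (v := b)] at hb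
      omega
  refine (hX.D_le_mul_dist (M := 1) le_rfl ?_).trans (by omega)
  intro c a b _ ha hb
  have t1 := hX.conn.dist_triangle (u := inl x) (v := inr c) (w := inl z)
  have p1 := hX.conn.pos_dist_of_ne (show (inr c : Γ ⊕ Z) ≠ inl w by simp)
  have p2 := hX.conn.pos_dist_of_ne (show (inr c : Γ ⊕ Z) ≠ inl h by simp)
  -- A cone point before the common level is avoided by going round through `z`; any other one is
  -- avoided by going round through `x`.
  by_cases h1 : X.Btw (inl x) (inr c) (inl w) ∨ X.Btw (inl x) (inr c) (inl h)
  · refine hX.D_le_one ha (.cons (w := inl z) ?_ (.single ?_)) hb (by omega)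
    · intro hv
      unfold SimpleGraph.Btw at *
      rw [X.dist_comm (u := inl w) (v := inr c)] at hv
      omega
    · intro hv
      replace hv := hv.symm
      unfold SimpleGraph.Btw at *
      rw [X.dist_comm (u := inl h) (v := inr c)] at hv
      omega
  · push Not at h1
    exact hX.D_le_one ha (.cons (w := inl x) (fun hv => h1.1 hv.symm) (.single h1.2)) hb (by omega)

/-- If `x` lies behind `g` as seen from `o`, then the points which look from `g` like a point `z₁`
with `[x, z₁]` far from `g` also lie behind `g` as seen from `o`. -/
theorem exists_near_of_sameView {o x g z₁ z : Γ} {κ : ℕ} (hN : 3 * δ + 20 ≤ N)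
    (hR : 6 * δ + 10 ≤ P.radius)
    (hB : P.slope * P.radius + 4 * δ + 20 ≤ P.budget) (hκ : δ + 1 ≤ κ)
    (hg : X.Btw (inl o) (inl g) (inl x)) (hz₁ : X.FarFrom D κ g x z₁)
    (h : X.SameView D P (inl g) g z₁ z) :
    ∃ w, X.Btw (inl o) (inl w) (inl z) ∧ D g w ≤ 3 * δ + 3 := by
  obtain ⟨w₀, hw₀, hgw₀⟩ := hX.thin (by omega) (y := inl z₁) hg
  replace hw₀ : X.Btw (inl o) (inl w₀) (inl z₁) := by
    refine hw₀.resolve_right fun hh => ?_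
    have := hz₁ w₀ hh.symm
    omega
  have hball : ∀ w, D g w ≤ 2 * δ + 2 → inl w ∈ X.view D P (inl g) g := fun w hw =>
    hX.mem_view_of_D_le (M := 2 * δ + 2) (by omega) (by omega) (by omega) (Or.inl rfl) hw
  have hw₀Y := hball w₀ (by omega)
  -- A hidden `o` costs nothing: the visible cone point `c` with a big jump lies on `[o, w₀]`, and
  -- `[c, z]` passes through `w₀` by equality of views. The jump then forces `[o, z]` through `c`.
  have hviol : ∀ c a b', X.Btw (inl o) (inr c) (inl g) → X.Entry (inl g) c a →
      X.Entry (inl o) c b' → P.budget < D a b' + P.slope * X.dist (inl g) (inr c) →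
      inr c ∈ X.view D P (inl g) g → X.Btw (inl o) (inl w₀) (inl z) := by
    intro c a b' hc ha hb' hv hcY
    have hgc : P.slope * X.dist (inl g) (inr c) ≤ P.slope * P.radius :=
      Nat.mul_le_mul_left _ hcY.1
    have hcw : X.Btw (inl o) (inr c) (inl w₀) := by
      by_contra hh
      have := hX.D_le_of_link ha (.nil (by simp)) hgw₀ (.single fun h => hh h.symm) hb' (by omega)
      omega
    have h1 := (h.btw hcY hw₀Y (hw₀.trans_left hX.conn hcw).2)
    obtain ⟨a₄, ha₄⟩ := hX.exists_entry (show (inl w₀ : Γ ⊕ Z) ≠ inr c by simp)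
    have ha₄' : X.Entry (inl z) c a₄ := hX.entry_extend h1.symm ha₄
    have d1 := hX.D_le_of_link ha (.nil (by simp)) hgw₀ (.nil (by simp)) ha₄ (by omega)
    have hcz : X.Btw (inl o) (inr c) (inl z) := by
      by_contra hh
      have d2 := hX.D_le_one hb' (.single hh) ha₄' (by omega)
      have d3 := hX.D_tri a a₄ b'
      rw [hX.D_comm a₄ b'] at d3
      omega
    exact (hcz.trans_right hX.conn h1).1
  by_cases hd : X.dist (inl g) (inl o) ≤ P.radius
  · refine ⟨w₀, ?_, by omega⟩
    by_cases ho : inl o ∈ X.view D P (inl g) g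
    · exact h.btw ho hw₀Y hw₀
    · obtain ⟨c, a, b', hc, ha, hb', hv, hcY⟩ := hX.exists_first_violation ho hd
      exact hviol c a b' hc.symm ha hb' hv hcY
  -- When `o` is beyond the radius, a group element `y` near the edge of the view stands in for it.
  -- Two further thin triangles give the constant `3δ + 3`.
  · obtain ⟨y, hy, hyd, hyd'⟩ : ∃ y : Γ, X.Btw (inl g) (inl y) (inl o) ∧
        P.radius ≤ X.dist (inl g) (inl y) + 1 ∧ X.dist (inl g) (inl y) ≤ P.radius := by
      obtain ⟨w, hw, hwd⟩ := SimpleGraph.exists_btw_dist hX.conn (x := inl g) (y := inl o)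
        (n := P.radius) (by omega)
      rcases w with y | c
      · exact ⟨y, hw, by omega, by omega⟩
      · obtain ⟨y, hy⟩ := hX.exists_entry (show (inl g : Γ ⊕ Z) ≠ inr c by simp)
        have := hy.2
        exact ⟨y, (hw.trans_left hX.conn hy.btw).1, by omega, by omega⟩
    by_cases hyY : inl y ∈ X.view D P (inl g) g
    · have hfar : ∀ w, X.Btw (inl o) (inl w) (inl y) → D g w ≤ 3 * δ + 3 → False := by
        intro w hw hgw
        have d1 := hX.dist_le g w
        have d2 := hX.conn.dist_triangle (u := inl g) (v := inl w) (w := inl o)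
        replace hw := hw.symm
        unfold SimpleGraph.Btw at hw hy
        omega
      obtain ⟨w₁, hw₁, hd₁⟩ := hX.thin (by omega) (y := inl y) hw₀
      have e1 := hX.D_tri g w₀ w₁
      replace hw₁ : X.Btw (inl y) (inl w₁) (inl z₁) :=
        hw₁.resolve_left fun hh => hfar w₁ hh (by omega)
      have hw₁' := h.btw hyY (hball w₁ (by omega)) hw₁
      obtain ⟨w₂, hw₂, hd₂⟩ := hX.thin (by omega) (y := inl o) hw₁'
      have e2 := hX.D_tri g w₁ w₂
      exact ⟨w₂, hw₂.resolve_left fun hh => hfar w₂ hh.symm (by omega), by omega⟩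
    · obtain ⟨c, a, b', hc, ha, hb', hv, hcY⟩ := hX.exists_first_violation hyY hyd'
      have h1 := hy.trans_left hX.conn hc
      exact ⟨w₀, hviol c a b' h1.1.symm ha (hX.entry_extend h1.2.symm hb') hv hcY, by omega⟩

/-- A change of base point moves the entry point at `c` by a bounded amount, which unbounded jumps
absorb. -/
theorem isLimitCone_of_base (hN : 5 ≤ N) {Λ : Set Γ} {g₁ g : Γ} {c : Z}
    (h : X.IsLimitCone D Λ g₁ c) : X.IsLimitCone D Λ g c := by
  intro M
  obtain ⟨a₀, ha₀⟩ := hX.exists_entry (show (inl g₁ : Γ ⊕ Z) ≠ inr c by simp)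
  obtain ⟨b₀, hb₀⟩ := hX.exists_entry (show (inl g : Γ ⊕ Z) ≠ inr c by simp)
  obtain ⟨x, hx, hc, a, b, ha, hb, hM⟩ := h (M + D a₀ b₀ + 5)
  have h1 := hX.D_le_one ha (.nil (by simp)) ha₀ (by omega)
  have t1 := hX.D_tri a a₀ b
  have t2 := hX.D_tri a₀ b₀ b
  have hgx : X.Btw (inl g) (inr c) (inl x) := by
    by_contra hgx
    have h2 := hX.D_le_one hb₀ (.single hgx) hb (by omega)
    omega
  exact ⟨x, hx, hgx, b₀, b, hb₀, hb, by omega⟩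

theorem isLimitCone_diff (hN : 5 ≤ N) {Λ E : Set Γ} {g : Γ} {c : Z} (hE : E.Finite)
    (h : X.IsLimitCone D Λ g c) : X.IsLimitCone D (Λ \ E) g c := by
  intro M
  choose f hf using fun x : Γ => hX.exists_entry (show (inl x : Γ ⊕ Z) ≠ inr c by simp)
  obtain ⟨K, hK⟩ := (hE.image fun x => D (f g) (f x)).bddAbove
  obtain ⟨x, hx, hc, a, b, ha, hb, hM⟩ := h (M + K + 5)
  refine ⟨x, ⟨hx, fun hxE => ?_⟩, hc, a, b, ha, hb, by omega⟩
  have h1 : D (f g) (f x) ≤ K := hK (Set.mem_image_of_mem _ hxE)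
  have h2 := hX.D_le_one ha (.nil (by simp)) (hf g) (by omega)
  have h3 := hX.D_le_one hb (.nil (by simp)) (hf x) (by omega)
  have t1 := hX.D_tri a (f g) b
  have t2 := hX.D_tri (f g) (f x) b
  rw [hX.D_comm b] at h3
  omega

/-- Take `x` in Λ behind `c`, with a big jump, and `z` in the class with `[x, z]` far from `g`. If
`[x, z]` crosses `c`, the entry point of `z` lies on it and is far from `g`; otherwise it is next to
that of `x`. Either way `z` is behind `c`. -/
theorem exists_btw_of_isLimitCone (hN : 5 ≤ N) {Λ : Set Γ} {g z₀ : Γ} {c : Z}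
    (h : X.IsLimitCone D Λ g c)
    (hz₀ : ∀ κ, {x ∈ Λ | ∀ z, X.SameView D P (inl g) g z₀ z → ¬ X.FarFrom D κ g x z}.Finite) :
    ∃ z, X.SameView D P (inl g) g z₀ z ∧ X.Btw (inl g) (inr c) (inl z) ∧
      ∃ a b, X.Entry (inl g) c a ∧ X.Entry (inl z) c b ∧ 1 < D a b := by
  obtain ⟨a₀, ha₀⟩ := hX.exists_entry (show (inl g : Γ ⊕ Z) ≠ inr c by simp)
  obtain ⟨x, ⟨hx, hxE⟩, hc, a, b, ha, hb, hM⟩ :=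
    hX.isLimitCone_diff hN (hz₀ (D g a₀ + 5)) h 3
  simp only [Set.mem_ofPred_eq, not_and, not_forall, not_not] at hxE
  obtain ⟨z, hz, hzx⟩ := hxE hx
  obtain ⟨c₁, hc₁⟩ := hX.exists_entry (show (inl z : Γ ⊕ Z) ≠ inr c by simp)
  have hD : 1 < D a c₁ := by
    by_cases hv : X.Btw (inl z) (inr c) (inl x)
    · have h1 := hzx c₁ (hv.trans_left hX.conn hc₁.btw).1.symm
      have h2 := hX.D_le_one ha₀ (.nil (by simp)) ha (by omega)
      have h3 := hX.D_tri g a₀ c₁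
      have h4 := hX.D_tri a₀ a c₁
      omega
    · have h1 := hX.D_le_one hc₁ (.single hv) hb (by omega)
      have h2 := hX.D_tri a c₁ b
      omega
  refine ⟨z, hz, ?_, a, c₁, ha, hc₁, hD⟩
  by_contra hv
  have := hX.D_le_one ha (.single hv) hc₁ (by omega)
  omega

/-- Look from the last group element `a` before `c` on a geodesic from `c'`. The selected class has
members behind `c` and behind `c'`. As `c` is visible from `a`, the member behind `c'` is also
behind `c`; but then the detour through `c` avoids `c'` and contradicts the jump there. -/
theorem isLimitCone_unique (hN : 5 ≤ N) (hR : 1 ≤ P.radius) {Λ : Set Γ}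
    (hz₀ : ∀ g, ∃ z₀, ∀ κ,
      {x ∈ Λ | ∀ z, X.SameView D P (inl g) g z₀ z → ¬ X.FarFrom D κ g x z}.Finite)
    {g : Γ} {c c' : Z} (h : X.IsLimitCone D Λ g c) (h' : X.IsLimitCone D Λ g c') : c = c' := by
  by_contra hne
  have hne' : (inr c' : Γ ⊕ Z) ≠ inr c := fun e => hne (Sum.inr.inj e).symm
  obtain ⟨a, ha⟩ := hX.exists_entry hne'
  have hac := SimpleGraph.dist_eq_one_iff_adj.2 ha.1
  obtain ⟨z₀, hz₀⟩ := hz₀ a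
  obtain ⟨z, hz, hcz, -⟩ := hX.exists_btw_of_isLimitCone hN (hX.isLimitCone_of_base hN h) hz₀
  obtain ⟨z', hz', hcz', a₁, b₁, ha₁, hb₁, hD⟩ :=
    hX.exists_btw_of_isLimitCone hN (hX.isLimitCone_of_base hN h') hz₀
  have hcY : inr c ∈ X.view D P (inl a) a := by
    refine ⟨by omega, ?_, ?_⟩
    · intro e a' b' he ha' hb'
      exfalso
      have h1 := hX.conn.pos_dist_of_ne (show (inl a : Γ ⊕ Z) ≠ inr e by simp)
      have h2 := hb'.2
      unfold SimpleGraph.Btw at he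
      rw [X.dist_comm (u := inr e) (v := inr c)] at he
      omega
    · intro e b' he; cases he
  have hzz' : X.SameView D P (inl a) a z z' := fun y hy => by
    have h1 := hz y hy
    have h2 := hz' y hy
    omega
  have hcz'' := hzz'.btw hX.base_mem_view hcY hcz
  have hd := ha.2
  rw [X.dist_comm (u := inr c') (v := inl a), X.dist_comm (u := inr c') (v := inr c)] at hd
  have h1 := hX.D_le_one ha₁ (.cons (w := inr c) ?_ (.single ?_)) hb₁ (by omega)
  · omega
  · intro hv
    have := hX.conn.pos_dist_of_ne hne'
    have := hX.conn.pos_dist_of_ne (show (inl a : Γ ⊕ Z) ≠ inr c' by simp)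
    unfold SimpleGraph.Btw at hv
    omega
  · intro hv
    unfold SimpleGraph.Btw at hv hcz' hcz''
    omega

/-- Induct on the level. Group elements have finitely many neighbours; a cone point that is not a
limit has bounded jumps, so only finitely many of its neighbours continue a geodesic to Λ. -/
theorem finite_level (hfin : ∀ a M, {b | D a b ≤ M}.Finite)
    (hnbr : ∀ a, {c | X.Adj (inl a) (inr c)}.Finite) {Λ : Set Γ} {o : Γ}
    (hlim : ∀ c, ¬ X.IsLimitCone D Λ o c) (j : ℕ) :
    {y | X.dist (inl o) y ≤ j ∧ ∃ x ∈ Λ, X.Btw (inl o) y (inl x)}.Finite := by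
  induction j with
  | zero =>
    refine (Set.finite_singleton (inl o)).subset ?_
    rintro y ⟨hy, -⟩
    exact ((hX.conn.dist_eq_zero_iff).1 (Nat.le_zero.1 hy)).symm
  | succ j ih =>
    have hlim' : ∀ c, ∃ M, ∀ x ∈ Λ, X.Btw (inl o) (inr c) (inl x) → ∀ a b, X.Entry (inl o) c a →
        X.Entry (inl x) c b → D a b ≤ M := by
      intro c
      have := hlim c
      unfold SimpleGraph.IsLimitCone at this
      push Not at this
      exact this
    choose M hM using hlim'
    have hf1 : {y | ∃ a, inl a ∈ {y | X.dist (inl o) y ≤ j ∧ ∃ x ∈ Λ, X.Btw (inl o) y (inl x)} ∧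
        X.Adj (inl a) y}.Finite := by
      refine (ih.biUnion (t := fun y' => {y | ∃ a, inl a = y' ∧ X.Adj (inl a) y}) ?_).subset ?_
      · rintro (a | c) -
        · refine (((hfin a 1).image inl).union ((hnbr a).image inr)).subset ?_
          rintro (b | c) ⟨a', h1, h2⟩
          · cases h1; exact Or.inl ⟨b, hX.D_adj _ _ h2, rfl⟩
          · cases h1; exact Or.inr ⟨c, h2, rfl⟩
        · convert Set.finite_empty
          ext y; simp
      · rintro y ⟨a, h1, h2⟩
        exact Set.mem_biUnion h1 ⟨a, rfl, h2⟩
    have hf2 : {y : Γ ⊕ Z | ∃ c a b, inr c ∈ {y | X.dist (inl o) y ≤ j ∧ ∃ x ∈ Λ,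
        X.Btw (inl o) y (inl x)} ∧ inl a ∈ {y | X.dist (inl o) y ≤ j ∧ ∃ x ∈ Λ,
        X.Btw (inl o) y (inl x)} ∧ y = inl b ∧ D a b ≤ M c}.Finite := by
      refine ((ih.prod ih).biUnion (t := fun p => {y | ∃ c a b, p.1 = inr c ∧ p.2 = inl a ∧
        y = inl b ∧ D a b ≤ M c}) ?_).subset ?_
      · rintro ⟨p₁, p₂⟩ -
        rcases p₁ with _ | c
        · convert Set.finite_empty
          ext y; simp
        rcases p₂ with a | _
        · refine ((hfin a (M c)).image inl).subset ?_
          rintro y ⟨c', a', b, h1, h2, rfl, h3⟩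
          cases h1; cases h2
          exact ⟨b, h3, rfl⟩
        · convert Set.finite_empty
          ext y; simp
      · rintro y ⟨c, a, b, h1, h2, h3, h4⟩
        exact Set.mem_biUnion (x := (inr c, inl a)) ⟨h1, h2⟩ ⟨c, a, b, rfl, rfl, h3, h4⟩
    refine ((ih.union hf1).union hf2).subset ?_
    rintro y ⟨hy, x, hx, hyx⟩
    by_cases hyj : X.dist (inl o) y ≤ j
    · exact Or.inl (Or.inl ⟨hyj, x, hx, hyx⟩)
    have hoy : (inl o : Γ ⊕ Z) ≠ y := by
      rintro rfl
      simp at hyj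
    obtain ⟨w, hw, hwd⟩ := SimpleGraph.exists_adj_dist_succ hX.conn hoy
    have hwy : X.Btw (inl o) w y := by
      have := SimpleGraph.dist_eq_one_iff_adj.2 hw
      unfold SimpleGraph.Btw; omega
    have hwx := hyx.trans_left hX.conn hwy
    rcases w with a | c
    · exact Or.inl (Or.inr ⟨a, ⟨by omega, x, hx, hwx.1⟩, hw⟩)
    · right
      obtain ⟨a, ha⟩ := hX.exists_entry (show (inl o : Γ ⊕ Z) ≠ inr c by simp)
      have ha2 := ha.2
      rcases y with b | c'
      · refine ⟨c, a, b, ⟨by omega, x, hx, hwx.1⟩, ⟨by omega, x, hx,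
          (hwx.1.trans_left hX.conn ha.btw).1⟩, rfl, hM c x hx hwx.1 a b ha ?_⟩
        exact hX.entry_extend hwx.2.symm (.self hw.symm)
      · exact absurd hw (hX.not_adj _ _)

/-- An infinite set escaping in the sense of `h₁` and `h₂` accumulates at a cone point. -/
theorem exists_isLimitCone (hN : 3 * δ + 20 ≤ N) (hR : 6 * δ + 10 ≤ P.radius)
    (hB : P.slope * P.radius + 4 * δ + 20 ≤ P.budget)
    (hfin : ∀ a M, {b | D a b ≤ M}.Finite)
    (hnbr : ∀ a, {c | X.Adj (inl a) (inr c)}.Finite) {Λ : Set Γ} (hΛ : Λ.Infinite) {o : Γ}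
    {z₀ : Γ → Γ}
    (h₁ : ∀ g κ, {x ∈ Λ | ∀ z, X.SameView D P (inl g) g (z₀ g) z → ¬ X.FarFrom D κ g x z}.Finite)
    (h₂ : ∀ κ, {g | ∀ z, X.SameView D P (inl g) g (z₀ g) z → ¬ X.FarFrom D κ g o z}.Finite) :
    ∃ c, X.IsLimitCone D Λ o c := by
  by_contra! hlim
  have hlev := hX.finite_level hfin hnbr hlim
  -- Beyond distance `K`, the class chosen at `g` has a member whose geodesics from `o` avoid the
  -- neighbourhood of `g`. A `g` between `o` and some `x` in Λ just beyond `K` contradicts this, by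
  -- `exists_near_of_sameView`. Without limit cones there are finitely many candidates for `g`, so
  -- one `x` avoids all their exceptional sets.
  obtain ⟨K, hK⟩ := ((h₂ (3 * δ + 3)).image fun g => X.dist (inl o) (inl g)).bddAbove
  have hG : {g : Γ | inl g ∈ {y | X.dist (inl o) y ≤ K + 2 ∧ ∃ x ∈ Λ,
      X.Btw (inl o) y (inl x)}}.Finite := (hlev (K + 2)).preimage Sum.inl_injective.injOn
  have hE := hG.biUnion fun g _ => h₁ g (δ + 1)
  obtain ⟨x, hx, hxn⟩ := hΛ.exists_notMem_finite (hG.union hE)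
  rw [Set.mem_union, not_or] at hxn
  obtain ⟨hx1, hx2⟩ := hxn
  have hxd : K + 2 < X.dist (inl o) (inl x) := by
    by_contra hle
    exact hx1 ⟨by omega, x, hx, SimpleGraph.btw_right _ _⟩
  obtain ⟨g, hg, hgd, hgd'⟩ : ∃ g : Γ, X.Btw (inl o) (inl g) (inl x) ∧
      K + 1 ≤ X.dist (inl o) (inl g) ∧ X.dist (inl o) (inl g) ≤ K + 2 := by
    obtain ⟨w, hw, hwd⟩ := SimpleGraph.exists_btw_dist hX.conn (x := inl o) (y := inl x)
      (n := K + 2) (by omega)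
    rcases w with g | c
    · exact ⟨g, hw, by omega, by omega⟩
    · obtain ⟨g, hg⟩ := hX.exists_entry (show (inl o : Γ ⊕ Z) ≠ inr c by simp)
      have := hg.2
      exact ⟨g, (hw.trans_left hX.conn hg.btw).1, by omega, by omega⟩
  have hgG : inl g ∈ {y | X.dist (inl o) y ≤ K + 2 ∧ ∃ x ∈ Λ, X.Btw (inl o) y (inl x)} :=
    ⟨hgd', x, hx, hg⟩
  have hxE : ∃ z, X.SameView D P (inl g) g (z₀ g) z ∧ X.FarFrom D (δ + 1) g x z := by
    by_contra! hh
    exact hx2 (Set.mem_biUnion (x := g) hgG ⟨hx, hh⟩)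
  obtain ⟨z₁, hz₁, hfar⟩ := hxE
  have hmem : X.dist (inl o) (inl g) ≤ K := hK ⟨g, fun z hz hzf => by
    obtain ⟨w, hw, hgw⟩ := hX.exists_near_of_sameView hN hR hB le_rfl hg hfar (z := z)
      (fun y hy => by
        have e1 := hz₁ y hy
        have e2 := hz y hy
        omega)
    have := hzf w hw
    omega, rfl⟩
  omega

end

end ConedGeometry

/-! ### Strong Property (T) and invariant vectors. -/

section Extension

variable {Γ E H : Type*} [Group Γ] [AddCommGroup E] [Module ℂ E] [NormedAddCommGroup H]
  [NormedSpace ℂ H] [CompleteSpace H]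

/-- A representation on a module extends to any completion for which it acts by bounded operators. -/
def extendRep (A : Γ →* (E →ₗ[ℂ] E)) (Φ : E →ₗ[ℂ] H) (hd : DenseRange Φ)
    (hΦ : ∀ g, ∃ C, ∀ x, ‖Φ (A g x)‖ ≤ C * ‖Φ x‖) : Γ →* (H →L[ℂ] H) where
  toFun g := (Φ ∘ₗ A g).extendOfNorm Φ
  map_one' := by
    refine ContinuousLinearMap.ext fun x => ?_
    refine hd.induction_on x (isClosed_eq (by fun_prop) (by fun_prop)) fun y => ?_
    rw [LinearMap.extendOfNorm_eq hd (hΦ 1)]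
    simp
  map_mul' g h := by
    refine ContinuousLinearMap.ext fun x => ?_
    refine hd.induction_on x (isClosed_eq (by fun_prop) (by fun_prop)) fun y => ?_
    rw [LinearMap.extendOfNorm_eq hd (hΦ (g * h)), ContinuousLinearMap.mul_def, ContinuousLinearMap.comp_apply,
      LinearMap.extendOfNorm_eq hd (hΦ h), LinearMap.comp_apply, LinearMap.comp_apply,
      LinearMap.extendOfNorm_eq hd (hΦ g)]
    simp

theorem extendRep_apply (A : Γ →* (E →ₗ[ℂ] E)) (Φ : E →ₗ[ℂ] H) (hd : DenseRange Φ)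
    (hΦ : ∀ g, ∃ C, ∀ x, ‖Φ (A g x)‖ ≤ C * ‖Φ x‖) (g : Γ) (x : E) :
    extendRep A Φ hd hΦ g (Φ x) = Φ (A g x) :=
  LinearMap.extendOfNorm_eq hd (hΦ g) x

theorem norm_extendRep_le (A : Γ →* (E →ₗ[ℂ] E)) (Φ : E →ₗ[ℂ] H) (hd : DenseRange Φ)
    (hΦ : ∀ g, ∃ C, ∀ x, ‖Φ (A g x)‖ ≤ C * ‖Φ x‖) {g : Γ} {C : ℝ} (hC : 0 ≤ C)
    (h : ∀ x, ‖Φ (A g x)‖ ≤ C * ‖Φ x‖) : ‖extendRep A Φ hd hΦ g‖ ≤ C :=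
  LinearMap.opNorm_extendOfNorm_le hd hC h

end Extension

/-- A polynomial is dominated by every exponential. -/
theorem exists_pow_le_exp (p : ℕ) {t : ℝ} (ht : 0 < t) :
    ∃ L : ℝ, 0 ≤ L ∧ ∀ r : ℝ, 0 ≤ r → (r + 1) ^ p ≤ L * Real.exp (t * r) := by
  refine ⟨p.factorial / t ^ p * Real.exp t, by positivity, fun r hr => ?_⟩
  have h := Real.pow_div_factorial_le_exp (t * (r + 1)) (by positivity) p
  rw [mul_assoc, ← Real.exp_add, show t + t * r = t * (r + 1) by ring]
  rw [div_le_iff₀ (by positivity), mul_pow] at h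
  rw [div_mul_eq_mul_div, le_div_iff₀ (by positivity)]
  linarith

/-- Factoring through a countable discrete group makes the range countable, hence separable;
compactness of the support gives a bound. -/
theorem integrable_of_isCompactlySupported {G Γ E : Type*} [TopologicalSpace G]
    [MeasurableSpace G] [BorelSpace G] [TopologicalSpace Γ] [DiscreteTopology Γ] [Countable Γ]
    [NormedAddCommGroup E] {μ : Measure G} [IsFiniteMeasure μ] {K : Set G} (hK : IsCompact K)
    (hμ : μ Kᶜ = 0) {φ : G → Γ} (hφ : Continuous φ) (f : Γ → E) :
    Integrable (fun g => f (φ g)) μ := by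
  borelize E
  have hc : Continuous fun g => f (φ g) := continuous_of_discreteTopology.comp hφ
  have hsm : StronglyMeasurable fun g => f (φ g) := by
    refine stronglyMeasurable_iff_measurable_separable.2 ⟨hc.measurable, ?_⟩
    refine (Set.Countable.mono ?_ (Set.countable_range f)).isSeparable
    rintro _ ⟨g, rfl⟩
    exact ⟨_, rfl⟩
  obtain ⟨C, hC⟩ := hK.exists_bound_of_continuousOn hc.continuousOn
  refine Integrable.of_bound hsm.aestronglyMeasurable C ?_
  rw [ae_iff]
  refine measure_mono_null (fun g hg => ?_) hμ
  intro hgK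
  exact hg (hC g hgK)

theorem map_signedIntegral {G Γ E : Type*} [TopologicalSpace G]
    [MeasurableSpace G] [BorelSpace G] [TopologicalSpace Γ] [DiscreteTopology Γ] [Countable Γ]
    [NormedAddCommGroup E] [NormedSpace ℂ E] [CompleteSpace E] {m : SignedMeasure G}
    (hm : m.IsCompactlySupported) {φ : G → Γ} (hφ : Continuous φ) (f : Γ → E) (α : E →L[ℂ] ℂ) :
    α (signedIntegral m fun g => f (φ g)) = signedIntegral m fun g => α (f (φ g)) := by
  obtain ⟨K, hK, hmK⟩ := hm
  rw [SignedMeasure.totalVariation, Measure.add_apply, add_eq_zero] at hmK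
  unfold signedIntegral
  rw [map_sub]
  congr 1
  · exact (α.integral_comp_comm (integrable_of_isCompactlySupported hK hmK.1 hφ f)).symm
  · exact (α.integral_comp_comm (integrable_of_isCompactlySupported hK hmK.2 hφ f)).symm

/-- Under strong Property (T) a representation of polynomial growth has an invariant vector at
which a given invariant functional does not vanish. -/
theorem StrongPropertyT.exists_invariant {G : Type u} [Group G] [TopologicalSpace G]
    [MeasurableSpace G] [BorelSpace G] (hG : StrongPropertyT.{u, v} G)
    {Γ : Type*} [Group Γ] [TopologicalSpace Γ] [DiscreteTopology Γ] [Countable Γ]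
    {φ : G →* Γ} (hφ : Continuous φ) {l : Γ → ℝ} (hl : IsLengthFunction l) {c : ℝ} (hc : 0 ≤ c)
    {p : ℕ} {E : Type*} [AddCommGroup E] [Module ℂ E] (A : Γ →* (E →ₗ[ℂ] E)) {H : Type v}
    [NormedAddCommGroup H] [InnerProductSpace ℂ H] [CompleteSpace H] {Φ : E →ₗ[ℂ] H}
    (hd : DenseRange Φ) (hΦ : ∀ g x, ‖Φ (A g x)‖ ≤ c * (l g + 1) ^ p * ‖Φ x‖)
    {lam : H →L[ℂ] ℂ} (hlam : ∀ g x, lam (Φ (A g x)) = lam (Φ x)) (x₀ : E) :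
    ∃ η : H, lam η = lam (Φ x₀) ∧ ∀ g (α β : H →L[ℂ] ℂ),
      (∀ x, α (Φ (A (φ g) x)) = β (Φ x)) → α η = β η := by
  obtain ⟨m, hm, hmH⟩ := hG (fun g => l (φ g))
    { continuous := hl.continuous.comp hφ
      nonneg := fun g => hl.nonneg _
      inv := fun g => by rw [map_inv, hl.inv]
      mul_le := fun g h => by rw [map_mul]; exact hl.mul_le _ _ }
  obtain ⟨t, ht, hrep⟩ := hmH H
  have hΦ' : ∀ g, ∃ C, ∀ x, ‖Φ (A g x)‖ ≤ C * ‖Φ x‖ := fun g => ⟨_, hΦ g⟩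
  set π := extendRep A Φ hd hΦ' with hπ
  have hπ' : ∀ g (α β : H →L[ℂ] ℂ), (∀ x, α (Φ (A g x)) = β (Φ x)) → ∀ y, α (π g y) = β y := by
    intro g α β h y
    refine hd.induction_on y (isClosed_eq (by fun_prop) (by fun_prop)) fun x => ?_
    rw [hπ, extendRep_apply, h]
  obtain ⟨L, hL, hLe⟩ := exists_pow_le_exp p ht
  obtain ⟨T, P, hT, ⟨hP, hPr⟩, hTP⟩ := hrep (π.comp φ)
    (fun x => (continuous_of_discreteTopology (f := fun g => π g x)).comp hφ)
    ⟨c * L, by positivity, fun g => by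
      have h0 := hl.nonneg (φ g)
      refine norm_extendRep_le A Φ hd hΦ' (by positivity) fun x => (hΦ (φ g) x).trans ?_
      rw [mul_assoc c L]
      gcongr
      exact hLe _ h0⟩
  -- The same measures are applied to the trivial representation on the same `H`, whose limit is the
  -- identity. As `lam` cannot distinguish the two sequences of operators, `lam` of the limit `P` is
  -- `lam`; no normalisation of the measures is needed.
  obtain ⟨T', P', hT', ⟨hP', hPr'⟩, hTP'⟩ := hrep 1 (fun x => continuous_const)
    ⟨‖(1 : H →L[ℂ] H)‖, by positivity, fun g => by
      have h0 := hl.nonneg (φ g)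
      refine le_mul_of_one_le_right (norm_nonneg _) (Real.one_le_exp (by positivity))⟩
  have hid : ∀ x, P' x = x := by
    intro x
    have hx : x ∈ Set.range P' := by
      rw [hPr']
      intro g
      rfl
    obtain ⟨y, rfl⟩ := hx
    exact hP' y
  have hTT : ∀ n x, lam (T n x) = lam (T' n x) := by
    intro n x
    rw [hT n x, hT' n x]
    have h1 := map_signedIntegral (hm n).1 hφ (fun g => π g x) lam
    have h2 := map_signedIntegral (hm n).1 hφ (fun g => x) lam
    refine h1.trans (Eq.trans ?_ h2.symm)
    congr 1
    funext g
    exact hπ' _ lam lam (hlam _) x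
  have hPP : ∀ x, lam (P x) = lam x := by
    intro x
    have h1 : Tendsto (fun n => lam (T n x)) atTop (𝓝 (lam (P x))) :=
      (lam.continuous.tendsto _).comp
        ((ContinuousLinearMap.apply ℂ H x).continuous.tendsto P |>.comp hTP)
    have h2 : Tendsto (fun n => lam (T' n x)) atTop (𝓝 (lam (P' x))) :=
      (lam.continuous.tendsto _).comp
        ((ContinuousLinearMap.apply ℂ H x).continuous.tendsto P' |>.comp hTP')
    simp only [hTT] at h1
    rw [tendsto_nhds_unique h1 h2, hid]
  refine ⟨P (Φ x₀), hPP _, fun g α β h => ?_⟩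
  have hinv : P (Φ x₀) ∈ {x | ∀ g, (π.comp φ) g x = x} := hPr ▸ Set.mem_range_self _
  rw [← hπ' _ α β h]
  congr 1
  exact (hinv g).symm

/-! ### Hilbert norms defined by masses on families of sets. -/

section Masses

variable {Γ : Type*}

/-- The total mass which a finitely supported function gives to a set. -/
def massOn (B : Set Γ) : (Γ →₀ ℂ) →ₗ[ℂ] ℂ :=
  Finsupp.linearCombination ℂ (B.indicator (1 : Γ → ℂ))

theorem massOn_single (B : Set Γ) (z : Γ) (a : ℂ) :
    massOn B (Finsupp.single z a) = a * B.indicator 1 z := by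
  simp [massOn]

theorem massOn_eq_sum {ι : Type*} {s : Finset ι} {B : Set Γ} {C : ι → Set Γ}
    (h : ∀ z, B.indicator (1 : Γ → ℂ) z = ∑ i ∈ s, (C i).indicator (1 : Γ → ℂ) z) (f : Γ →₀ ℂ) :
    massOn B f = ∑ i ∈ s, massOn (C i) f := by
  simp only [massOn, Finsupp.linearCombination_apply, Finsupp.sum, h, smul_eq_mul, Finset.mul_sum]
  exact Finset.sum_comm

theorem massOn_empty (f : Γ →₀ ℂ) : massOn (∅ : Set Γ) f = 0 := by
  simp [massOn, Finsupp.linearCombination_apply, Finsupp.sum]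

/-- The left regular representation on finitely supported functions. -/
def translation (Γ : Type*) [Group Γ] : Γ →* ((Γ →₀ ℂ) →ₗ[ℂ] (Γ →₀ ℂ)) where
  toFun h := Finsupp.lmapDomain ℂ ℂ (h * ·)
  map_one' := by
    refine Finsupp.lhom_ext fun z a => ?_
    simp
  map_mul' g h := by
    refine Finsupp.lhom_ext fun z a => ?_
    simp [Finsupp.mapDomain_single, mul_assoc]

theorem massOn_translation [Group Γ] {B C : Set Γ} {h : Γ} (hB : ∀ z, h * z ∈ B ↔ z ∈ C)
    (f : Γ →₀ ℂ) : massOn B (translation Γ h f) = massOn C f := by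
  induction f using Finsupp.induction_linear with
  | zero => simp
  | add f g hf hg => simp [hf, hg]
  | single z a =>
    have : translation Γ h (Finsupp.single z a) = Finsupp.single (h * z) a := by
      simp [translation, Finsupp.mapDomain_single]
    rw [this, massOn_single, massOn_single]
    congr 1
    by_cases hz : z ∈ C
    · rw [Set.indicator_of_mem hz, Set.indicator_of_mem ((hB z).2 hz)]; rfl
    · rw [Set.indicator_of_notMem hz, Set.indicator_of_notMem (mt (hB z).1 hz)]

/-- The squared norm given by the masses on a weighted family of sets. -/
def massNormSq {J : Type*} (ω : J → ℝ≥0) (B : J → Set Γ) (f : Γ →₀ ℂ) : ℝ≥0∞ :=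
  ∑' j, (ω j : ℝ≥0∞) * ‖massOn (B j) f‖ₑ ^ 2

theorem massNormSq_ne_top {J : Type*} {ω : J → ℝ≥0} {B : J → Set Γ}
    (h : ∀ z, ∑' j, (B j).indicator (fun _ => (ω j : ℝ≥0∞)) z ≠ ∞) (f : Γ →₀ ℂ) :
    massNormSq ω B f ≠ ∞ := by
  induction f using Finsupp.induction_linear with
  | zero => simp [massNormSq]
  | add f g hf hg =>
    refine ne_top_of_le_ne_top (b := 2 * massNormSq ω B f + 2 * massNormSq ω B g)
      (by finiteness) ?_
    unfold massNormSq
    rw [← ENNReal.tsum_mul_left, ← ENNReal.tsum_mul_left, ← ENNReal.tsum_add]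
    refine ENNReal.tsum_le_tsum fun j => ?_
    rw [map_add]
    calc (ω j : ℝ≥0∞) * ‖massOn (B j) f + massOn (B j) g‖ₑ ^ 2
        ≤ ω j * (2 * (‖massOn (B j) f‖ₑ ^ 2 + ‖massOn (B j) g‖ₑ ^ 2)) := by
          gcongr
          refine (pow_le_pow_left₀ (zero_le) (enorm_add_le _ _) 2).trans ?_
          simp only [enorm_eq_nnnorm]
          norm_cast
          exact add_sq_le
      _ = _ := by ring
  | single z a =>
    have hz := h z
    refine ne_top_of_le_ne_top (ENNReal.mul_ne_top (a := ‖a‖ₑ ^ 2) (by finiteness) hz) ?_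
    unfold massNormSq
    rw [← ENNReal.tsum_mul_left]
    refine ENNReal.tsum_le_tsum fun j => ?_
    rw [massOn_single]
    by_cases hz : z ∈ B j
    · rw [Set.indicator_of_mem hz, Set.indicator_of_mem hz]
      simp [mul_comm]
    · rw [Set.indicator_of_notMem hz, Set.indicator_of_notMem hz]
      simp

theorem enorm_sqrt_sq (a : ℝ≥0) : ‖((NNReal.sqrt a : ℝ) : ℂ)‖ₑ ^ 2 = a := by
  rw [enorm_eq_nnnorm, Complex.nnnorm_real, NNReal.nnnorm_eq]
  norm_cast
  exact NNReal.sq_sqrt a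

theorem lp_enorm_sq {I : Type*} (x : lp (fun _ : I => ℂ) 2) : ‖x‖ₑ ^ 2 = ∑' i, ‖x i‖ₑ ^ 2 := by
  have h2 : (0 : ℝ) < (2 : ℝ≥0∞).toReal := by norm_num
  have h := lp.norm_rpow_eq_tsum h2 x
  have hs := (memℓp_gen_iff h2).1 (lp.memℓp x)
  simp only [ENNReal.toReal_ofNat, Real.rpow_ofNat] at h hs
  have := ENNReal.ofReal_tsum_of_nonneg (fun i => by positivity) hs
  rw [← h] at this
  simpa [ENNReal.ofReal_pow] using this

/-- The vector of square roots of weights times masses. -/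
def massVector {J : Type*} (ω : J → ℝ≥0) (B : J → Set Γ)
    (h : ∀ z, ∑' j, (B j).indicator (fun _ => (ω j : ℝ≥0∞)) z ≠ ∞) :
    (Γ →₀ ℂ) →ₗ[ℂ] lp (fun _ : J => ℂ) 2 where
  toFun f := ⟨fun j => ((NNReal.sqrt (ω j) : ℝ) : ℂ) * massOn (B j) f, by
    refine memℓp_gen ?_
    have := massNormSq_ne_top h f
    have h' := ENNReal.summable_toReal this
    convert h' using 2 with j
    simp [mul_pow]⟩
  map_add' f g := by
    ext j
    simp only [map_add, mul_add]
    rfl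
  map_smul' a f := by
    ext j
    simp only [map_smul, smul_eq_mul, lp.coeFn_smul, Pi.smul_apply, RingHom.id_apply]
    ring

theorem massVector_apply {J : Type*} (ω : J → ℝ≥0) (B : J → Set Γ)
    (h : ∀ z, ∑' j, (B j).indicator (fun _ => (ω j : ℝ≥0∞)) z ≠ ∞) (f : Γ →₀ ℂ) (j : J) :
    massVector ω B h f j = ((NNReal.sqrt (ω j) : ℝ) : ℂ) * massOn (B j) f := rfl

theorem enorm_massVector_sq {J : Type*} (ω : J → ℝ≥0) (B : J → Set Γ)
    (h : ∀ z, ∑' j, (B j).indicator (fun _ => (ω j : ℝ≥0∞)) z ≠ ∞) (f : Γ →₀ ℂ) :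
    ‖massVector ω B h f‖ₑ ^ 2 = massNormSq ω B f := by
  rw [lp_enorm_sq]
  refine tsum_congr fun j => ?_
  rw [massVector_apply, enorm_mul, mul_pow]
  rw [enorm_sqrt_sq]

end Masses

/-- Under strong Property (T), if the masses on a family of sets permuted by `Γ` define a norm for
which `Γ` has polynomial growth, there is an invariant mean in its completion. -/
theorem StrongPropertyT.exists_invariant_masses {G : Type u} [Group G] [TopologicalSpace G]
    [MeasurableSpace G] [BorelSpace G] (hG : StrongPropertyT.{u, v} G)
    {Γ : Type*} [Group Γ] [TopologicalSpace Γ] [DiscreteTopology Γ] [Countable Γ]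
    {φ : G →* Γ} (hφ : Continuous φ) {l : Γ → ℝ} (hl : IsLengthFunction l) {c : ℝ} (hc : 0 ≤ c)
    {p : ℕ} {J : Type*} [Countable J] [MulAction Γ J] {B : J → Set Γ}
    (hB : ∀ h j z, h * z ∈ B (h • j) ↔ z ∈ B j) {ω : J → ℝ≥0} (hω : ∀ j, ω j ≠ 0)
    (hsum : ∀ z, ∑' j, (B j).indicator (fun _ => (ω j : ℝ≥0∞)) z ≠ ∞)
    (hbound : ∀ h f, massNormSq ω B (translation Γ h f) ≤
      ENNReal.ofReal ((c * (l h + 1) ^ p) ^ 2) * massNormSq ω B f)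
    {j₀ : J} (hj₀ : B j₀ = Set.univ) :
    ∃ η : J → ℂ, ∑' j, (ω j : ℝ≥0∞) * ‖η j‖ₑ ^ 2 ≠ ∞ ∧ (∀ g j, η (φ g • j) = η j) ∧
      ∀ s : Finset J, (∀ z, ∑ j ∈ s, (B j).indicator (1 : Γ → ℂ) z = 1) → ∑ j ∈ s, η j = 1 := by
  -- A countable index set has a copy in the universe of the Hilbert spaces to which the hypothesis
  -- applies.
  let e : Shrink.{v} J ≃ J := (equivShrink.{v} J).symm
  have hsum' : ∀ z, ∑' i, (B (e i)).indicator (fun _ => (ω (e i) : ℝ≥0∞)) z ≠ ∞ := by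
    intro z
    rw [e.tsum_eq fun j => (B j).indicator (fun _ => (ω j : ℝ≥0∞)) z]
    exact hsum z
  have hN : ∀ f, massNormSq (fun i => ω (e i)) (fun i => B (e i)) f = massNormSq ω B f := fun f =>
    e.tsum_eq fun j => (ω j : ℝ≥0∞) * ‖massOn (B j) f‖ₑ ^ 2
  let Φ₀ := massVector (fun i => ω (e i)) (fun i => B (e i)) hsum'
  let K := (LinearMap.range Φ₀).topologicalClosure
  let Φ : (Γ →₀ ℂ) →ₗ[ℂ] K := Φ₀.codRestrict K fun f =>
    Submodule.le_topologicalClosure _ ⟨f, rfl⟩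
  have : CompleteSpace K := (Submodule.isClosed_topologicalClosure _).completeSpace_coe
  have hd : DenseRange Φ := by
    refine Subtype.dense_iff.2 fun x hx => ?_
    refine closure_mono ?_ hx
    rintro _ ⟨f, rfl⟩
    exact ⟨Φ f, ⟨f, rfl⟩, rfl⟩
  let coord : J → K →L[ℂ] ℂ := fun j =>
    (((NNReal.sqrt (ω j) : ℝ) : ℂ)⁻¹) • (lp.evalCLM ℂ (fun _ : Shrink.{v} J => ℂ) 2 (e.symm j)).comp
      K.subtypeL
  have hs : ∀ j, ((NNReal.sqrt (ω j) : ℝ) : ℂ) ≠ 0 := fun j => by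
    simpa using hω j
  have hcoord : ∀ j (y : K), ((NNReal.sqrt (ω j) : ℝ) : ℂ) * coord j y = y.1 (e.symm j) := by
    intro j y
    exact mul_inv_cancel_left₀ (hs j) _
  have hcoordΦ : ∀ j f, coord j (Φ f) = massOn (B j) f := by
    intro j f
    refine mul_left_cancel₀ (hs j) ?_
    rw [hcoord]
    have : e (e.symm j) = j := e.apply_symm_apply j
    change massVector _ _ _ f (e.symm j) = _
    rw [massVector_apply, this]
  have htr : ∀ g j f, massOn (B (g • j)) (translation Γ g f) = massOn (B j) f := fun g j f =>
    massOn_translation (fun z => hB g j z) f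
  have huniv : ∀ h f, massOn (B j₀) (translation Γ h f) = massOn (B j₀) f := fun h f =>
    massOn_translation (fun z => by simp [hj₀]) f
  obtain ⟨y, hy₀, hy⟩ := hG.exists_invariant hφ hl hc (p := p) (translation Γ) hd
    (fun g f => by
      have h1 : ‖Φ (translation Γ g f)‖ₑ ^ 2 ≤
          ENNReal.ofReal ((c * (l g + 1) ^ p) ^ 2) * ‖Φ f‖ₑ ^ 2 := by
        have h := hbound g f
        rw [← hN, ← hN, ← enorm_massVector_sq _ _ hsum', ← enorm_massVector_sq _ _ hsum'] at h
        exact h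
      have h0 := hl.nonneg g
      refine (sq_le_sq₀ (by positivity) (by positivity)).1 ?_
      rw [mul_pow]
      rw [← ofReal_norm, ← ofReal_norm, ← ENNReal.ofReal_pow (by positivity),
        ← ENNReal.ofReal_pow (by positivity), ← ENNReal.ofReal_mul (by positivity)] at h1
      exact (ENNReal.ofReal_le_ofReal_iff (by positivity)).1 h1)
    (lam := coord j₀) (fun g f => by rw [hcoordΦ, hcoordΦ, huniv]) (Finsupp.single 1 1)
  rw [hcoordΦ, massOn_single] at hy₀
  refine ⟨fun j => coord j y, ?_, fun g j => ?_, fun s hs1 => ?_⟩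
  · have h1 : (∑' i, ‖(y : lp (fun _ : Shrink.{v} J => ℂ) 2) i‖ₑ ^ 2) ≠ ∞ := by
      rw [← lp_enorm_sq]
      finiteness
    rw [← e.symm.tsum_eq] at h1
    convert h1 using 4 with j
    rw [← hcoord, enorm_mul, mul_pow]
    rw [enorm_sqrt_sq]
  · refine hy g _ _ fun f => ?_
    rw [hcoordΦ, hcoordΦ, htr]
  · have h1 : ∀ f, massOn (B j₀) f = ∑ j ∈ s, massOn (B j) f := by
      refine massOn_eq_sum fun z => ?_
      rw [hs1, hj₀]
      simp
    -- With `g = 1` the intertwining clause says that linear relations between masses survive in the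
    -- completion.
    have h2 := hy 1 (coord j₀) (∑ j ∈ s, coord j) fun f => by
      simp [hcoordΦ, ← h1]
    rw [hy₀] at h2
    simpa [hj₀] using h2.symm

/-! ### Reach of a set of points, and exponential sums over it. -/

section Reach

variable {Γ Z : Type*} {X : SimpleGraph (Γ ⊕ Z)} {D : Γ → Γ → ℕ} {δ N : ℕ}

/-- The largest `D`-distance from `b` to the intervals between `x` and the points of `T`. -/
def SimpleGraph.reach (X : SimpleGraph (Γ ⊕ Z)) (D : Γ → Γ → ℕ) (b x : Γ) (T : Set Γ) : ℕ :=
  sInf {κ | ∀ z ∈ T, ¬ X.FarFrom D κ b x z}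

theorem SimpleGraph.FarFrom.mono {κ κ' : ℕ} {b x z : Γ} (h : X.FarFrom D κ b x z) (hκ : κ' ≤ κ) :
    X.FarFrom D κ' b x z :=
  fun w hw => hκ.trans_lt (h w hw)

theorem SimpleGraph.reach_le_iff {b x : Γ} {T : Set Γ} {κ : ℕ} :
    X.reach D b x T ≤ κ ↔ ∀ z ∈ T, ¬ X.FarFrom D κ b x z := by
  have hne : {κ | ∀ z ∈ T, ¬ X.FarFrom D κ b x z}.Nonempty :=
    ⟨D b x, fun z _ h => lt_irrefl _ (h x (SimpleGraph.btw_left _ _))⟩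
  refine ⟨fun h z hz hf => ?_, fun h => Nat.sInf_le h⟩
  exact Nat.sInf_mem hne z hz (hf.mono h)

theorem SimpleGraph.exists_D_eq_reach (X : SimpleGraph (Γ ⊕ Z)) (b x z : Γ) :
    ∃ w, X.Btw (inl x) (inl w) (inl z) ∧ D b w ≤ X.reach D b x {z} := by
  have h := SimpleGraph.reach_le_iff.1 (le_refl (X.reach D b x {z})) z rfl
  unfold SimpleGraph.FarFrom at h
  push Not at h
  exact h

namespace ConedGeometry

variable (hX : ConedGeometry X D δ N)
include hX

/-- In the triangle `x', x, z` a point of `[x', z]` close to `b` is near `[x, z]` or near `[x', x]`.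
One `z` of the second kind gives the second alternative. -/
theorem reach_le_or_reach_le (hN : 8 ≤ N) (b x x' : Γ) (T : Set Γ) :
    X.reach D b x T ≤ X.reach D b x' T + (δ + 1) ∨
      X.reach D b x {x'} ≤ X.reach D b x' T + (δ + 1) := by
  rw [SimpleGraph.reach_le_iff, SimpleGraph.reach_le_iff, or_iff_not_imp_right]
  intro hf z hz hfar
  simp only [Set.mem_singleton_iff, forall_eq, not_not] at hf
  have hz' := SimpleGraph.reach_le_iff.1 (le_refl (X.reach D b x' T)) z hz
  unfold SimpleGraph.FarFrom at hz'
  push Not at hz'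
  obtain ⟨w, hw, hwd⟩ := hz'
  obtain ⟨w', hw' | hw', hd⟩ := hX.thin hN (y := inl x) hw
  · have h1 := hf w' hw'.symm
    have h2 := hX.D_tri b w w'
    omega
  · have h1 := hfar w' hw'
    have h2 := hX.D_tri b w w'
    omega

/-- Exponentially decaying functions of the distance to a geodesic have sum at most linear in its
length. -/
theorem tsum_pow_reach_le (hN : 5 ≤ N) {q S : ℝ≥0∞} (hq : q ≤ 1) (hS : ∀ a, ∑' b, q ^ D a b ≤ S)
    (x z : Γ) :
    q ^ (2 * δ) * ∑' b, q ^ X.reach D b x {z} ≤ (X.dist (inl x) (inl z) + 1) * S := by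
  classical
  -- One representative per level of the interval suffices, since points of equal level are within
  -- `2δ`.
  let v : ℕ → Γ := fun n => if h : ∃ w, X.Btw (inl x) (inl w) (inl z) ∧
    X.dist (inl x) (inl w) = n then h.choose else x
  have hv : ∀ w, X.Btw (inl x) (inl w) (inl z) → D (v (X.dist (inl x) (inl w))) w ≤ 2 * δ := by
    intro w hw
    have h : ∃ w', X.Btw (inl x) (inl w') (inl z) ∧
      X.dist (inl x) (inl w') = X.dist (inl x) (inl w) := ⟨w, hw, rfl⟩
    have h1 : v (X.dist (inl x) (inl w)) = h.choose := dif_pos h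
    rw [h1]
    exact hX.D_le_of_same_level hN h.choose_spec.1 hw h.choose_spec.2
  rw [← ENNReal.tsum_mul_left]
  calc ∑' b, q ^ (2 * δ) * q ^ X.reach D b x {z}
      ≤ ∑' b, ∑ n ∈ Finset.range (X.dist (inl x) (inl z) + 1), q ^ D (v n) b := by
        refine ENNReal.tsum_le_tsum fun b => ?_
        obtain ⟨w, hw, hwd⟩ := X.exists_D_eq_reach (D := D) b x z
        have h1 := hv w hw
        have h2 := hX.D_tri (v (X.dist (inl x) (inl w))) w b
        rw [hX.D_comm w b] at h2
        have h3 : X.dist (inl x) (inl w) ∈ Finset.range (X.dist (inl x) (inl z) + 1) := by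
          unfold SimpleGraph.Btw at hw
          rw [Finset.mem_range]
          omega
        refine le_trans ?_ (Finset.single_le_sum (f := fun n => q ^ D (v n) b)
          (fun _ _ => zero_le) h3)
        rw [← pow_add]
        exact pow_le_pow_right_of_le_one' hq (by omega)
    _ = ∑ n ∈ Finset.range (X.dist (inl x) (inl z) + 1), ∑' b, q ^ D (v n) b :=
        Summable.tsum_finsetSum fun _ _ => ENNReal.summable
    _ ≤ ∑ n ∈ Finset.range (X.dist (inl x) (inl z) + 1), S := Finset.sum_le_sum fun _ _ => hS _
    _ = _ := by simp

end ConedGeometry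

end Reach

/-! ### View classes and the linear bound on their masses. -/

/-- A finite equivariant system of names for the flags at each group element and for the classes of
points with the same view from a flag. -/
structure FlagTypes {Γ Z : Type*} [Group Γ] (X : SimpleGraph (Γ ⊕ Z)) (D : Γ → Γ → ℕ)
    (P : ViewParams) (O Θ : Type*) where
  apex : Γ → O → Γ ⊕ Z
  type : Γ → O → Γ → Θ
  base : O
  apex_base : ∀ b, apex b base = inl b
  isFlag : ∀ b o, X.IsFlag (apex b o) b
  exists_apex : ∀ s b, X.IsFlag s b → ∃ o, apex b o = s
  type_eq_iff : ∀ b o z z', type b o z = type b o z' ↔ X.SameView D P (apex b o) b z z'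
  type_mul : ∀ h b o z, type (h * b) o (h * z) = type b o z
  D_mul : ∀ h a b, D (h * a) (h * b) = D a b
  dist_mul : ∀ h a b, X.dist (inl (h * a)) (inl (h * b)) = X.dist (inl a) (inl b)

namespace ConedGeometry

variable {Γ Z : Type*} [Group Γ] {X : SimpleGraph (Γ ⊕ Z)} {D : Γ → Γ → ℕ} {δ N : ℕ}
  {O Θ : Type*} [Fintype Θ]

/-- The mass of a union of view classes is controlled, linearly in the distance of the flag from the
base point, by the masses of the classes which stay near their base point. -/
theorem norm_massOn_le (hX : ConedGeometry X D δ N) (hN : 30 * δ + 100 ≤ N)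
    (F : FlagTypes X D (viewParams δ) O Θ) {x : Γ} {f : Γ →₀ ℂ} {M C : ℝ} (hM : 0 ≤ M) (hC : 0 ≤ C)
    (h₀ : ‖massOn Set.univ f‖ ≤ M)
    (h₁ : ∀ b o θ, (∀ z, F.type b o z = θ → ¬ X.FarFrom D (farConst δ) b x z) →
      ‖massOn {z | F.type b o z = θ} f‖ ≤ C * M) :
    ∀ n s b A, X.IsFlag s b → flagDist X x s b ≤ n →
      (∀ z z', z ∈ A → X.SameView D (viewParams δ) s b z z' → z' ∈ A) →
      ‖massOn A f‖ ≤ (Fintype.card Θ * C + 1) * (n + 1) * M := by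
  classical
  have hnear : ∀ s b (A : Set Γ), X.IsFlag s b →
      (∀ z z', z ∈ A → X.SameView D (viewParams δ) s b z z' → z' ∈ A) →
      (∀ z ∈ A, ¬ X.FarFrom D (farConst δ) b x z) → ‖massOn A f‖ ≤ Fintype.card Θ * C * M := by
    intro s b A hs hA hfar
    obtain ⟨o, rfl⟩ := F.exists_apex s b hs
    have hsum : massOn A f = ∑ θ : Θ, massOn (A ∩ {z | F.type b o z = θ}) f := by
      refine massOn_eq_sum (fun z => ?_) f
      rw [Finset.sum_eq_single (F.type b o z)]
      · by_cases hz : z ∈ A <;> simp [hz]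
      · intro θ _ hθ
        rw [Set.indicator_of_notMem]
        exact fun h => hθ h.2.symm
      · simp
    rw [hsum]
    refine (norm_sum_le_of_le _ (fun θ _ => ?_)).trans (b := ∑ θ : Θ, C * M) (by simp [mul_assoc])
    by_cases hθ : ∃ z ∈ A, F.type b o z = θ
    · obtain ⟨z, hz, rfl⟩ := hθ
      have hsub : ∀ z', F.type b o z' = F.type b o z → z' ∈ A := fun z' hz' =>
        hA z z' hz ((F.type_eq_iff b o z z').1 hz'.symm)
      rw [Set.inter_eq_right.2 (show {z' | F.type b o z' = F.type b o z} ⊆ A from hsub)]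
      exact h₁ b o _ fun z' hz' => hfar z' (hsub z' hz')
    · have : A ∩ {z | F.type b o z = θ} = ∅ := by
        refine Set.eq_empty_of_forall_notMem ?_
        rintro z ⟨h1, h2⟩
        exact hθ ⟨z, h1, h2⟩
      rw [this, massOn_empty, norm_zero]
      positivity
  have hadd : ∀ A B : Set Γ, Disjoint A B → massOn (A ∪ B) f = massOn A f + massOn B f := by
    intro A B hAB
    have := massOn_eq_sum (s := Finset.univ) (C := fun i : Bool => if i then A else B)
      (B := A ∪ B) (fun z => by
        simp only [Fintype.sum_bool, if_true]
        rw [Set.indicator_union_of_disjoint hAB]; simp) f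
    simpa using this
  have hK : 0 ≤ Fintype.card Θ * C := by positivity
  intro n
  induction n with
  | zero =>
    intro s b A hs hn hA
    rcases hX.exists_closer_flag hN hs x with h | ⟨s', b', -, hlt, -⟩
    · refine (hnear s b A hs hA fun z _ => h z).trans ?_
      simp only [Nat.cast_zero, zero_add, mul_one]
      nlinarith
    · omega
  | succ n ih =>
    intro s b A hs hn hA
    rcases hX.exists_closer_flag hN hs x with h | ⟨s', b', hs', hlt, E, hE, hfar⟩
    · refine (hnear s b A hs hA fun z _ => h z).trans ?_
      push_cast
      have : 0 ≤ (n : ℝ) + 1 := by positivity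
      have h3 : 0 ≤ (Fintype.card Θ * C + 1) * ((n : ℝ) + 1) * M := by positivity
      nlinarith
    · have key : ∀ A : Set Γ,
          (∀ z z', z ∈ A → X.SameView D (viewParams δ) s b z z' → z' ∈ A) →
          (∀ z ∈ A, ¬ E z) →
          ‖massOn A f‖ ≤ Fintype.card Θ * C * M + (Fintype.card Θ * C + 1) * (n + 1) * M := by
        intro A hA hAE
        -- `A₂` collects the classes with a far member. It is also a union of classes for the closer
        -- flag, so the induction applies; the remaining classes are controlled by `h₁`.
        set A₂ : Set Γ := {z ∈ A | ∃ z', X.SameView D (viewParams δ) s b z' z ∧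
          X.FarFrom D (farConst δ) b x z'} with hA₂
        have hsub : A₂ ⊆ A := fun z hz => hz.1
        rw [← Set.sdiff_union_of_subset hsub, hadd _ _ Set.disjoint_sdiff_left]
        refine (norm_add_le _ _).trans (add_le_add ?_ ?_)
        · refine hnear s b _ hs ?_ ?_
          · rintro z z' ⟨hz, hz₂⟩ hzz'
            refine ⟨hA z z' hz hzz', ?_⟩
            rintro ⟨-, y, hy, hyf⟩
            refine hz₂ ⟨hz, y, ?_, hyf⟩
            obtain ⟨o, rfl⟩ := F.exists_apex s b hs
            rw [← F.type_eq_iff] at *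
            rw [hy, hzz']
          · rintro z ⟨hz, hz₂⟩ hzf
            exact hz₂ ⟨hz, z, fun y _ => rfl, hzf⟩
        · refine ih s' b' A₂ hs' (by omega) ?_
          rintro z'' z' ⟨hz, z, hzz, hzf⟩ hz'
          have hzA : z ∈ A := hA z'' z hz hzz.symm
          have h1 := (hfar z hzf).resolve_left (hAE z hzA) z'' hzz z' hz'
          refine ⟨hA _ _ hz h1, z, ?_, hzf⟩
          obtain ⟨o, rfl⟩ := F.exists_apex s b hs
          rw [← F.type_eq_iff] at *
          rw [hzz, h1]
      push_cast
      by_cases hAE : ∀ z ∈ A, ¬ E z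
      · refine (key A hA hAE).trans ?_
        nlinarith
      · push Not at hAE
        obtain ⟨z₁, hz₁, hz₁E⟩ := hAE
        -- `E` lies in one class, so if `A` meets it then the complement of `A` does not. Passing to
        -- the complement costs only the total mass.
        have hc := key Aᶜ (fun z z' hz hzz' hz' => hz (hA z' z hz' hzz'.symm))
          (fun z hz hzE => hz (hA z₁ z hz₁ (hE _ _ hz₁E hzE)))
        have h2 := hadd A Aᶜ disjoint_compl_right
        rw [Set.union_compl_self] at h2
        have h3 : massOn A f = massOn Set.univ f - massOn Aᶜ f := by rw [h2]; ring
        rw [h3]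
        refine (norm_sub_le _ _).trans ?_
        nlinarith

end ConedGeometry

/-! ### The weighted norm and the change of base point. -/

/-- The total set, or a class of points with the same view from a flag. -/
inductive FlagIndex (Γ O Θ : Type*)
  | total
  | part (b : Γ) (o : O) (θ : Θ)

namespace FlagIndex

variable {Γ O Θ : Type*}

/-- An index is either the total set or a triple. -/
def equivSum (Γ O Θ : Type*) : FlagIndex Γ O Θ ≃ Unit ⊕ (Γ × O × Θ) where
  toFun
    | total => inl ()
    | part b o θ => inr (b, o, θ)
  invFun
    | inl _ => total
    | inr (b, o, θ) => part b o θ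
  left_inv := by rintro (_ | _) <;> rfl
  right_inv := by rintro (_ | _) <;> rfl

instance [Countable Γ] [Countable O] [Countable Θ] : Countable (FlagIndex Γ O Θ) :=
  (equivSum Γ O Θ).injective.countable

instance [Group Γ] : MulAction Γ (FlagIndex Γ O Θ) where
  smul h
    | total => total
    | part b o θ => part (h * b) o θ
  one_smul := by
    rintro (_ | ⟨b, o, θ⟩)
    · rfl
    · exact congrArg (part · o θ) (one_mul b)
  mul_smul g h := by
    rintro (_ | ⟨b, o, θ⟩)
    · rfl
    · exact congrArg (part · o θ) (mul_assoc g h b)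

theorem smul_part [Group Γ] (h b : Γ) (o : O) (θ : Θ) :
    h • (part b o θ : FlagIndex Γ O Θ) = part (h * b) o θ := rfl

theorem tsum_eq [Fintype O] [Fintype Θ] (a : FlagIndex Γ O Θ → ℝ≥0∞) :
    ∑' j, a j = a total + ∑' b, ∑ o, ∑ θ, a (part b o θ) := by
  rw [← (equivSum Γ O Θ).symm.tsum_eq, Summable.tsum_sum ENNReal.summable ENNReal.summable,
    tsum_fintype, ENNReal.tsum_prod']
  refine congrArg₂ _ (by simp [equivSum]) ?_
  refine tsum_congr fun b => ?_
  rw [tsum_fintype, Fintype.sum_prod_type]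
  rfl

end FlagIndex

namespace FlagTypes

variable {Γ Z : Type*} [Group Γ] {X : SimpleGraph (Γ ⊕ Z)} {D : Γ → Γ → ℕ} {P : ViewParams}
  {O Θ : Type*}

open FlagIndex

/-- The set of points with a given index. -/
def piece (F : FlagTypes X D P O Θ) : FlagIndex Γ O Θ → Set Γ
  | total => Set.univ
  | part b o θ => {z | F.type b o z = θ}

/-- Weights decaying exponentially with the reach of the pieces. -/
def weight (F : FlagTypes X D P O Θ) (q : ℝ≥0) (x : Γ) : FlagIndex Γ O Θ → ℝ≥0
  | total => 1
  | part b o θ => q ^ X.reach D b x {z | F.type b o z = θ}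

theorem mul_mem_piece (F : FlagTypes X D P O Θ) (h : Γ) (j : FlagIndex Γ O Θ) (z : Γ) :
    h * z ∈ F.piece (h • j) ↔ z ∈ F.piece j := by
  rcases j with _ | ⟨b, o, θ⟩
  · exact iff_of_true (Set.mem_univ _) (Set.mem_univ _)
  · change F.type (h * b) o (h * z) = θ ↔ F.type b o z = θ
    rw [F.type_mul]

theorem farFrom_mul (F : FlagTypes X D P O Θ) (h : Γ) (κ : ℕ) (b x z : Γ) :
    X.FarFrom D κ (h * b) (h * x) (h * z) ↔ X.FarFrom D κ b x z := by
  unfold SimpleGraph.FarFrom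
  rw [(Equiv.mulLeft h).surjective.forall]
  simp only [Equiv.coe_mulLeft, SimpleGraph.Btw, F.dist_mul, F.D_mul]

theorem reach_mul (F : FlagTypes X D P O Θ) (h b x : Γ) (o : O) (θ : Θ) :
    X.reach D (h * b) (h * x) {z | F.type (h * b) o z = θ} =
      X.reach D b x {z | F.type b o z = θ} := by
  unfold SimpleGraph.reach
  congr 1
  ext κ
  simp only [Set.mem_ofPred_eq]
  rw [(Equiv.mulLeft h).surjective.forall]
  simp only [Equiv.coe_mulLeft, F.type_mul, F.farFrom_mul]

theorem weight_smul (F : FlagTypes X D P O Θ) (q : ℝ≥0) (h x : Γ) (j : FlagIndex Γ O Θ) :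
    F.weight q (h * x) (h • j) = F.weight q x j := by
  rcases j with _ | ⟨b, o, θ⟩
  · rfl
  · exact congrArg (q ^ ·) (F.reach_mul h b x o θ)

theorem massNormSq_translation (F : FlagTypes X D P O Θ) (q : ℝ≥0) (h x : Γ) (f : Γ →₀ ℂ) :
    massNormSq (F.weight q (h * x)) F.piece (translation Γ h f) =
      massNormSq (F.weight q x) F.piece f := by
  unfold massNormSq
  rw [← (MulAction.toPerm h : Equiv.Perm (FlagIndex Γ O Θ)).tsum_eq]
  refine tsum_congr fun j => ?_
  rw [MulAction.toPerm_apply, F.weight_smul,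
    massOn_translation (fun z => F.mul_mem_piece h j z)]

variable [Fintype O] [Fintype Θ]

/-- Each flag has exactly one class containing `z`, whose reach is at least that of `{z}`;
`tsum_pow_reach_le` bounds the sum. -/
theorem tsum_indicator_weight_ne_top (F : FlagTypes X D P O Θ) {δ N : ℕ}
    (hX : ConedGeometry X D δ N) (hN : 5 ≤ N) {q S : ℝ≥0} (hq₀ : q ≠ 0) (hq : q ≤ 1)
    (hS : ∀ a, ∑' b, (q : ℝ≥0∞) ^ D a b ≤ S) (x z : Γ) :
    ∑' j, (F.piece j).indicator (fun _ => (F.weight q x j : ℝ≥0∞)) z ≠ ∞ := by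
  classical
  rw [FlagIndex.tsum_eq]
  have h1 := hX.tsum_pow_reach_le hN (ENNReal.coe_le_one_iff.2 hq) hS x z
  have h2 : ∑' b, (q : ℝ≥0∞) ^ X.reach D b x {z} ≠ ∞ := by
    intro h
    rw [h, ENNReal.mul_top (pow_ne_zero _ (by simpa using hq₀))] at h1
    exact (ne_top_of_le_ne_top (by finiteness) h1) rfl
  refine ENNReal.add_ne_top.2 ⟨?_, ?_⟩
  · simp [piece]
  · refine ne_top_of_le_ne_top (ENNReal.mul_ne_top (a := Fintype.card O) (by simp) h2) ?_
    rw [← ENNReal.tsum_mul_left]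
    refine ENNReal.tsum_le_tsum fun b => ?_
    rw [← nsmul_eq_mul]
    refine Finset.sum_le_card_nsmul _ _ _ fun o _ => ?_
    rw [Finset.sum_eq_single (F.type b o z)]
    · rw [Set.indicator_of_mem (show z ∈ F.piece (part b o (F.type b o z)) from rfl)]
      simp only [weight, ENNReal.coe_pow]
      refine pow_le_pow_right_of_le_one' (ENNReal.coe_le_one_iff.2 hq) ?_
      rw [SimpleGraph.reach_le_iff]
      rintro _ rfl
      exact SimpleGraph.reach_le_iff.1 le_rfl _ rfl
    · intro θ _ hθ
      rw [Set.indicator_of_notMem]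
      exact fun h => hθ h.symm
    · simp

/-- Change of base point. -/
theorem exists_massNormSq_le {δ N : ℕ} (F : FlagTypes X D (viewParams δ) O Θ)
    (hX : ConedGeometry X D δ N) (hN : 30 * δ + 100 ≤ N) {q S : ℝ≥0} (hq₀ : q ≠ 0) (hq : q ≤ 1)
    (hS : ∀ a, ∑' b, (q : ℝ≥0∞) ^ D a b ≤ S) :
    ∃ K : ℝ≥0, ∀ x x' f, massNormSq (F.weight (q / 4) x') F.piece f ≤
      K * (X.dist (inl x) (inl x') + 1) ^ 3 * massNormSq (F.weight (q / 4) x) F.piece f := by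
  classical
  -- The factor `4` is chosen to absorb the growth `4 ^ reach` of the squared masses in `hmass`,
  -- leaving the summable `q ^ reach`.
  set w : ℝ≥0 := q / 4 with hw
  have hw₀ : w ≠ 0 := by positivity
  have hwq : w ≤ q := by
    rw [hw]; exact div_le_self (zero_le) (by norm_num)
  have hw₁ : w ≤ 1 := hwq.trans hq
  have h4 : w * 4 = q := by rw [hw]; field_simp
  set V : ℝ≥0 := (w ^ (δ + 1))⁻¹ with hV
  have hV₁ : 1 ≤ V := (one_le_inv₀ (by positivity)).2 (pow_le_one₀ zero_le hw₁)
  have hVw : ∀ r r', r ≤ r' + (δ + 1) → w ^ r' ≤ V * w ^ r := by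
    intro r r' h
    have h1 : w ^ (r' + (δ + 1)) ≤ w ^ r := pow_le_pow_right_of_le_one' hw₁ h
    rw [hV, inv_mul_eq_div, le_div_iff₀ (by positivity), ← pow_add]
    exact h1
  have hSw : ∀ a, ∑' b, (w : ℝ≥0∞) ^ D a b ≤ S := fun a =>
    (ENNReal.tsum_le_tsum fun b => by gcongr).trans (hS a)
  set c : ℝ≥0 := Fintype.card Θ * (w ^ farConst δ)⁻¹ + 1 with hc
  refine ⟨V + V * (16 * c ^ 2) * (Fintype.card O * Fintype.card Θ) * ((q ^ (2 * δ))⁻¹ * S),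
    fun x x' f => ?_⟩
  set d := X.dist (inl x) (inl x') with hd
  have hfin : massNormSq (F.weight w x) F.piece f ≠ ∞ :=
    massNormSq_ne_top (F.tsum_indicator_weight_ne_top hX (by omega) hw₀ hw₁ hSw x) f
  obtain ⟨n, hn⟩ : ∃ n : ℝ≥0, (n : ℝ≥0∞) = massNormSq (F.weight w x) F.piece f :=
    ⟨_, ENNReal.coe_toNNReal hfin⟩
  have hterm : ∀ j, F.weight w x j * ‖massOn (F.piece j) f‖₊ ^ 2 ≤ n := by
    intro j
    have h1 := ENNReal.le_tsum (f := fun j => (F.weight w x j : ℝ≥0∞) *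
      ‖massOn (F.piece j) f‖ₑ ^ 2) j
    change _ ≤ massNormSq (F.weight w x) F.piece f at h1
    rw [← hn, enorm_eq_nnnorm] at h1
    exact_mod_cast h1
  have hmass : ∀ b o θ, ‖massOn (F.piece (part b o θ)) f‖₊ ^ 2 ≤
      16 * c ^ 2 * (d + 1) ^ 2 * n * 4 ^ X.reach D b x {x'} := by
    intro b o θ
    have h1 := hX.norm_massOn_le hN F (x := x) (f := f) (M := Real.sqrt n)
      (C := ((w ^ farConst δ)⁻¹ : ℝ≥0)) (by positivity) (by positivity) (by
        refine Real.le_sqrt_of_sq_le ?_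
        have := hterm total
        simp only [weight, piece, one_mul] at this
        exact_mod_cast this) (by
        intro b o θ hfar
        have h2 := hterm (part b o θ)
        have h3 : w ^ farConst δ ≤ F.weight w x (part b o θ) :=
          pow_le_pow_right_of_le_one' hw₁ (SimpleGraph.reach_le_iff.2 hfar)
        have h4 : w ^ farConst δ * ‖massOn (F.piece (part b o θ)) f‖₊ ^ 2 ≤ n :=
          (mul_le_mul_left h3 _).trans h2
        have h5 : w ^ farConst δ ≤ 1 := pow_le_one₀ zero_le hw₁
        have h6 : 0 < w ^ farConst δ := by positivity
        refine abs_le_of_sq_le_sq' ?_ (by positivity) |>.2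
        rw [mul_pow, Real.sq_sqrt (by positivity)]
        change ((‖massOn (F.piece (part b o θ)) f‖₊ : ℝ≥0) : ℝ) ^ 2 ≤ _
        norm_cast
        rw [inv_pow, inv_mul_eq_div, le_div_iff₀ (by positivity)]
        calc _ = w ^ farConst δ * (w ^ farConst δ * ‖massOn (F.piece (part b o θ)) f‖₊ ^ 2) := by
              ring
          _ ≤ w ^ farConst δ * ‖massOn (F.piece (part b o θ)) f‖₊ ^ 2 :=
              mul_le_of_le_one_left zero_le h5
          _ ≤ n := h4)
      (ConedGeometry.flagDist X x (F.apex b o) b) (F.apex b o) b (F.piece (part b o θ)) (F.isFlag b o) le_rfl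
      (by
        intro z z' hz hzz'
        exact ((F.type_eq_iff b o z z').2 hzz').symm.trans hz)
    obtain ⟨v, hv, hvd⟩ := X.exists_D_eq_reach (D := D) b x x'
    set g := X.reach D b x {x'} with hg
    -- The flag is within about `2g` of the interval between `x` and `x'`, of length `d`; with `g +
    -- 1 ≤ 2 ^ g` the linear mass bound becomes `2 ^ g * (d + 1)` up to constants.
    have h2 : ConedGeometry.flagDist X x (F.apex b o) b + 1 ≤ 4 * (g + 1) * (d + 1) := by
      have t1 : X.dist (F.apex b o) (inl x) ≤ X.dist (inl b) (inl x) + 1 := by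
        rcases F.isFlag b o with h | ⟨c, h, hadj⟩
        · rw [h]; omega
        · have t := hX.conn.dist_triangle (u := F.apex b o) (v := inl b) (w := inl x)
          rw [h] at t ⊢
          rw [X.dist_comm (u := inr c) (v := inl b), SimpleGraph.dist_eq_one_iff_adj.2 hadj] at t
          omega
      have t2 := hX.conn.dist_triangle (u := inl b) (v := inl v) (w := inl x)
      have t3 := hX.dist_le b v
      have t4 : ConedGeometry.flagDist X x (F.apex b o) b ≤ 2 * X.dist (F.apex b o) (inl x) + 1 := by
        unfold ConedGeometry.flagDist
        split_ifs <;> omega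
      rw [X.dist_comm (u := inl v)] at t2
      unfold SimpleGraph.Btw at hv
      have t5 : 4 * (g + 1) * (d + 1) = 4 * (g * d) + 4 * g + 4 * d + 4 := by ring
      have t6 : 0 ≤ g * d := by positivity
      omega
    have h3 : g + 1 ≤ 2 ^ g := Nat.lt_two_pow_self
    have h4 : (‖massOn (F.piece (part b o θ)) f‖ : ℝ) ≤
        (c : ℝ) * (4 * 2 ^ g * (d + 1)) * Real.sqrt n := by
      refine h1.trans ?_
      have h5 : ((ConedGeometry.flagDist X x (F.apex b o) b : ℝ) + 1) ≤ 4 * 2 ^ g * (d + 1) := by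
        calc ((ConedGeometry.flagDist X x (F.apex b o) b : ℝ) + 1) ≤ 4 * (g + 1) * (d + 1) := by exact_mod_cast h2
          _ ≤ _ := by gcongr; exact_mod_cast h3
      rw [hc]
      push_cast
      gcongr
    rw [← NNReal.coe_le_coe]
    push_cast
    refine (pow_le_pow_left₀ (norm_nonneg _) h4 2).trans (le_of_eq ?_)
    rw [mul_pow, mul_pow, mul_pow, mul_pow, Real.sq_sqrt (by positivity), ← pow_mul, mul_comm g 2,
      pow_mul]
    norm_num
    ring
  let B : ℝ≥0 := V * (16 * c ^ 2 * (d + 1) ^ 2 * n)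
  let e : FlagIndex Γ O Θ → ℝ≥0∞
    | total => 0
    | part b _ _ => B * (q : ℝ≥0∞) ^ X.reach D b x {x'}
  have hle : ∀ j, (F.weight w x' j : ℝ≥0∞) * ‖massOn (F.piece j) f‖ₑ ^ 2 ≤
      V * ((F.weight w x j : ℝ≥0∞) * ‖massOn (F.piece j) f‖ₑ ^ 2) + e j := by
    rintro (_ | ⟨b, o, θ⟩)
    · refine le_add_right ?_
      rw [enorm_eq_nnnorm]
      norm_cast
      simp only [weight, one_mul]
      exact le_mul_of_one_le_left zero_le hV₁
    · have hm := hmass b o θ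
      -- Either the two weights are comparable, or the new weight decays with the distance of `b`
      -- from `[x, x']`, and the mass bound takes over.
      have h1 : F.weight w x' (part b o θ) ≤ V * F.weight w x (part b o θ) ∨
          F.weight w x' (part b o θ) ≤ V * w ^ X.reach D b x {x'} :=
        (hX.reach_le_or_reach_le (by omega) b x x' {z | F.type b o z = θ}).imp (hVw _ _) (hVw _ _)
      simp only [e]
      rw [enorm_eq_nnnorm]
      norm_cast
      rcases h1 with h1 | h1
      · refine le_add_right ?_
        rw [← mul_assoc]
        gcongr
      · refine le_add_left ?_
        refine (mul_le_mul' h1 hm).trans (le_of_eq ?_)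
        rw [← h4, mul_pow]
        ring
  have he : ∑' j, e j = B * (Fintype.card O * Fintype.card Θ) *
      ∑' b, (q : ℝ≥0∞) ^ X.reach D b x {x'} := by
    rw [FlagIndex.tsum_eq, ← ENNReal.tsum_mul_left]
    simp only [e, zero_add, Finset.sum_const, Finset.card_univ, nsmul_eq_mul]
    refine tsum_congr fun b => ?_
    ring
  have hsum : ∑' b, (q : ℝ≥0∞) ^ X.reach D b x {x'} ≤
      ((q ^ (2 * δ))⁻¹ : ℝ≥0) * S * (d + 1) := by
    have h1 := hX.tsum_pow_reach_le (by omega) (ENNReal.coe_le_one_iff.2 hq) hS x x'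
    rw [mul_comm, ← ENNReal.le_div_iff_mul_le (by simp [hq₀]) (by simp), ENNReal.div_eq_inv_mul] at h1
    refine h1.trans (le_of_eq ?_)
    rw [← hd, ENNReal.coe_inv (by positivity), ENNReal.coe_pow]
    ring
  calc massNormSq (F.weight w x') F.piece f
      ≤ ∑' j, (V * ((F.weight w x j : ℝ≥0∞) * ‖massOn (F.piece j) f‖ₑ ^ 2) + e j) :=
        ENNReal.tsum_le_tsum hle
    _ = V * n + ∑' j, e j := by rw [ENNReal.tsum_add, ENNReal.tsum_mul_left, hn]; rfl
    _ ≤ V * n + B * (Fintype.card O * Fintype.card Θ) *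
        (((q ^ (2 * δ))⁻¹ : ℝ≥0) * S * (d + 1)) := by
        rw [he]; gcongr
    _ ≤ _ := by
        rw [← hn]
        norm_cast
        have hd1 : (1 : ℝ≥0) ≤ ((d : ℝ≥0) + 1) ^ 3 := one_le_pow₀ (by simp)
        have h1 : V * n ≤ V * ((d : ℝ≥0) + 1) ^ 3 * n := by
          gcongr
          exact le_mul_of_one_le_right zero_le hd1
        push_cast
        calc _ ≤ V * ((d : ℝ≥0) + 1) ^ 3 * n + B * (Fintype.card O * Fintype.card Θ) *
              ((q ^ (2 * δ))⁻¹ * S * (d + 1)) := by gcongr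
          _ = _ := by simp only [B]; ring

end FlagTypes

/-! ### Escaping view classes from the invariant vector. -/

namespace FlagTypes

variable {Γ Z : Type*} [Group Γ] {X : SimpleGraph (Γ ⊕ Z)} {D : Γ → Γ → ℕ} {P : ViewParams}
  {O Θ : Type*} [Fintype O] [Fintype Θ]

open FlagIndex

/-- Summability leaves only finitely many indices where both the weight and the coordinate of the
invariant vector are bounded below. A class with a large coordinate and bounded reach is such an
index. -/
theorem exists_escaping {G : Type u} [Group G] [TopologicalSpace G]
    [MeasurableSpace G] [BorelSpace G] (hG : StrongPropertyT.{u, v} G)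
    [TopologicalSpace Γ] [DiscreteTopology Γ] [Countable Γ] {φ : G →* Γ} (hφ : Continuous φ)
    {δ N : ℕ} (F : FlagTypes X D (viewParams δ) O Θ)
    (hX : ConedGeometry X D δ N) (hN : 30 * δ + 100 ≤ N) {q S : ℝ≥0} (hq₀ : q ≠ 0) (hq : q ≤ 1)
    (hS : ∀ a, ∑' b, (q : ℝ≥0∞) ^ D a b ≤ S) :
    ∃ z₀ : Γ → Γ, (∀ g κ, {x ∈ Set.range φ | ∀ z, X.SameView D (viewParams δ) (inl g) g (z₀ g) z →
        ¬ X.FarFrom D κ g x z}.Finite) ∧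
      ∀ κ, {g | ∀ z, X.SameView D (viewParams δ) (inl g) g (z₀ g) z →
        ¬ X.FarFrom D κ g 1 z}.Finite := by
  classical
  obtain ⟨K, hK⟩ := F.exists_massNormSq_le hX hN hq₀ hq hS
  set w : ℝ≥0 := q / 4 with hw
  have hw₀ : w ≠ 0 := by positivity
  have hwq : w ≤ q := by
    rw [hw]; exact div_le_self (zero_le) (by norm_num)
  have hw₁ : w ≤ 1 := hwq.trans hq
  have hSw : ∀ a, ∑' b, (w : ℝ≥0∞) ^ D a b ≤ S := fun a =>
    (ENNReal.tsum_le_tsum fun b => by gcongr).trans (hS a)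
  have hdinv : ∀ g : Γ, X.dist (inl 1) (inl g⁻¹) = X.dist (inl 1) (inl g) := by
    intro g
    rw [← F.dist_mul g, mul_one, mul_inv_cancel, X.dist_comm]
  obtain ⟨η, hη, hinv, hpart⟩ := hG.exists_invariant_masses hφ
    (l := fun g => (X.dist (inl 1) (inl g) : ℝ))
    { continuous := continuous_of_discreteTopology
      nonneg := fun g => by positivity
      inv := fun g => by rw [hdinv]
      mul_le := fun g h => by
        have h1 := hX.conn.dist_triangle (u := inl 1) (v := inl g) (w := inl (g * h))
        have h2 := F.dist_mul g 1 h
        rw [mul_one] at h2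
        rw [h2] at h1
        exact_mod_cast h1 }
    -- The squared norm grows at most like the cube of `l + 1`, which the fourth power dominates;
    -- hence the exponent `2` for the norm.
    (c := Real.sqrt K) (by positivity) (p := 2) (F.mul_mem_piece) (ω := F.weight w 1)
    (by
      rintro (_ | ⟨b, o, θ⟩)
      · exact one_ne_zero
      · exact pow_ne_zero _ hw₀)
    (F.tsum_indicator_weight_ne_top hX (by omega) hw₀ hw₁ hSw 1)
    (by
      intro h f
      have h1 := F.massNormSq_translation w h h⁻¹ f
      rw [mul_inv_cancel] at h1
      rw [h1]
      refine (hK 1 h⁻¹ f).trans ?_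
      gcongr
      rw [hdinv, mul_pow, Real.sq_sqrt (by positivity), ENNReal.ofReal_mul (by positivity),
        ENNReal.ofReal_coe_nnreal]
      gcongr
      rw [← pow_mul, ENNReal.ofReal_pow (by positivity), ENNReal.ofReal_add (by positivity)
        (by positivity), ENNReal.ofReal_natCast, ENNReal.ofReal_one]
      exact pow_le_pow_right₀ (by simp) (by norm_num))
    (j₀ := total) rfl
  -- Pigeonhole over the nonempty classes at `g`, whose coordinates add up to 1.
  have hθ : ∀ g, ∃ z₀, (Fintype.card Θ + 1 : ℝ)⁻¹ ≤
      ‖η (part g F.base (F.type g F.base z₀))‖ := by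
    intro g
    by_contra! hcon
    let e : Θ ↪ FlagIndex Γ O Θ := ⟨part g F.base, fun θ θ' h => by injection h⟩
    have h1 := hpart ((Finset.univ.filter fun θ => ∃ z, F.type g F.base z = θ).map e) (by
      intro z
      rw [Finset.sum_map, Finset.sum_eq_single (F.type g F.base z)]
      · exact Set.indicator_of_mem (s := F.piece (e (F.type g F.base z))) (a := z) rfl _
      · intro θ _ hθ
        rw [Set.indicator_of_notMem]
        exact fun h => hθ h.symm
      · intro h
        simp at h)
    rw [Finset.sum_map] at h1
    have h2 := norm_sum_le_of_le (f := fun θ => η (e θ))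
      (Finset.univ.filter fun θ => ∃ z, F.type g F.base z = θ)
      (n := fun _ => (Fintype.card Θ + 1 : ℝ)⁻¹) (by
        intro θ hθ
        obtain ⟨z, rfl⟩ := (Finset.mem_filter.1 hθ).2
        exact (hcon z).le)
    rw [h1, norm_one, Finset.sum_const, nsmul_eq_mul] at h2
    have h3 : ((Finset.univ.filter fun θ => ∃ z, F.type g F.base z = θ).card : ℝ) ≤
        Fintype.card Θ := by exact_mod_cast Finset.card_le_univ _
    rw [← div_eq_mul_inv, le_div_iff₀ (by positivity)] at h2
    linarith
  choose z₀ hz₀ using hθ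
  set ε : ℝ≥0 := ((Fintype.card Θ : ℝ≥0) + 1)⁻¹ with hε
  have hlow : ∀ κ, {j | ((w ^ κ * ε ^ 2 : ℝ≥0) : ℝ≥0∞) ≤
      (F.weight w 1 j : ℝ≥0∞) * ‖η j‖ₑ ^ 2}.Finite := fun κ =>
    ENNReal.finite_const_le_of_tsum_ne_top hη (by
      rw [ne_eq, ENNReal.coe_eq_zero]
      positivity)
  have hmem : ∀ κ b θ, X.reach D b 1 {z | F.type b F.base z = θ} ≤ κ →
      (Fintype.card Θ + 1 : ℝ)⁻¹ ≤ ‖η (part b F.base θ)‖ →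
      part b F.base θ ∈ {j | ((w ^ κ * ε ^ 2 : ℝ≥0) : ℝ≥0∞) ≤
        (F.weight w 1 j : ℝ≥0∞) * ‖η j‖ₑ ^ 2} := by
    intro κ b θ hr hn
    have h1 : w ^ κ ≤ F.weight w 1 (part b F.base θ) := pow_le_pow_right_of_le_one' hw₁ hr
    have h2 : ε ≤ ‖η (part b F.base θ)‖₊ := by
      rw [← NNReal.coe_le_coe, hε]
      push_cast
      exact hn
    rw [Set.mem_ofPred_eq, enorm_eq_nnnorm]
    norm_cast
    gcongr
  have hsame : ∀ g x κ, (∀ z, X.SameView D (viewParams δ) (inl g) g (z₀ g) z →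
      ¬ X.FarFrom D κ g x z) →
      X.reach D g x {z | F.type g F.base z = F.type g F.base (z₀ g)} ≤ κ := by
    intro g x κ h
    rw [SimpleGraph.reach_le_iff]
    intro z hz
    refine h z ?_
    rw [← F.apex_base g, ← F.type_eq_iff]
    exact hz.symm
  refine ⟨z₀, fun g κ => ?_, fun κ => ?_⟩
  -- Translating by the inverse of `x` in the image of `φ` keeps the coordinate and turns reach from
  -- `x` into reach from 1; distinct `x` give distinct indices.
  · refine ((hlow κ).preimage (f := fun x => part (x⁻¹ * g) F.base (F.type g F.base (z₀ g)))
      ?_).subset ?_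
    · intro x _ y _ hxy
      injection hxy with h
      simpa using h
    · rintro _ ⟨⟨γ, rfl⟩, hx⟩
      refine hmem κ _ _ ?_ ?_
      · have h1 := F.reach_mul (φ γ)⁻¹ g (φ γ) F.base (F.type g F.base (z₀ g))
        rw [inv_mul_cancel] at h1
        rw [h1]
        exact hsame g _ κ hx
      · have h1 := hinv γ⁻¹ (part g F.base (F.type g F.base (z₀ g)))
        rw [smul_part, map_inv] at h1
        rw [h1]
        exact hz₀ g
  · refine ((hlow κ).preimage (f := fun g => part g F.base (F.type g F.base (z₀ g)))
      ?_).subset ?_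
    · intro x _ y _ hxy
      injection hxy
    · intro g hg
      exact hmem κ _ _ (hsame g _ κ hg) (hz₀ g)

end FlagTypes

/-! ### Word metrics and their growth. -/

namespace SimpleGraph

section Action

variable {Γ V : Type*} [Group Γ] [MulAction Γ V] {X : SimpleGraph V}

theorem dist_smul (hc : X.Connected) (hX : ∀ (h : Γ) x y, X.Adj x y → X.Adj (h • x) (h • y)) (h : Γ)
    (x y : V) : X.dist (h • x) (h • y) = X.dist x y := by
  have key : ∀ (h : Γ) (x y : V), X.dist (h • x) (h • y) ≤ X.dist x y := by
    intro h x y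
    obtain ⟨p, hp⟩ := hc.exists_walk_length_eq_dist x y
    let f : X →g X := ⟨fun z => h • z, fun {a b} hab => hX h a b hab⟩
    rw [← hp, ← Walk.length_map f]
    exact dist_le (p.map f)
  refine le_antisymm (key h x y) ?_
  have := key h⁻¹ (h • x) (h • y)
  rwa [inv_smul_smul, inv_smul_smul] at this

end Action

section Cayley

variable {Γ : Type*} [Group Γ] {F : Set Γ}

theorem mulCayley_connected (hF : Subgroup.closure F = ⊤) : (mulCayley F).Connected := by
  have key : ∀ g : Γ, (mulCayley F).Reachable 1 g := by
    intro g
    have hg : g ∈ Subgroup.closure F := by rw [hF]; trivial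
    induction hg using Subgroup.closure_induction_right with
    | one => exact Reachable.refl 1
    | mul_right x hx y hyF ih =>
      refine ih.trans ?_
      by_cases h : x = x * y
      · rw [← h]
      · exact Adj.reachable ((mulCayley_adj _ _ _).2 ⟨h, Or.inl (by simpa using hyF)⟩)
    | mul_inv_cancel x hx y hyF ih =>
      refine ih.trans ?_
      by_cases h : x = x * y⁻¹
      · rw [← h]
      · exact Adj.reachable ((mulCayley_adj _ _ _).2 ⟨h, Or.inr (by simpa using hyF)⟩)
  have : Nonempty Γ := ⟨1⟩
  exact ⟨fun a b => (key a).symm.trans (key b)⟩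

theorem dist_mulCayley_mul (hF : Subgroup.closure F = ⊤) (h a b : Γ) :
    (mulCayley F).dist (h * a) (h * b) = (mulCayley F).dist a b :=
  dist_smul (mulCayley_connected hF) (fun _ _ _ => mulCayley_adj_mul_iff_right.2) h a b

theorem dist_mulCayley_le_one {a b : Γ} (hab : a⁻¹ * b ∈ F) :
    (mulCayley F).dist a b ≤ 1 := by
  by_cases h : a = b
  · simp [h]
  · exact (dist_eq_one_iff_adj.2 ((mulCayley_adj _ _ _).2 ⟨h, Or.inl hab⟩)).le

theorem Connected.exists_dist_step {V : Type*} {X : SimpleGraph V} (hc : X.Connected) {a b : V}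
    {k : ℕ} (h : X.dist a b ≤ k + 1) : ∃ c, X.dist a c ≤ 1 ∧ X.dist c b ≤ k := by
  by_cases hk : X.dist a b ≤ k
  · exact ⟨a, by simp, hk⟩
  · obtain ⟨c, hc, hd⟩ := exists_btw_dist hc (x := a) (y := b) (n := 1) (by omega)
    unfold Btw at hc
    exact ⟨c, by omega, by omega⟩

theorem exists_ball_finset (hF : Subgroup.closure F = ⊤) (hfin : F.Finite) :
    ∃ A : ℕ, 0 < A ∧ ∀ a n, ∃ T : Finset Γ, T.card ≤ A ^ n ∧ ∀ b, (mulCayley F).dist a b ≤ n → b ∈ T := by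
  classical
  have hc := mulCayley_connected hF
  let F' : Finset Γ := insert 1 (hfin.toFinset ∪ hfin.toFinset.image (·⁻¹))
  have hF' : ∀ a b, (mulCayley F).dist a b ≤ 1 → a⁻¹ * b ∈ F' := by
    intro a b hab
    rcases Nat.le_one_iff_eq_zero_or_eq_one.1 hab with h | h
    · rw [hc.dist_eq_zero_iff] at h
      simp [F', h]
    · rw [dist_eq_one_iff_adj, mulCayley_adj] at h
      rcases h.2 with h | h
      · simp [F', h]
      · have : (a⁻¹ * b)⁻¹ ∈ F := by simpa using h
        simp only [F', Finset.mem_insert, Finset.mem_union, Finset.mem_image, Set.Finite.mem_toFinset]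
        exact Or.inr (Or.inr ⟨_, this, by simp⟩)
  refine ⟨F'.card, Finset.card_pos.2 ⟨1, by simp [F']⟩, fun a n => ?_⟩
  induction n generalizing a with
  | zero =>
    refine ⟨{a}, by simp, fun b hb => ?_⟩
    have := (hc.dist_eq_zero_iff).1 (Nat.le_zero.1 hb)
    simp [this]
  | succ n ih =>
    obtain ⟨T, hT, hTb⟩ := ih a
    refine ⟨Finset.image₂ (· * ·) T F', ?_, fun b hb => ?_⟩
    · refine (Finset.card_image₂_le _ _ _).trans ?_
      rw [pow_succ]
      gcongr
    · rw [dist_comm] at hb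
      obtain ⟨c, h1, h2⟩ := hc.exists_dist_step hb
      rw [dist_comm] at h1 h2
      exact Finset.mem_image₂.2 ⟨c, hTb c h2, c⁻¹ * b, hF' c b h1, by simp⟩

/-- Balls grow at most like `A ^ n`; with `q = 1 / (2A)` the sum is dominated by a geometric series
of ratio one half. -/
theorem exists_tsum_pow_dist_le (hF : Subgroup.closure F = ⊤) (hfin : F.Finite) :
    ∃ q : ℝ≥0, q ≠ 0 ∧ q ≤ 1 ∧ ∀ a, ∑' b, (q : ℝ≥0∞) ^ (mulCayley F).dist a b ≤ (2 : ℝ≥0) := by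
  classical
  obtain ⟨A, hA, hT⟩ := exists_ball_finset hF hfin
  choose T hTc hTm using hT
  have hA' : (0 : ℝ≥0) < A := by exact_mod_cast hA
  refine ⟨(2 * A)⁻¹, by positivity, ?_, fun a => ?_⟩
  · refine inv_le_one_of_one_le₀ ?_
    have : (1 : ℝ≥0) ≤ A := by exact_mod_cast hA
    linarith
  set q : ℝ≥0 := (2 * A)⁻¹ with hq
  have hqA : ∀ n : ℕ, ((A : ℝ≥0∞) ^ n) * (q : ℝ≥0∞) ^ n = (2⁻¹ : ℝ≥0∞) ^ n := by
    intro n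
    rw [← mul_pow]
    congr 1
    have : (A : ℝ≥0) * q = 2⁻¹ := by rw [hq]; field_simp
    have h2 : ((A : ℝ≥0) : ℝ≥0∞) * (q : ℝ≥0∞) = ((2⁻¹ : ℝ≥0) : ℝ≥0∞) := by
      rw [← this]; push_cast; rfl
    simpa using h2
  calc ∑' b, (q : ℝ≥0∞) ^ (mulCayley F).dist a b
      ≤ ∑' b, ∑' n, (if b ∈ T a n then (q : ℝ≥0∞) ^ n else 0) := by
        refine ENNReal.tsum_le_tsum fun b => ?_
        refine le_trans ?_ (ENNReal.le_tsum ((mulCayley F).dist a b))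
        rw [if_pos (hTm a _ b le_rfl)]
    _ = ∑' n, ∑' b, (if b ∈ T a n then (q : ℝ≥0∞) ^ n else 0) := ENNReal.tsum_comm
    _ ≤ ∑' n : ℕ, (2⁻¹ : ℝ≥0∞) ^ n := by
        refine ENNReal.tsum_le_tsum fun n => ?_
        rw [tsum_eq_sum (s := T a n) (fun b hb => if_neg hb), ← hqA]
        rw [Finset.sum_congr rfl (fun b hb => if_pos hb), Finset.sum_const, nsmul_eq_mul]
        gcongr
        exact_mod_cast hTc a n
    _ = (2 : ℝ≥0) := by rw [ENNReal.tsum_geometric_two]; rfl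

end Cayley

end SimpleGraph

/-! ### Coned-off Cayley graphs and fineness. -/

section ConedOff

variable {Γ ι : Type*} [Group Γ] {H : ι → Subgroup Γ} {S : Set Γ}

theorem conedOffCayleyGraph_adj_inl {a b : Γ} : (conedOffCayleyGraph H S).Adj (inl a) (inl b) ↔
    a ≠ b ∧ (a⁻¹ * b ∈ S ∨ b⁻¹ * a ∈ S) := by
  simp [conedOffCayleyGraph]

theorem conedOffCayleyGraph_adj_inr {a : Γ} {c : Σ i, Γ ⧸ H i} :
    (conedOffCayleyGraph H S).Adj (inl a) (inr c) ↔ (QuotientGroup.mk a : Γ ⧸ H c.1) = c.2 := by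
  simp [conedOffCayleyGraph]

theorem not_conedOffCayleyGraph_adj {c c' : Σ i, Γ ⧸ H i} :
    ¬ (conedOffCayleyGraph H S).Adj (inr c) (inr c') := by
  simp [conedOffCayleyGraph]

theorem conedOffCayleyGraph_adj_smul (h : Γ) (x y : Γ ⊕ Σ i, Γ ⧸ H i)
    (hxy : (conedOffCayleyGraph H S).Adj x y) :
    (conedOffCayleyGraph H S).Adj (h • x) (h • y) := by
  have key : ∀ (a : Γ) (c : Σ i, Γ ⧸ H i), (conedOffCayleyGraph H S).Adj (inl a) (inr c) →
      (conedOffCayleyGraph H S).Adj (h • inl a) (h • inr c) := by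
    rintro a ⟨i, c⟩ hac
    rw [conedOffCayleyGraph_adj_inr] at hac
    rw [Sum.smul_inl, Sum.smul_inr, conedOffCayleyGraph_adj_inr]
    exact congrArg (h • ·) hac
  rcases x with a | c <;> rcases y with b | c'
  · rw [conedOffCayleyGraph_adj_inl] at hxy
    rw [Sum.smul_inl, Sum.smul_inl, conedOffCayleyGraph_adj_inl]
    simpa [mul_assoc] using hxy
  · exact key a c' hxy
  · exact (key b c hxy.symm).symm
  · exact absurd hxy not_conedOffCayleyGraph_adj

/-- By fineness only finitely many elements of `H i` can be joined to `1` by short paths avoiding the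
cone point. -/
theorem finite_short_of_isUniformlyFine (hf : (conedOffCayleyGraph H S).IsUniformlyFine) (i : ι)
    (ℓ : ℕ) : {h : Γ | h ∈ H i ∧ ∃ p : (conedOffCayleyGraph H S).Walk (inl 1) (inl h),
      inr ⟨i, ((1 : Γ) : Γ ⧸ H i)⟩ ∉ p.support ∧ p.length ≤ ℓ}.Finite := by
  classical
  set X := conedOffCayleyGraph H S
  set c : Γ ⊕ Σ i, Γ ⧸ H i := inr ⟨i, ((1 : Γ) : Γ ⧸ H i)⟩ with hc
  have hadj : ∀ h ∈ H i, X.Adj (inl h) c := by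
    intro h hh
    refine conedOffCayleyGraph_adj_inr.2 (QuotientGroup.eq.2 ?_)
    simpa using (H i).inv_mem hh
  obtain ⟨φ, hφ⟩ := hf
  have h1 := (hφ s(c, inl 1) (hadj 1 (H i).one_mem).symm (ℓ + 2)).1
  have hfin : (⋃ C ∈ X.simpleLoopsThrough s(c, inl 1) (ℓ + 2), {h : Γ | s(c, inl h) ∈ C}).Finite := by
    refine h1.biUnion ?_
    rintro _ ⟨v, p, -, -, -, rfl⟩
    have h2 : {f | f ∈ p.edges}.Finite := List.finite_toSet _
    refine h2.preimage (f := fun h : Γ => s(c, inl h)) ?_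
    intro a _ b _ hab
    simpa [hc] using hab
  refine (hfin.union (Set.finite_singleton 1)).subset ?_
  rintro h ⟨hh, p, hp, hpl⟩
  by_cases hh1 : h = 1
  · exact Or.inr hh1
  left
  have hq1 : c ∉ p.bypass.support := fun hm => hp (p.support_bypass_subset_support hm)
  have hq2 := (p.bypass_isPath).concat hq1 (hadj h hh)
  -- Closing the path up through the cone point gives a simple loop through the fixed edge from the
  -- cone point to `1`. It has length at most `ℓ + 2`, and `h` can be read off from its edges.
  refine Set.mem_biUnion (x := {f | f ∈ (SimpleGraph.Walk.cons (hadj 1 (H i).one_mem).symm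
    (p.bypass.concat (hadj h hh))).edges}) ⟨c, _, ?_, ?_, ?_, rfl⟩ ?_
  · rw [SimpleGraph.Walk.cons_isCycle_iff]
    refine ⟨hq2, ?_⟩
    rw [SimpleGraph.Walk.edges_concat, List.concat_eq_append, List.mem_append, not_or]
    refine ⟨fun hm => hq1 (SimpleGraph.Walk.fst_mem_support_of_mem_edges _ hm), ?_⟩
    simp [hc, Ne.symm hh1]
  · have := p.length_bypass_le_length
    simp
    omega
  · simp
  · simp [SimpleGraph.Walk.edges_concat, Sym2.eq_swap]

end ConedOff

/-! ### Finiteness and equivariance of views. -/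

namespace ConedGeometry

variable {Γ Z : Type*} {X : SimpleGraph (Γ ⊕ Z)} {D : Γ → Γ → ℕ} {δ N : ℕ} {P : ViewParams}

/-- Grow the view from `s` one level at a time. Infinite branching occurs only at cone points, where
the budget confines the next element to a `D`-ball about the entry point, or about `b` when the cone
point is `s`. -/
theorem finite_view (hX : ConedGeometry X D δ N) (hfin : ∀ a M, {b | D a b ≤ M}.Finite)
    (hnbr : ∀ a, {c | X.Adj (inl a) (inr c)}.Finite) (s : Γ ⊕ Z) (b : Γ) :
    (X.view D P s b).Finite := by
  have key : ∀ n, {y ∈ X.view D P s b | X.dist s y ≤ n}.Finite := by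
    intro n
    induction n with
    | zero =>
      refine (Set.finite_singleton s).subset ?_
      rintro y ⟨-, hy⟩
      exact ((hX.conn.dist_eq_zero_iff).1 (Nat.le_zero.1 hy)).symm
    | succ n ih =>
      have hG : {a : Γ | inl a ∈ {y ∈ X.view D P s b | X.dist s y ≤ n}}.Finite :=
        ih.preimage Sum.inl_injective.injOn
      have h1 := (hG.biUnion fun a _ => hfin a 1).image (inl : Γ → Γ ⊕ Z)
      have h2 := (hG.biUnion fun a _ => hnbr a).image (inr : Z → Γ ⊕ Z)
      have h3 := (hG.biUnion fun a _ => hfin a P.budget).image (inl : Γ → Γ ⊕ Z)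
      have h4 := (hfin b P.budget).image (inl : Γ → Γ ⊕ Z)
      refine ((((ih.union h1).union h2).union h3).union h4).subset ?_
      rintro y ⟨hy, hyn⟩
      by_cases hyn' : X.dist s y ≤ n
      · exact Or.inl (Or.inl (Or.inl (Or.inl ⟨hy, hyn'⟩)))
      have hsy : s ≠ y := by
        rintro rfl
        simp at hyn'
      obtain ⟨w, hw, hwd⟩ := SimpleGraph.exists_adj_dist_succ hX.conn hsy
      have hwy : X.Btw s w y := by
        have := SimpleGraph.dist_eq_one_iff_adj.2 hw
        unfold SimpleGraph.Btw; omega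
      have hwv := hX.mem_view_of_btw hy hwy
      rcases w with a | c
      · have ha : a ∈ {a : Γ | inl a ∈ {y ∈ X.view D P s b | X.dist s y ≤ n}} := ⟨hwv, by omega⟩
        rcases y with b' | c'
        · exact Or.inl (Or.inl (Or.inl (Or.inr ⟨b', Set.mem_biUnion ha (hX.D_adj _ _ hw), rfl⟩)))
        · exact Or.inl (Or.inl (Or.inr ⟨c', Set.mem_biUnion ha hw, rfl⟩))
      · rcases y with b' | c'
        · have hb' : X.Entry (inl b') c b' := .self hw.symm
          by_cases hsc : s = inr c
          · exact Or.inr ⟨b', hy.2.2 c b' hsc hb', rfl⟩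
          · obtain ⟨a, ha⟩ := hX.exists_entry hsc
            have hav := hX.mem_view_of_btw hwv ha.btw
            have had := ha.2
            have h5 := hy.2.1 c a b' hwy ha hb'
            refine Or.inl (Or.inr ⟨b', Set.mem_biUnion (x := a) ⟨hav, by omega⟩ ?_, rfl⟩)
            simp only [Set.mem_ofPred_eq]
            omega
        · exact absurd hw (hX.not_adj _ _)
  exact (key P.radius).subset fun y hy => ⟨hy, hy.1⟩

/-- The horofunction of `z` on the points visible from a flag. -/
def _root_.SimpleGraph.viewType (X : SimpleGraph (Γ ⊕ Z)) (D : Γ → Γ → ℕ) (P : ViewParams)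
    (s : Γ ⊕ Z) (b z : Γ) : X.view D P s b → ℤ :=
  fun y => (X.dist y.1 (inl z) : ℤ) - X.dist s (inl z)

theorem _root_.SimpleGraph.viewType_eq_iff {s : Γ ⊕ Z} {b z z' : Γ} :
    X.viewType D P s b z = X.viewType D P s b z' ↔ X.SameView D P s b z z' := by
  rw [funext_iff, Subtype.forall]
  refine forall₂_congr fun y hy => ?_
  unfold SimpleGraph.viewType
  dsimp only
  omega

theorem finite_range_viewType (hX : ConedGeometry X D δ N) {s : Γ ⊕ Z} {b : Γ}
    (hv : (X.view D P s b).Finite) : (Set.range (X.viewType D P s b)).Finite := by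
  have := hv.to_subtype
  refine (Set.Finite.pi (t := fun _ : X.view D P s b => Set.Icc (-(P.radius : ℤ)) P.radius)
    fun _ => Set.finite_Icc _ _).subset ?_
  rintro _ ⟨z, rfl⟩ ⟨y, hy⟩ -
  have h1 := hX.conn.dist_triangle (u := y) (v := s) (w := inl z)
  have h2 := hX.conn.dist_triangle (u := s) (v := y) (w := inl z)
  rw [X.dist_comm (u := y) (v := s)] at h1
  have h3 := hy.1
  simp only [SimpleGraph.viewType, Set.mem_Icc]
  omega

end ConedGeometry

section Invariance

variable {Γ Z : Type*} [Group Γ] [MulAction Γ Z] {X : SimpleGraph (Γ ⊕ Z)} {D : Γ → Γ → ℕ}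
  {P : ViewParams} (hd : ∀ (h : Γ) (x y : Γ ⊕ Z), X.dist (h • x) (h • y) = X.dist x y)
  (hD : ∀ h a b, D (h * a) (h * b) = D a b)

include hd

theorem SimpleGraph.btw_smul (h : Γ) (x w y : Γ ⊕ Z) :
    X.Btw (h • x) (h • w) (h • y) ↔ X.Btw x w y := by
  simp only [SimpleGraph.Btw, hd]

theorem SimpleGraph.entry_smul (h : Γ) (x : Γ ⊕ Z) (c : Z) (a : Γ) :
    X.Entry (h • x) (h • c) (h * a) ↔ X.Entry x c a := by
  have h1 : (inl (h * a) : Γ ⊕ Z) = h • inl a := rfl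
  have h2 : (inr (h • c) : Γ ⊕ Z) = h • inr c := rfl
  unfold SimpleGraph.Entry
  rw [← SimpleGraph.dist_eq_one_iff_adj, ← SimpleGraph.dist_eq_one_iff_adj, h1, h2, hd, hd, hd]

include hD

theorem SimpleGraph.smul_mem_view (h : Γ) (s : Γ ⊕ Z) (b : Γ) (y : Γ ⊕ Z) :
    h • y ∈ X.view D P (h • s) (h * b) ↔ y ∈ X.view D P s b := by
  have hinr : ∀ c : Z, (inr (h • c) : Γ ⊕ Z) = h • inr c := fun c => rfl
  unfold SimpleGraph.view
  simp only [Set.mem_ofPred_eq, hd]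
  refine and_congr_right fun _ => and_congr ?_ ?_
  · rw [(MulAction.surjective h).forall]
    refine forall_congr' fun c => ?_
    rw [(Group.mulLeft_bijective h).surjective.forall]
    refine forall_congr' fun a => ?_
    rw [(Group.mulLeft_bijective h).surjective.forall]
    simp only [hinr, SimpleGraph.btw_smul hd, SimpleGraph.entry_smul hd, hD, hd]
  · rw [(MulAction.surjective h).forall]
    refine forall_congr' fun c => ?_
    rw [(Group.mulLeft_bijective h).surjective.forall]
    simp only [hinr, SimpleGraph.entry_smul hd, hD, smul_left_cancel_iff]

theorem SimpleGraph.sameView_smul (h : Γ) (s : Γ ⊕ Z) (b z z' : Γ) :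
    X.SameView D P (h • s) (h * b) (h * z) (h * z') ↔ X.SameView D P s b z z' := by
  have hinl : ∀ a : Γ, (inl (h * a) : Γ ⊕ Z) = h • inl a := fun a => rfl
  unfold SimpleGraph.SameView
  rw [(MulAction.surjective h).forall]
  simp only [SimpleGraph.smul_mem_view hd hD, hinl, hd]

theorem SimpleGraph.IsLimitCone.smul {Λ : Set Γ} {g : Γ} {c : Z} (hc : X.IsLimitCone D Λ g c)
    {h : Γ} (hΛ : ∀ x ∈ Λ, h * x ∈ Λ) : X.IsLimitCone D Λ (h * g) (h • c) := by
  intro M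
  obtain ⟨x, hx, hb, a, b, ha, hb', hM⟩ := hc M
  exact ⟨h * x, hΛ x hx, (SimpleGraph.btw_smul hd h _ _ _).2 hb, h * a, h * b,
    (SimpleGraph.entry_smul hd h _ _ _).2 ha, (SimpleGraph.entry_smul hd h _ _ _).2 hb', by rwa [hD]⟩

end Invariance

/-! ### The enlarged word metric and the flag types. -/

section ConedOff

variable {Γ ι : Type*} [Group Γ] {H : ι → Subgroup Γ} {S : Set Γ}

/-- Neighbours of a cone point are at distance at most 2, so a chain of intervals avoiding it
shortens to a walk of bounded length avoiding it. Fineness leaves finitely many group elements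
spanned by such walks, and these are added to the generators. -/
theorem exists_conedGeometry [Finite ι] (hS : S.Finite) (hgen : Subgroup.closure S = ⊤)
    (hc : (conedOffCayleyGraph H S).Connected) (hf : (conedOffCayleyGraph H S).IsUniformlyFine)
    {δ : ℕ} (hδ : (conedOffCayleyGraph H S).Slim δ) (N : ℕ) :
    ∃ F : Set Γ, F.Finite ∧ Subgroup.closure F = ⊤ ∧
      ConedGeometry (conedOffCayleyGraph H S) (SimpleGraph.mulCayley F).dist δ N := by
  classical
  set X := conedOffCayleyGraph H S with hX
  choose ℓ hℓ using fun n => hδ.exists_walk_avoiding hc n 2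
  set L := ∑ n ∈ Finset.range (N + 1), ℓ n with hL
  have hℓL : ∀ n ≤ N, ℓ n ≤ L := fun n hn =>
    Finset.single_le_sum (f := ℓ) (fun _ _ => Nat.zero_le _) (Finset.mem_range.2 (by omega))
  set F : Set Γ := S ∪ ⋃ i, {h : Γ | h ∈ H i ∧ ∃ p : X.Walk (inl 1) (inl h),
      inr ⟨i, ((1 : Γ) : Γ ⧸ H i)⟩ ∉ p.support ∧ p.length ≤ L} with hF
  have hFfin : F.Finite :=
    hS.union (Set.finite_iUnion fun i => finite_short_of_isUniformlyFine hf i L)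
  have hFgen : Subgroup.closure F = ⊤ :=
    top_le_iff.1 (hgen ▸ Subgroup.closure_mono Set.subset_union_left)
  have hcF := SimpleGraph.mulCayley_connected hFgen
  have hcone : ∀ (a : Γ) i, X.Adj (inl a) (inr ⟨i, (a : Γ ⧸ H i)⟩) := fun a i =>
    conedOffCayleyGraph_adj_inr.2 rfl
  have hstep : ∀ a b, a⁻¹ * b ∈ F → X.dist (inl a) (inl b) ≤ 2 := by
    rintro a b (h | h)
    · by_cases hab : a = b
      · simp [hab]
      · have : X.dist (inl a) (inl b) = 1 := SimpleGraph.dist_eq_one_iff_adj.2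
          (conedOffCayleyGraph_adj_inl.2 ⟨hab, Or.inl h⟩)
        omega
    · obtain ⟨i, hi, -⟩ := Set.mem_iUnion.1 h
      have h1 := hcone b i
      rw [← QuotientGroup.eq.2 hi] at h1
      exact SimpleGraph.dist_le (.cons (hcone a i) (.cons h1.symm .nil))
  refine ⟨F, hFfin, hFgen, ?_⟩
  exact
    { conn := hc
      not_adj := fun c c' => not_conedOffCayleyGraph_adj
      slim := hδ
      D_comm := fun a b => SimpleGraph.dist_comm
      D_tri := fun a b c => hcF.dist_triangle
      D_eq_zero := fun a b => hcF.dist_eq_zero_iff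
      D_adj := by
        intro a b hab
        rcases (conedOffCayleyGraph_adj_inl.1 hab).2 with h | h
        · exact SimpleGraph.dist_mulCayley_le_one (Or.inl h)
        · rw [SimpleGraph.dist_comm]
          exact SimpleGraph.dist_mulCayley_le_one (Or.inl h)
      D_step := fun a b k h => hcF.exists_dist_step h
      dist_le := by
        intro a b
        obtain ⟨p, hp⟩ := hcF.exists_walk_length_eq_dist a b
        rw [← hp]
        clear hp
        induction p with
        | nil => simp
        | @cons a b c hab p ih =>
          have h1 : X.dist (inl a) (inl b) ≤ 2 := by
            rcases ((SimpleGraph.mulCayley_adj _ _ _).1 hab).2 with h | h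
            · exact hstep a b h
            · rw [SimpleGraph.dist_comm]
              exact hstep b a h
          have h2 := hc.dist_triangle (u := inl a) (v := inl b) (w := inl c)
          rw [SimpleGraph.Walk.length_cons]
          omega
      D_chain := by
        rintro ⟨i, c⟩ a b n hn ha hb hch
        have h2 : X.dist (inl a) (inl b) ≤ 2 := SimpleGraph.dist_le (.cons ha (.cons hb.symm .nil))
        obtain ⟨p, hp, hpl⟩ := hℓ n _ _ _ hch h2
        rw [conedOffCayleyGraph_adj_inr] at ha hb
        dsimp only at ha hb
        refine SimpleGraph.dist_mulCayley_le_one (Or.inr (Set.mem_iUnion.2 ⟨i, ?_, ?_⟩))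
        · exact QuotientGroup.eq.1 (ha.trans hb.symm)
        · let f : X →g X := ⟨fun z => a⁻¹ • z, fun {x y} h => conedOffCayleyGraph_adj_smul _ x y h⟩
          have hf1 : f (inl a) = inl 1 := congrArg inl (inv_mul_cancel a)
          have hf2 : f (inl b) = inl (a⁻¹ * b) := rfl
          refine ⟨(p.map f).copy hf1 hf2, ?_, ?_⟩
          · rw [SimpleGraph.Walk.support_copy, SimpleGraph.Walk.support_map]
            intro hm
            obtain ⟨y, hy, hy'⟩ := List.mem_map.1 hm
            have h3 : y = inr ⟨i, c⟩ := by
              have h4 : y = a • (a⁻¹ • y) := (smul_inv_smul a y).symm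
              have h5 : a⁻¹ • y = inr ⟨i, ((1 : Γ) : Γ ⧸ H i)⟩ := hy'
              rw [h4, h5, ← ha]
              change inr (⟨i, ((a * 1 : Γ) : Γ ⧸ H i)⟩ : Σ i, Γ ⧸ H i) = _
              rw [mul_one]
            exact hp (h3 ▸ hy)
          · rw [SimpleGraph.Walk.length_copy, SimpleGraph.Walk.length_map]
            exact hpl.trans (hℓL n hn) }

end ConedOff

section ConedOff

variable {Γ ι : Type*} [Group Γ] {H : ι → Subgroup Γ} {S : Set Γ}

/-- The flags at `1` are indexed by `Option ι`. -/
def conedOffApex (H : ι → Subgroup Γ) (b : Γ) : Option ι → Γ ⊕ Σ i, Γ ⧸ H i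
  | none => inl b
  | some i => inr ⟨i, (b : Γ ⧸ H i)⟩

theorem smul_conedOffApex (h b : Γ) (o : Option ι) :
    h • conedOffApex H b o = conedOffApex H (h * b) o := by
  rcases o with _ | i <;> rfl

/-- The types of points seen from the flags of a coned-off Cayley graph. -/
def conedOffFlagTypes {D : Γ → Γ → ℕ} {δ N : ℕ} (P : ViewParams)
    (hX : ConedGeometry (conedOffCayleyGraph H S) D δ N)
    (hD : ∀ h a b, D (h * a) (h * b) = D a b) :
    FlagTypes (conedOffCayleyGraph H S) D P (Option ι)
      (Set.range fun p : Option ι × Γ => (⟨p.1, SimpleGraph.viewType (conedOffCayleyGraph H S) D P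
        (conedOffApex H 1 p.1) 1 p.2⟩ : Σ o,
          (conedOffCayleyGraph H S).view D P (conedOffApex H 1 o) 1 → ℤ)) where
  apex := conedOffApex H
  -- The flag is translated to `1`, so a finite set of names there serves every `b`.
  type b o z := ⟨_, Set.mem_range_self (o, b⁻¹ * z)⟩
  base := none
  apex_base _ := rfl
  isFlag b o := by
    rcases o with _ | i
    · exact Or.inl rfl
    · exact Or.inr ⟨_, rfl, conedOffCayleyGraph_adj_inr.2 rfl⟩
  exists_apex := by
    rintro s b (rfl | ⟨⟨i, c⟩, rfl, h⟩)
    · exact ⟨none, rfl⟩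
    · rw [conedOffCayleyGraph_adj_inr] at h
      refine ⟨some i, ?_⟩
      dsimp only at h
      rw [← h]
      rfl
  type_eq_iff b o z z' := by
    refine Subtype.ext_iff.trans ?_
    dsimp only
    rw [Sigma.mk.injEq]
    simp only [heq_eq_eq, true_and]
    rw [SimpleGraph.viewType_eq_iff, ← SimpleGraph.sameView_smul
      (SimpleGraph.dist_smul hX.conn conedOffCayleyGraph_adj_smul) hD b, smul_conedOffApex,
      mul_one, mul_inv_cancel_left, mul_inv_cancel_left]
  type_mul h b o z := by
    have : (h * b)⁻¹ * (h * z) = b⁻¹ * z := by group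
    simp only [this]
  D_mul := hD
  dist_mul h a b := SimpleGraph.dist_smul hX.conn conedOffCayleyGraph_adj_smul h (inl a) (inl b)

theorem finite_conedOffTypes [Finite ι] {D : Γ → Γ → ℕ} {δ N : ℕ} (P : ViewParams)
    (hX : ConedGeometry (conedOffCayleyGraph H S) D δ N)
    (hv : ∀ o, ((conedOffCayleyGraph H S).view D P (conedOffApex H 1 o) 1).Finite) :
    (Set.range fun p : Option ι × Γ => (⟨p.1, SimpleGraph.viewType (conedOffCayleyGraph H S) D P
        (conedOffApex H 1 p.1) 1 p.2⟩ : Σ o,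
          (conedOffCayleyGraph H S).view D P (conedOffApex H 1 o) 1 → ℤ)).Finite := by
  refine (Set.finite_iUnion fun o => (hX.finite_range_viewType (hv o)).image
    fun t => (⟨o, t⟩ : Σ o, (conedOffCayleyGraph H S).view D P (conedOffApex H 1 o) 1 → ℤ)).subset ?_
  rintro _ ⟨⟨o, z⟩, rfl⟩
  exact Set.mem_iUnion.2 ⟨o, _, ⟨z, rfl⟩, rfl⟩

end ConedOff

/-! ### The image fixes its limit cone point. -/

theorem corollary1p4 {G : Type u} [Group G] [TopologicalSpace G] [IsTopologicalGroup G]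
    [LocallyCompactSpace G] [T2Space G] [MeasurableSpace G] [BorelSpace G]
    (hG : StrongPropertyT.{u, v} G)
    {Γ : Type w} [Group Γ] [TopologicalSpace Γ] [DiscreteTopology Γ]
    {k : ℕ} (H : Fin k → Subgroup Γ) (hΓ : IsRelativelyHyperbolic H)
    (φ : G →* Γ) (hφ : Continuous φ) :
    Finite φ.range ∨
      ∃ (i : Fin k) (γ : Γ), φ.range ≤ (H i).map (MulAut.conj γ).toMonoidHom := by
  rw [or_iff_not_imp_left]
  intro hinf
  obtain ⟨S, hS, hgen, hhyp, hfine⟩ := hΓ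
  obtain ⟨δ, hδ⟩ := hhyp.exists_slim
  obtain ⟨F, hF, hFgen, hX⟩ := exists_conedGeometry hS hgen hhyp.1 hfine hδ (30 * δ + 100)
  obtain ⟨q, hq₀, hq, hsum⟩ := SimpleGraph.exists_tsum_pow_dist_le hFgen hF
  obtain ⟨A, -, hball⟩ := SimpleGraph.exists_ball_finset hFgen hF
  have hfin : ∀ a M, {b | (SimpleGraph.mulCayley F).dist a b ≤ M}.Finite := by
    intro a M
    obtain ⟨T, -, hT⟩ := hball a M
    exact T.finite_toSet.subset hT
  have hcount : Countable Γ := by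
    rw [← Set.countable_univ_iff]
    refine (Set.countable_iUnion fun n => (hfin 1 n).countable).mono fun b _ => ?_
    exact Set.mem_iUnion.2 ⟨(SimpleGraph.mulCayley F).dist 1 b,
      show (SimpleGraph.mulCayley F).dist 1 b ≤ _ from le_rfl⟩
  have hnbr : ∀ a, {c | (conedOffCayleyGraph H S).Adj (inl a) (inr c)}.Finite := by
    intro a
    refine (Set.finite_range fun i => (⟨i, (a : Γ ⧸ H i)⟩ : Σ i, Γ ⧸ H i)).subset ?_
    rintro ⟨i, c⟩ hc
    have hc' : (a : Γ ⧸ H i) = c := (conedOffCayleyGraph_adj_inr (S := S)).1 hc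
    exact ⟨i, by rw [← hc']⟩
  have hD := SimpleGraph.dist_mulCayley_mul hFgen
  let FT := conedOffFlagTypes (viewParams δ) hX hD
  have hfinT := (finite_conedOffTypes (viewParams δ) hX fun o =>
    hX.finite_view hfin hnbr _ _).fintype
  obtain ⟨z₀, h₁, h₂⟩ := FT.exists_escaping hG hφ hX le_rfl hq₀ hq hsum
  have hΛ : (Set.range φ).Infinite := by
    intro h
    exact hinf h.to_subtype
  obtain ⟨c, hc⟩ := hX.exists_isLimitCone (P := viewParams δ) (by omega) (by simp [viewParams]; omega)
    (by simp [viewParams]; omega) hfin hnbr hΛ (o := 1) h₁ h₂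
  -- The image is invariant under its own translations, so `φ g • c` is again a limit cone, and
  -- uniqueness applies.
  have hfix : ∀ g, φ g • c = c := by
    intro g
    refine hX.isLimitCone_unique (P := viewParams δ) (by omega) (by simp [viewParams])
      (fun g => ⟨z₀ g, h₁ g⟩) (g := 1) ?_ hc
    refine hX.isLimitCone_of_base (by omega) (hc.smul
      (SimpleGraph.dist_smul hX.conn conedOffCayleyGraph_adj_smul) hD (h := φ g) ?_)
    rintro _ ⟨g', rfl⟩
    exact ⟨g * g', map_mul _ _ _⟩
  obtain ⟨i, c⟩ := c
  obtain ⟨γ, rfl⟩ := QuotientGroup.mk_surjective c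
  refine ⟨i, γ, ?_⟩
  rintro _ ⟨g, rfl⟩
  have h1 : ((φ g * γ : Γ) : Γ ⧸ H i) = (γ : Γ ⧸ H i) := by
    have h2 := hfix g
    rw [Sigma.smul_mk, Sigma.mk.injEq] at h2
    exact eq_of_heq h2.2
  refine ⟨γ⁻¹ * φ g * γ, ?_, ?_⟩
  · have := QuotientGroup.eq.1 h1.symm
    rwa [← mul_assoc] at this
  · simp [mul_assoc]
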